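/- A partial ring is a set $A$ with elements $0,1$, a commutative associative multiplication with unit $1$ satisfying $0\cdot a=0$, and a partially defined addition $+\colon A_2\to A$ on a set $A_2\subseteq A\times A$ of summable pairs, such that $+$ is commutative with unit $0$, is strictly associative (that is, $(a,b),(a+b,c)\in A_2$ if and only if $(b,c),(a,b+c)\in A_2$, and then $(a+b)+c=a+(b+c)$), and is preserved by multiplication by any element. A partial field is a partial ring with $0\neq 1$ in which every nonzero element is invertible. A field is a partial field in which every pair is summable, and $\mathbb F_1=\{0,1\}$ is the partial field in which $1+1$ is undefined. For a partial field $F$ let $\kappa=\kappa(F)$ be the cardinality of the set of $x\in F$ that are summable with $1$. Let $n\geq 0$, and let $$B=\mathbb F_1\langle y_0,\dots,y_n\mid \exists (y_0+\dots+y_n)\rangle$$ be the smallest partial subring of the polynomial semiring $\mathbb N[y_0,\dots,y_n]$ that contains every subsum of $y_0+\dots+y_n$ and in which $(a,b)$ is summable whenever $a+b$ is such a subsum. For $0\le i\le n$ let $A^{(i)}=\{y_i^{-r}f \mid r\ge 0,\ f\in B \text{ homogeneous of degree } r\}$ be the degree-$0$ part of the localization of $B$ at $y_i$, and for $0\le i,j\le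 n$ let $A^{(i,j)}=A^{(j,i)}$ be the degree-$0$ part of the localization of $B$ at $y_i$ and $y_j$. For a partial ring $A$ let $\operatorname{Spec}A$ be the set of prime ideals of $A$ with the Zariski topology and the sheaf of partial rings whose stalks are the localizations $A_{\mathfrak p}$; it is a locally partial-ringed space, and a partial scheme is a locally partial-ringed space which is locally of this form. Let $\mathbb P^n$ be the locally partial-ringed space obtained by gluing the $\operatorname{Spec}A^{(i)}$ along the $\operatorname{Spec}A^{(i,j)}$. Then $\mathbb P^n$ is a partial scheme, and for every partial field $F$ the set $\mathbb P^n(F)$ of morphisms $\operatorname{Spec}F\to\mathbb P^n$ of locally partial-ringed spaces has cardinality $$\#\mathbb P^n(F)=\kappa^n+\kappa^{n-1}+\dots+\kappa+1$$ (an equality of cardinal numbers, so that $F$ may be infinite). In particular, for a finite field $\mathbb F_q$ with $q$ elements, $\kappa(\mathbb F_q)=q$ and $\#\mathbb P^n(\mathbb F_q)=q^n+\dots+q+1$; and $\kappa(\mathbb F_1)=1$ and $\#\mathbb P^n(\mathbb F_1)=n+1$. -/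

import Mathlib

open TopologicalSpace

universe u v w

/-! ### Partial rings -/

/-- A (commutative, unital) partial ring.  The partially defined addition `+ : A₂ → A` is given by
its graph: `IsSum a b c` means that `(a, b) ∈ A₂` and `a + b = c`. -/
class PRing (A : Type u) extends CommMonoidWithZero A where
  IsSum : A → A → A → Prop
  isSum_unique : ∀ {a b c c' : A}, IsSum a b c → IsSum a b c' → c = c'
  zero_isSum : ∀ a : A, IsSum 0 a a
  isSum_comm : ∀ {a b c : A}, IsSum a b c → IsSum b a c
  /-- If `(a, b)` and `(a + b, c)` are summable, then so are `(b, c)` and `(a, b + c)`, and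
  `(a + b) + c = a + (b + c)`.  The converse implication follows by commutativity. -/
  isSum_assoc : ∀ {a b c d e : A}, IsSum a b d → IsSum d c e → ∃ f, IsSum b c f ∧ IsSum a f e
  isSum_mul : ∀ {a b c : A} (x : A), IsSum a b c → IsSum (a * x) (b * x) (c * x)

namespace PRing

/-- `(a, b)` belongs to the set `A₂` of summable pairs. -/
def Summ {A : Type u} [PRing A] (a b : A) : Prop := ∃ c, IsSum a b c

theorem isSum_assoc' {A : Type u} [PRing A] {a b c f e : A} (h₁ : IsSum b c f)
    (h₂ : IsSum a f e) : ∃ d, IsSum a b d ∧ IsSum d c e := by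
  obtain ⟨d, hd, hd'⟩ := isSum_assoc (isSum_comm h₁) (isSum_comm h₂)
  exact ⟨d, isSum_comm hd, isSum_comm hd'⟩

theorem mul_isSum {A : Type u} [PRing A] {a b c : A} (x : A) (h : IsSum a b c) :
    IsSum (x * a) (x * b) (x * c) := by
  simpa [mul_comm] using isSum_mul x h

/-- A commutative semiring as a partial ring: every pair is summable. -/
abbrev ofCommSemiring (R : Type u) [CommSemiring R] : PRing R where
  IsSum a b c := a + b = c
  isSum_unique := by rintro a b c c' rfl rfl; rfl
  zero_isSum := zero_add
  isSum_comm := by rintro a b c rfl; exact add_comm _ _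
  isSum_assoc := by rintro a b c d e rfl rfl; exact ⟨_, rfl, (add_assoc _ _ _).symm⟩
  isSum_mul := by rintro a b c x rfl; exact (add_mul _ _ _).symm

/-- A commutative monoid with zero as a partial ring: only `0 + a = a + 0 = a` is defined. -/
abbrev ofMonoid (M : Type u) [CommMonoidWithZero M] : PRing M where
  IsSum a b c := (a = 0 ∧ c = b) ∨ (b = 0 ∧ c = a)
  isSum_unique := by
    rintro a b c c' (⟨rfl, rfl⟩ | ⟨rfl, rfl⟩) (⟨h, rfl⟩ | ⟨h, rfl⟩) <;> simp_all
  zero_isSum a := Or.inl ⟨rfl, rfl⟩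
  isSum_comm := by
    rintro a b c (h | h)
    · exact Or.inr h
    · exact Or.inl h
  isSum_assoc := by
    rintro a b c d e (⟨rfl, rfl⟩ | ⟨rfl, rfl⟩) h
    · exact ⟨e, h, Or.inl ⟨rfl, rfl⟩⟩
    · exact ⟨c, Or.inl ⟨rfl, rfl⟩, h⟩
  isSum_mul := by
    rintro a b c x (⟨rfl, rfl⟩ | ⟨rfl, rfl⟩)
    · exact Or.inl ⟨zero_mul _, rfl⟩
    · exact Or.inr ⟨zero_mul _, rfl⟩

end PRing

open PRing

/-- The partial field `𝔽₁ = {0, 1}`, in which `1 + 1` is undefined. -/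
def FOne : Type := WithZero Unit

instance FOne.instCommMonoidWithZero : CommMonoidWithZero FOne :=
  inferInstanceAs (CommMonoidWithZero (WithZero Unit))

instance FOne.instPRing : PRing FOne := PRing.ofMonoid FOne

/-- A (nonzero) partial ring in which every nonzero element is invertible. -/
def IsPartialField (F : Type u) [PRing F] : Prop :=
  (0 : F) ≠ 1 ∧ ∀ a : F, a ≠ 0 → IsUnit a

/-- The number `κ` of elements that are summable with `1`. -/
noncomputable def kappa (F : Type u) [PRing F] : Cardinal.{u} :=
  Cardinal.mk {x : F // Summ 1 x}

/-- Homomorphisms of partial rings. -/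
structure PRingHom (A : Type u) (B : Type v) [PRing A] [PRing B] extends A →*₀ B where
  map_isSum' : ∀ {a b c : A}, IsSum a b c → IsSum (toFun a) (toFun b) (toFun c)

namespace PRingHom

variable {A : Type u} {B : Type v} {C : Type w} [PRing A] [PRing B] [PRing C]

instance : FunLike (PRingHom A B) A B where
  coe f := f.toFun
  coe_injective f g h := by
    cases f; cases g; congr; exact DFunLike.coe_injective h

instance : MonoidWithZeroHomClass (PRingHom A B) A B where
  map_mul f := f.map_mul'
  map_one f := f.map_one'
  map_zero f := f.map_zero'

theorem map_isSum (f : PRingHom A B) {a b c : A} (h : IsSum a b c) :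
    IsSum (f a) (f b) (f c) := f.map_isSum' h

/-- The composition `g ∘ f`. -/
def comp (g : PRingHom B C) (f : PRingHom A B) : PRingHom A C where
  toMonoidWithZeroHom := g.toMonoidWithZeroHom.comp f.toMonoidWithZeroHom
  map_isSum' h := g.map_isSum (f.map_isSum h)

end PRingHom

/-! ### Ideals and local partial rings -/

/-- Ideals of a partial ring. -/
@[ext]
structure PIdeal (A : Type u) [PRing A] where
  carrier : Set A
  zero_mem : (0 : A) ∈ carrier
  sum_mem : ∀ {a b c : A}, a ∈ carrier → b ∈ carrier → IsSum a b c → c ∈ carrier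
  mul_mem : ∀ (a : A) {x : A}, x ∈ carrier → a * x ∈ carrier

namespace PIdeal

variable {A : Type u} {B : Type v} [PRing A] [PRing B]

/-- The ideal `φ^*(J) = φ⁻¹(J)`. -/
def comap (φ : PRingHom A B) (J : PIdeal B) : PIdeal A where
  carrier := φ ⁻¹' J.carrier
  zero_mem := by simpa using J.zero_mem
  sum_mem ha hb h := J.sum_mem ha hb (φ.map_isSum h)
  mul_mem a x hx := by simpa using J.mul_mem (φ a) hx

/-- Prime ideals. -/
def IsPrime (I : PIdeal A) : Prop :=
  I.carrier ≠ Set.univ ∧ ∀ a b : A, a * b ∈ I.carrier → a ∈ I.carrier ∨ b ∈ I.carrier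

/-- Maximal ideals. -/
def IsMaximal (I : PIdeal A) : Prop :=
  I.carrier ≠ Set.univ ∧
    ∀ J : PIdeal A, J.carrier ≠ Set.univ → I.carrier ⊆ J.carrier → J = I

theorem one_notMem {I : PIdeal A} (h : I.carrier ≠ Set.univ) : (1 : A) ∉ I.carrier := by
  intro h1
  apply h
  ext a
  simpa using I.mul_mem a h1

end PIdeal

/-- A local partial ring: a partial ring with a unique maximal ideal. -/
def IsLocalPRing (A : Type u) [PRing A] : Prop :=
  ∃! I : PIdeal A, I.IsMaximal

/-- Local homomorphisms: `φ^*(𝔪_B) = 𝔪_A`. -/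
def PRingHom.IsLocal {A : Type u} {B : Type v} [PRing A] [PRing B] (φ : PRingHom A B) : Prop :=
  ∀ (I : PIdeal A) (J : PIdeal B), I.IsMaximal → J.IsMaximal → J.comap φ = I

theorem isLocalPRing_of_hom {A : Type u} {R : Type v} [PRing A] [PRing R] (φ : PRingHom A R)
    (hφ : ∀ a, IsUnit (φ a) → IsUnit a) (h0 : ¬ IsUnit (0 : R))
    (hR : ∀ a b c : R, IsSum a b c → IsUnit c → IsUnit a ∨ IsUnit b) : IsLocalPRing A := by
  let I : PIdeal A :=
    { carrier := {a | ¬ IsUnit (φ a)}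
      zero_mem := by simpa using h0
      sum_mem := fun {a b c} ha hb h hc => by
        rcases hR _ _ _ (φ.map_isSum h) hc with h | h
        · exact ha h
        · exact hb h
      mul_mem := fun a x hx h => hx (by
        rw [map_mul] at h
        exact isUnit_of_mul_isUnit_right h) }
  have hI : ∀ J : PIdeal A, J.carrier ≠ Set.univ → J.carrier ⊆ I.carrier := by
    intro J hJ a ha hu
    obtain ⟨b, hb⟩ := (hφ a hu).exists_left_inv
    exact PIdeal.one_notMem hJ (hb ▸ J.mul_mem b ha)
  have hI1 : I.carrier ≠ Set.univ := by
    intro h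
    have : (1 : A) ∈ I.carrier := h ▸ Set.mem_univ _
    exact this (by simp)
  refine ⟨I, ⟨hI1, fun J hJ hIJ => PIdeal.ext (Set.Subset.antisymm (hI J hJ) hIJ)⟩, ?_⟩
  intro J hJ
  exact (hJ.2 I hI1 (hI J hJ.1)).symm

/-! ### Localization -/

section Localization

variable {A : Type u} {B : Type v} [PRing A] [PRing B]

theorem mk_mul_left_cancel (S : Submonoid A) (t s : S) (a : A) :
    Localization.mk ((t : A) * a) (t * s) = Localization.mk a s := by
  rw [← Localization.mk_mul, Localization.mk_self, one_mul]

/-- Sums in the localization `S⁻¹ A`: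
`a / s + b / s = c / s` whenever `a + b = c`.  Equivalently, `a / s` and `b / t` are summable iff
there is `u ∈ S` such that `(u t a, u s b)` is summable (see `locIsSum_mk_iff`). -/
def LocIsSum (S : Submonoid A) (x y z : Localization S) : Prop :=
  ∃ (a b c : A) (s : S), IsSum a b c ∧
    x = Localization.mk a s ∧ y = Localization.mk b s ∧ z = Localization.mk c s

theorem locIsSum_mk_iff (S : Submonoid A) (a b : A) (s t : S) (z : Localization S) :
    LocIsSum S (Localization.mk a s) (Localization.mk b t) z ↔
      ∃ (u : S) (c : A), IsSum (u * (t * a)) (u * (s * b)) c ∧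
        z = Localization.mk c (u * (s * t)) := by
  constructor
  · rintro ⟨a', b', c', v, h, hx, hy, rfl⟩
    rw [Localization.mk_eq_mk_iff, Localization.r_iff_exists] at hx hy
    obtain ⟨p, hp⟩ := hx
    obtain ⟨q, hq⟩ := hy
    simp only at hp hq
    refine ⟨p * q * v, (p * q * s * t : A) * c', ?_, ?_⟩
    · have := mul_isSum (p * q * s * t : A) h
      convert this using 1
      · calc ((p * q * v : S) : A) * (t * a) = q * t * (p * (v * a)) := by
              simp only [Submonoid.coe_mul, mul_comm, mul_left_comm]
          _ = _ := by rw [hp]; simp only [mul_comm, mul_left_comm]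
      · calc ((p * q * v : S) : A) * (s * b) = p * s * (q * (v * b)) := by
              simp only [Submonoid.coe_mul, mul_comm, mul_left_comm]
          _ = _ := by rw [hq]; simp only [mul_comm, mul_left_comm]
    · rw [← mk_mul_left_cancel S (p * q * s * t) v c']
      congr 1
      ext
      simp only [Submonoid.coe_mul, mul_comm, mul_left_comm]
  · rintro ⟨u, c, h, rfl⟩
    refine ⟨_, _, c, u * (s * t), h, ?_, ?_, rfl⟩
    · rw [← mk_mul_left_cancel S (u * t) s a]
      congr 1
      · simp only [Submonoid.coe_mul, mul_comm, mul_left_comm]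
      · simp only [mul_comm, mul_left_comm]
    · rw [← mk_mul_left_cancel S (u * s) t b]
      congr 1
      · simp only [Submonoid.coe_mul, mul_comm, mul_left_comm]
      · simp only [mul_comm, mul_left_comm]

/-- The localization `S⁻¹ A` of a partial ring. -/
instance Localization.instPRing (S : Submonoid A) : PRing (Localization S) where
  IsSum := LocIsSum S
  isSum_unique := by
    rintro x y z z' ⟨a, b, c, s, h, rfl, rfl, rfl⟩ ⟨a', b', c', s', h', hx, hy, rfl⟩
    rw [Localization.mk_eq_mk_iff, Localization.r_iff_exists] at hx hy ⊢
    obtain ⟨p, hp⟩ := hx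
    obtain ⟨q, hq⟩ := hy
    refine ⟨p * q, ?_⟩
    simp only at hp hq ⊢
    have h₁ := mul_isSum (p * q * s' : A) h
    have h₂ := mul_isSum (p * q * s : A) h'
    have ea : (p * q * s' : A) * a = p * q * s * a' := by
      calc (p * q * s' : A) * a = q * (p * (s' * a)) := by simp only [mul_comm, mul_left_comm]
        _ = _ := by rw [hp]; simp only [mul_comm, mul_left_comm]
    have eb : (p * q * s' : A) * b = p * q * s * b' := by
      calc (p * q * s' : A) * b = p * (q * (s' * b)) := by simp only [mul_comm, mul_left_comm]
        _ = _ := by rw [hq]; simp only [mul_comm, mul_left_comm]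
    rw [ea, eb] at h₁
    have := isSum_unique h₁ h₂
    calc _ = (p * q * s' : A) * c := by
          simp only [Submonoid.coe_mul, mul_assoc]
      _ = _ := by
          rw [this]; simp only [Submonoid.coe_mul, mul_assoc]
  zero_isSum x := by
    induction x using Localization.induction_on with
    | H y => exact ⟨0, y.1, y.1, y.2, zero_isSum _, (Localization.mk_zero _).symm, rfl, rfl⟩
  isSum_comm := by
    rintro x y z ⟨a, b, c, s, h, rfl, rfl, rfl⟩
    exact ⟨b, a, c, s, isSum_comm h, rfl, rfl, rfl⟩
  isSum_assoc := by
    rintro x y z d e ⟨a, b, c, s, h, rfl, rfl, rfl⟩ h'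
    induction z using Localization.induction_on with
    | H z =>
      obtain ⟨z, t⟩ := z
      rw [locIsSum_mk_iff] at h'
      obtain ⟨u, w, hw, rfl⟩ := h'
      have h₁ := mul_isSum (u * t : A) h
      simp only [mul_assoc] at h₁
      obtain ⟨f, hf, hf'⟩ := isSum_assoc h₁ hw
      refine ⟨Localization.mk f (u * (s * t)), ?_, ?_⟩
      · rw [locIsSum_mk_iff]
        exact ⟨u, f, hf, rfl⟩
      · refine ⟨_, _, _, u * (s * t), hf', ?_, rfl, rfl⟩
        rw [← mk_mul_left_cancel S (u * t) s a]
        congr 1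
        · simp only [Submonoid.coe_mul, mul_comm, mul_left_comm]
        · simp only [mul_comm, mul_left_comm]
  isSum_mul := by
    rintro x y z w ⟨a, b, c, s, h, rfl, rfl, rfl⟩
    induction w using Localization.induction_on with
    | H w =>
      refine ⟨a * w.1, b * w.1, c * w.1, s * w.2, isSum_mul _ h, ?_, ?_, ?_⟩ <;>
        exact Localization.mk_mul _ _ _ _

/-- The homomorphism `S⁻¹ A → T⁻¹ B`, `a / s ↦ φ a / φ s`, induced by `φ : A → B` with
`φ S ⊆ T`. -/
def locMap (φ : PRingHom A B) (S : Submonoid A) (T : Submonoid B) (h : ∀ s ∈ S, φ s ∈ T) :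
    PRingHom (Localization S) (Localization T) where
  toFun x := x.liftOn (fun a s => Localization.mk (φ a) ⟨φ s, h s s.2⟩) (by
    intro a c b d hr
    rw [Localization.r_iff_exists] at hr
    obtain ⟨p, hp⟩ := hr
    rw [Localization.mk_eq_mk_iff, Localization.r_iff_exists]
    exact ⟨⟨φ p, h p p.2⟩, by simpa using congrArg φ hp⟩)
  map_zero' := by
    rw [← Localization.mk_zero (1 : S), Localization.liftOn_mk, map_zero, Localization.mk_zero]
  map_one' := by
    rw [← Localization.mk_one, Localization.liftOn_mk, ← Localization.mk_one]
    congr 1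
    · simp
    · ext; simp
  map_mul' x y := by
    induction x using Localization.induction_on with
    | H x =>
      induction y using Localization.induction_on with
      | H y =>
        simp only [Localization.mk_mul, Localization.liftOn_mk, map_mul]
        congr 1
        ext; simp
  map_isSum' := by
    rintro x y z ⟨a, b, c, s, h', rfl, rfl, rfl⟩
    exact ⟨φ a, φ b, φ c, ⟨φ s, h s s.2⟩, φ.map_isSum h', rfl, rfl, rfl⟩

theorem locMap_mk (φ : PRingHom A B) (S : Submonoid A) (T : Submonoid B)
    (h : ∀ s ∈ S, φ s ∈ T) (a : A) (s : S) :
    locMap φ S T h (Localization.mk a s) = Localization.mk (φ a) ⟨φ s, h s s.2⟩ := rfl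

end Localization

/-! ### The prime spectrum -/

/-- The set of prime ideals of `A`. -/
@[ext]
structure PSpec (A : Type u) [PRing A] : Type u where
  ideal : PIdeal A
  isPrime : ideal.IsPrime

namespace PSpec

variable {A : Type u} {B : Type v} [PRing A] [PRing B]

/-- The set `D(a)` of primes not containing `a`. -/
def basicSet (a : A) : Set (PSpec A) := {p | a ∉ p.ideal.carrier}

/-- The Zariski topology, generated by the sets `D(a)`. -/
instance instTop : TopologicalSpace (PSpec A) :=
  generateFrom (Set.range basicSet)

/-- `D(a)` as an open set. -/
def basicOpen (a : A) : Opens (PSpec A) :=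
  ⟨basicSet a, isOpen_generateFrom_of_mem ⟨a, rfl⟩⟩

/-- The multiplicative set `A ∖ 𝔭`. -/
def compl (p : PSpec A) : Submonoid A where
  carrier := {a | a ∉ p.ideal.carrier}
  one_mem' := PIdeal.one_notMem p.isPrime.1
  mul_mem' ha hb h := (p.isPrime.2 _ _ h).elim ha hb

/-- The localization `A_𝔭`. -/
abbrev LocalAt (p : PSpec A) : Type u := Localization p.compl

/-- The map `Spec B → Spec A`, `𝔮 ↦ φ⁻¹ 𝔮`. -/
def comap (φ : PRingHom A B) (q : PSpec B) : PSpec A :=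
  ⟨q.ideal.comap φ, by
    refine ⟨fun h => PIdeal.one_notMem q.isPrime.1 ?_, fun a b h => q.isPrime.2 _ _ ?_⟩
    · have : (1 : A) ∈ (q.ideal.comap φ).carrier := h ▸ Set.mem_univ _
      simpa [PIdeal.comap] using this
    · simpa [PIdeal.comap] using h⟩

/-- The homomorphism `A_{φ⁻¹ 𝔮} → B_𝔮`. -/
def localMap (φ : PRingHom A B) (q : PSpec B) :
    PRingHom (LocalAt (comap φ q)) (LocalAt q) :=
  locMap φ _ _ fun _ hs => hs

theorem isUnit_mk_iff (p : PSpec A) (a : A) (s : p.compl) :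
    IsUnit (Localization.mk a s : LocalAt p) ↔ a ∉ p.ideal.carrier := by
  constructor
  · intro h ha
    obtain ⟨y, hy⟩ := h.exists_right_inv
    induction y using Localization.induction_on with
    | H y =>
      rw [Localization.mk_mul, ← Localization.mk_one, Localization.mk_eq_mk_iff,
        Localization.r_iff_exists] at hy
      obtain ⟨c, hc⟩ := hy
      have h1 : (c : A) * (y.2 * s) ∈ p.compl :=
        p.compl.mul_mem c.2 (p.compl.mul_mem y.2.2 s.2)
      apply h1
      have h2 := p.ideal.mul_mem (c * y.1 : A) ha
      have h3 : (c * y.1 : A) * a = c * (y.2 * s) := by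
        simp only [Submonoid.coe_one, one_mul, mul_one] at hc
        push_cast at hc
        rw [mul_assoc, mul_comm y.1 a, hc, mul_comm (s : A)]
      rwa [h3] at h2
  · intro ha
    refine IsUnit.of_mul_eq_one (Localization.mk (s : A) (⟨a, ha⟩ : p.compl)) ?_
    rw [Localization.mk_mul, ← Localization.mk_self (s * ⟨a, ha⟩ : p.compl)]
    congr 1
    push_cast
    exact mul_comm _ _

theorem isUnit_localMap_iff (φ : PRingHom A B) (q : PSpec B) (x : LocalAt (comap φ q)) :
    IsUnit (localMap φ q x) ↔ IsUnit x := by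
  induction x using Localization.induction_on with
  | H x =>
    exact (isUnit_mk_iff q (φ x.1) ⟨φ x.2, x.2.2⟩).trans
      (isUnit_mk_iff (comap φ q) x.1 x.2).symm

theorem localAt_not_isUnit_zero (p : PSpec A) : ¬ IsUnit (0 : LocalAt p) := by
  rw [← Localization.mk_zero (1 : p.compl), isUnit_mk_iff]
  exact fun h => h p.ideal.zero_mem

theorem localAt_isUnit_or (p : PSpec A) (a b c : LocalAt p) (h : IsSum a b c)
    (hc : IsUnit c) : IsUnit a ∨ IsUnit b := by
  obtain ⟨a, b, c, s, h, rfl, rfl, rfl⟩ := h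
  rw [isUnit_mk_iff] at hc ⊢
  rw [isUnit_mk_iff]
  by_contra hab
  rw [not_or, not_not, not_not] at hab
  exact hc (p.ideal.sum_mem hab.1 hab.2 h)

end PSpec

/-! ### Locally partial-ringed spaces -/

/-- A topological space with a sheaf of partial rings.  Being a sheaf of partial rings means that
both the elements and the sums of sections can be glued. -/
structure PRingedSpace : Type (u + 1) where
  carrier : Type u
  [top : TopologicalSpace carrier]
  sec : Opens carrier → Type u
  [ring : ∀ U, PRing (sec U)]
  res : ∀ (U V : Opens carrier), V ≤ U → PRingHom (sec U) (sec V)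
  res_self : ∀ (U : Opens carrier) (s : sec U), res U U le_rfl s = s
  res_res : ∀ (U V W : Opens carrier) (hVU : V ≤ U) (hWV : W ≤ V) (s : sec U),
    res V W hWV (res U V hVU s) = res U W (hWV.trans hVU) s
  eq_of_local : ∀ (U : Opens carrier) (s t : sec U),
    (∀ x ∈ U, ∃ (V : Opens carrier) (h : V ≤ U), x ∈ V ∧ res U V h s = res U V h t) → s = t
  isSum_of_local : ∀ (U : Opens carrier) (s t r : sec U),
    (∀ x ∈ U, ∃ (V : Opens carrier) (h : V ≤ U), x ∈ V ∧
      IsSum (res U V h s) (res U V h t) (res U V h r)) → IsSum s t r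
  exists_glue : ∀ (ι : Type u) (U : ι → Opens carrier) (s : ∀ i, sec (U i)),
    (∀ i j, res (U i) (U i ⊓ U j) inf_le_left (s i) = res (U j) (U i ⊓ U j) inf_le_right (s j)) →
      ∃ t : sec (⨆ i, U i), ∀ i, res (⨆ i, U i) (U i) (le_iSup U i) t = s i

namespace PRingedSpace

attribute [instance] PRingedSpace.top PRingedSpace.ring

variable (X : PRingedSpace.{u})

/-- The sections over an open neighbourhood of `x`; neighbourhoods are ordered by `⊇`. -/
abbrev nhdsSec (x : X.carrier) (U : (OpenNhdsOf x)ᵒᵈ) : Type u :=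
  X.sec (OrderDual.ofDual U).toOpens

/-- The restriction maps between the sections over the open neighbourhoods of `x`. -/
abbrev nhdsRes (x : X.carrier) (U V : (OpenNhdsOf x)ᵒᵈ) (h : U ≤ V) :
    PRingHom (X.nhdsSec x U) (X.nhdsSec x V) :=
  X.res _ _ h

instance (x : X.carrier) : DirectedSystem (X.nhdsSec x) (X.nhdsRes x · · ·) where
  map_self _ s := X.res_self _ s
  map_map _ _ _ h₁ h₂ s := X.res_res _ _ _ h₁ h₂ s

/-- The stalk at `x`: the direct limit of the sections over the open neighbourhoods of `x`. -/
def stalk (x : X.carrier) : Type u := DirectLimit (X.nhdsSec x) (X.nhdsRes x)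

noncomputable instance (x : X.carrier) : CommMonoidWithZero (X.stalk x) :=
  { (inferInstance : MonoidWithZero (DirectLimit (X.nhdsSec x) (X.nhdsRes x))) with
    mul_comm := (inferInstance :
      CommMonoid (DirectLimit (X.nhdsSec x) (X.nhdsRes x))).mul_comm }

/-- The germ at `x` of a section over a neighbourhood of `x`. -/
def germ {x : X.carrier} (U : Opens X.carrier) (hx : x ∈ U) (s : X.sec U) : X.stalk x :=
  Quotient.mk _ ⟨OrderDual.toDual ⟨U, hx⟩, s⟩

variable {X}

theorem germ_res {x : X.carrier} (U V : Opens X.carrier) (h : V ≤ U) (hx : x ∈ V)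
    (s : X.sec U) : X.germ V hx (X.res U V h s) = X.germ U (h hx) s :=
  DirectLimit.mk_apply (F := X.nhdsSec x) (f := X.nhdsRes x)
    (OrderDual.toDual ⟨U, h hx⟩) (OrderDual.toDual ⟨V, hx⟩) s h

theorem exists_germ {x : X.carrier} (a : X.stalk x) :
    ∃ (U : Opens X.carrier) (hx : x ∈ U) (s : X.sec U), a = X.germ U hx s := by
  obtain ⟨U, s, rfl⟩ := DirectLimit.exists_eq_mk (f := X.nhdsRes x) a
  exact ⟨_, (OrderDual.ofDual U).2, s, rfl⟩

theorem germ_eq_iff {x : X.carrier} (U V : Opens X.carrier) (hU : x ∈ U) (hV : x ∈ V)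
    (s : X.sec U) (t : X.sec V) : X.germ U hU s = X.germ V hV t ↔
      ∃ (W : Opens X.carrier) (hWU : W ≤ U) (hWV : W ≤ V), x ∈ W ∧
        X.res U W hWU s = X.res V W hWV t := by
  constructor
  · intro h
    obtain ⟨W, h₁, h₂, h₃⟩ := Quotient.exact h
    exact ⟨_, h₁, h₂, (OrderDual.ofDual W).2, h₃⟩
  · rintro ⟨W, h₁, h₂, hx, h₃⟩
    rw [← germ_res U W h₁ hx, ← germ_res V W h₂ hx, h₃]

theorem germ_mul {x : X.carrier} (U : Opens X.carrier) (hx : x ∈ U) (s t : X.sec U) :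
    X.germ U hx (s * t) = X.germ U hx s * X.germ U hx t :=
  (DirectLimit.mul_def (G := X.nhdsSec x) (f := X.nhdsRes x) (OrderDual.toDual ⟨U, hx⟩) s t).symm

theorem germ_one {x : X.carrier} (U : Opens X.carrier) (hx : x ∈ U) :
    X.germ U hx 1 = 1 :=
  (DirectLimit.one_def (G := X.nhdsSec x) (f := X.nhdsRes x) (OrderDual.toDual ⟨U, hx⟩)).symm

theorem germ_zero {x : X.carrier} (U : Opens X.carrier) (hx : x ∈ U) :
    X.germ U hx 0 = 0 :=
  (DirectLimit.zero_def (G := X.nhdsSec x) (f := X.nhdsRes x) (OrderDual.toDual ⟨U, hx⟩)).symm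

/-- The partial ring structure of a stalk: sums of germs are germs of sums. -/
noncomputable instance (x : X.carrier) : PRing (X.stalk x) where
  IsSum a b c := ∃ (U : Opens X.carrier) (hx : x ∈ U) (r s t : X.sec U), IsSum r s t ∧
    a = X.germ U hx r ∧ b = X.germ U hx s ∧ c = X.germ U hx t
  isSum_unique := by
    rintro a b c c' ⟨U, hU, r, s, t, h, rfl, rfl, rfl⟩ ⟨V, hV, r', s', t', h', hr, hs, rfl⟩
    rw [germ_eq_iff] at hr hs ⊢
    obtain ⟨W, hWU, hWV, hxW, e⟩ := hr
    obtain ⟨W', hWU', hWV', hxW', e'⟩ := hs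
    refine ⟨W ⊓ W', inf_le_left.trans hWU, inf_le_left.trans hWV, ⟨hxW, hxW'⟩, ?_⟩
    have h₁ := (X.res U (W ⊓ W') (inf_le_left.trans hWU)).map_isSum h
    have h₂ := (X.res V (W ⊓ W') (inf_le_left.trans hWV)).map_isSum h'
    have e₁ := congrArg (X.res W (W ⊓ W') inf_le_left) e
    have e₂ := congrArg (X.res W' (W ⊓ W') inf_le_right) e'
    rw [X.res_res, X.res_res] at e₁ e₂
    rw [e₁, e₂] at h₁
    exact isSum_unique h₁ h₂
  zero_isSum a := by
    obtain ⟨U, hx, s, rfl⟩ := exists_germ a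
    exact ⟨U, hx, 0, s, s, zero_isSum s, (germ_zero U hx).symm, rfl, rfl⟩
  isSum_comm := by
    rintro a b c ⟨U, hU, r, s, t, h, rfl, rfl, rfl⟩
    exact ⟨U, hU, s, r, t, isSum_comm h, rfl, rfl, rfl⟩
  isSum_assoc := by
    rintro a b c d e ⟨U, hU, r, s, t, h, rfl, rfl, rfl⟩ ⟨V, hV, r', s', t', h', hr, rfl, rfl⟩
    rw [germ_eq_iff] at hr
    obtain ⟨W, hWU, hWV, hxW, e⟩ := hr
    have h₁ := (X.res U W hWU).map_isSum h
    have h₂ := (X.res V W hWV).map_isSum h'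
    rw [e] at h₁
    obtain ⟨f, hf, hf'⟩ := isSum_assoc h₁ h₂
    exact ⟨X.germ W hxW f,
      ⟨W, hxW, _, _, _, hf, (germ_res U W hWU hxW s).symm, (germ_res V W hWV hxW s').symm, rfl⟩,
      ⟨W, hxW, _, _, _, hf', (germ_res U W hWU hxW r).symm, rfl, (germ_res V W hWV hxW t').symm⟩⟩
  isSum_mul := by
    rintro a b c y ⟨U, hU, r, s, t, h, rfl, rfl, rfl⟩
    obtain ⟨V, hV, z, rfl⟩ := exists_germ y
    have key : ∀ q : X.sec U, X.germ U hU q * X.germ V hV z =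
        X.germ (U ⊓ V) ⟨hU, hV⟩ (X.res U (U ⊓ V) inf_le_left q *
          X.res V (U ⊓ V) inf_le_right z) := fun q => by
      rw [← germ_res U (U ⊓ V) inf_le_left ⟨hU, hV⟩, ← germ_res V (U ⊓ V) inf_le_right ⟨hU, hV⟩]
      exact (germ_mul _ _ _ _).symm
    exact ⟨U ⊓ V, ⟨hU, hV⟩, _, _, _,
      isSum_mul (X.res V (U ⊓ V) inf_le_right z) ((X.res U (U ⊓ V) inf_le_left).map_isSum h),
      key r, key s, key t⟩

/-- The homomorphism from a stalk induced by a compatible family of homomorphisms. -/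
noncomputable def stalkLift {x : X.carrier} {R : Type v} [PRing R]
    (φ : ∀ U : Opens X.carrier, x ∈ U → PRingHom (X.sec U) R)
    (hφ : ∀ (U V : Opens X.carrier) (h : V ≤ U) (hx : x ∈ V) (s : X.sec U),
      φ U (h hx) s = φ V hx (X.res U V h s)) : PRingHom (X.stalk x) R where
  toFun := DirectLimit.lift (X.nhdsRes x)
    (fun U s => φ (OrderDual.ofDual U).toOpens (OrderDual.ofDual U).2 s)
    (fun U V h s => hφ (OrderDual.ofDual U).toOpens (OrderDual.ofDual V).toOpens h
      (OrderDual.ofDual V).2 s)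
  map_zero' := by
    rw [← germ_zero (⊤ : Opens X.carrier) (Opens.mem_top x)]
    exact map_zero (φ ⊤ (Opens.mem_top x))
  map_one' := by
    rw [← germ_one (⊤ : Opens X.carrier) (Opens.mem_top x)]
    exact map_one (φ ⊤ (Opens.mem_top x))
  map_mul' a b := by
    obtain ⟨U, hU, s, rfl⟩ := exists_germ a
    obtain ⟨V, hV, t, rfl⟩ := exists_germ b
    rw [← germ_res U (U ⊓ V) inf_le_left ⟨hU, hV⟩, ← germ_res V (U ⊓ V) inf_le_right ⟨hU, hV⟩]
    have h := map_mul (φ (U ⊓ V) ⟨hU, hV⟩) (X.res U (U ⊓ V) inf_le_left s)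
      (X.res V (U ⊓ V) inf_le_right t)
    exact (congrArg _ (germ_mul (U ⊓ V) ⟨hU, hV⟩ _ _).symm).trans h
  map_isSum' := by
    rintro a b c ⟨U, hU, r, s, t, h, rfl, rfl, rfl⟩
    exact (φ U hU).map_isSum h

theorem stalkLift_germ {x : X.carrier} {R : Type v} [PRing R]
    (φ : ∀ U : Opens X.carrier, x ∈ U → PRingHom (X.sec U) R)
    (hφ : ∀ (U V : Opens X.carrier) (h : V ≤ U) (hx : x ∈ V) (s : X.sec U),
      φ U (h hx) s = φ V hx (X.res U V h s)) (U : Opens X.carrier) (hx : x ∈ U) (s : X.sec U) :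
    stalkLift φ hφ (X.germ U hx s) = φ U hx s := rfl

variable (X) in
/-- The homomorphism sending a section to its germ at `x`. -/
noncomputable def germHom {x : X.carrier} (U : Opens X.carrier) (hx : x ∈ U) :
    PRingHom (X.sec U) (X.stalk x) where
  toFun := X.germ U hx
  map_zero' := germ_zero U hx
  map_one' := germ_one U hx
  map_mul' := germ_mul U hx
  map_isSum' h := ⟨U, hx, _, _, _, h, rfl, rfl, rfl⟩

end PRingedSpace

/-- A locally partial-ringed space: all stalks are local partial rings. -/
structure LPRingedSpace : Type (u + 1) extends PRingedSpace.{u} where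
  isLocal_stalk : ∀ x : carrier, IsLocalPRing (toPRingedSpace.stalk x)

namespace LPRingedSpace

/-- Morphisms of locally partial-ringed spaces: a continuous map `f : X → Y` with a homomorphism of
sheaves of partial rings `𝒪_Y → f_* 𝒪_X` that induces local homomorphisms on stalks. -/
structure Hom (X : LPRingedSpace.{u}) (Y : LPRingedSpace.{v}) where
  base : C(X.carrier, Y.carrier)
  app : ∀ V : Opens Y.carrier, PRingHom (Y.sec V) (X.sec (V.comap base))
  app_res : ∀ (V W : Opens Y.carrier) (h : W ≤ V) (s : Y.sec V),
    app W (Y.res V W h s) =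
      X.res (V.comap base) (W.comap base) (Opens.comap_mono base h) (app V s)
  isLocal_stalkMap : ∀ x : X.carrier,
    (PRingedSpace.stalkLift (X := Y.toPRingedSpace) (x := base x)
      (fun V hV => (X.germHom (x := x) (V.comap base) hV).comp (app V))
      (fun V W h hx s => by
        change X.germ _ _ (app V s) = X.germ _ _ (app W (Y.res V W h s))
        rw [app_res]
        exact (PRingedSpace.germ_res _ _ (Opens.comap_mono base h) hx _).symm)).IsLocal

/-- Open immersions: open embeddings such that `𝒪_Y(V) → 𝒪_X(f⁻¹ V)` is an isomorphism of partial
rings for all open `V` contained in the image. -/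
structure Hom.IsOpenImmersion {X : LPRingedSpace.{u}} {Y : LPRingedSpace.{v}} (f : Hom X Y) :
    Prop where
  isOpenEmbedding : Topology.IsOpenEmbedding f.base
  bijective : ∀ V : Opens Y.carrier, (V : Set Y.carrier) ⊆ Set.range f.base →
    Function.Bijective (f.app V)
  isSum_iff : ∀ V : Opens Y.carrier, (V : Set Y.carrier) ⊆ Set.range f.base →
    ∀ a b c : Y.sec V, IsSum (f.app V a) (f.app V b) (f.app V c) ↔ IsSum a b c

end LPRingedSpace

/-! ### Sheaves of functions with values in local partial rings -/

/-- Data for a sheaf whose sections over `U ⊆ X` are functions on the preimage of `U` under a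
surjection `proj : E → X`, with values in given local partial rings `R e`, that satisfy a local
condition `P`. -/
structure FunSheafData : Type (u + 1) where
  X : Type u
  [top : TopologicalSpace X]
  E : Type u
  proj : E → X
  proj_surj : Function.Surjective proj
  R : E → Type u
  [ring : ∀ e, PRing (R e)]
  not_isUnit_zero : ∀ e, ¬ IsUnit (0 : R e)
  isUnit_or : ∀ (e : E) (a b c : R e), IsSum a b c → IsUnit c → IsUnit a ∨ IsUnit b
  P : ∀ U : Opens X, (∀ e, proj e ∈ U → R e) → Prop
  P_res : ∀ (U V : Opens X) (h : V ≤ U) (s : ∀ e, proj e ∈ U → R e), P U s →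
    P V (fun e he => s e (h he))
  P_local : ∀ (U : Opens X) (s : ∀ e, proj e ∈ U → R e),
    (∀ x ∈ U, ∃ (V : Opens X) (h : V ≤ U), x ∈ V ∧ P V (fun e he => s e (h he))) → P U s
  P_zero : ∀ U : Opens X, P U (fun _ _ => 0)
  P_one : ∀ U : Opens X, P U (fun _ _ => 1)
  P_mul : ∀ (U : Opens X) (s t : ∀ e, proj e ∈ U → R e), P U s → P U t →
    P U (fun e he => s e he * t e he)
  P_sum : ∀ (U : Opens X) (s t r : ∀ e, proj e ∈ U → R e), P U s → P U t →
    (∀ e he, IsSum (s e he) (t e he) (r e he)) → P U r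
  P_inv : ∀ (U : Opens X) (s : ∀ e, proj e ∈ U → R e), P U s → ∀ (e : E) (he : proj e ∈ U),
    IsUnit (s e he) → ∃ (V : Opens X) (h : V ≤ U) (t : ∀ e, proj e ∈ V → R e),
      proj e ∈ V ∧ P V t ∧ ∀ e' he', s e' (h he') * t e' he' = 1

namespace FunSheafData

attribute [instance] FunSheafData.top FunSheafData.ring

variable (D : FunSheafData.{u})

/-- The sections over `U`. -/
def Sec (U : Opens D.X) : Type u := {s : ∀ e, D.proj e ∈ U → D.R e // D.P U s}

variable {D} in
@[ext]
theorem Sec.ext {U : Opens D.X} {s t : D.Sec U} (h : ∀ e he, s.1 e he = t.1 e he) : s = t :=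
  Subtype.ext (funext fun e => funext fun he => h e he)

/-- The sections over `U` form a partial ring with the pointwise operations; two sections are
summable if and only if all their values are. -/
instance (U : Opens D.X) : PRing (D.Sec U) where
  mul s t := ⟨fun e he => s.1 e he * t.1 e he, D.P_mul U _ _ s.2 t.2⟩
  one := ⟨fun _ _ => 1, D.P_one U⟩
  zero := ⟨fun _ _ => 0, D.P_zero U⟩
  mul_assoc _ _ _ := Sec.ext fun _ _ => mul_assoc _ _ _
  mul_comm _ _ := Sec.ext fun _ _ => mul_comm _ _
  one_mul _ := Sec.ext fun _ _ => one_mul _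
  mul_one _ := Sec.ext fun _ _ => mul_one _
  zero_mul _ := Sec.ext fun _ _ => zero_mul _
  mul_zero _ := Sec.ext fun _ _ => mul_zero _
  IsSum s t r := ∀ e he, IsSum (s.1 e he) (t.1 e he) (r.1 e he)
  isSum_unique h h' := Sec.ext fun e he => isSum_unique (h e he) (h' e he)
  zero_isSum _ _ _ := zero_isSum _
  isSum_comm h e he := isSum_comm (h e he)
  isSum_assoc {a b c d f} h h' := by
    have H := fun e he => isSum_assoc (h e he) (h' e he)
    choose g hg hg' using H
    exact ⟨⟨g, D.P_sum U _ _ _ b.2 c.2 hg⟩, hg, hg'⟩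
  isSum_mul _ h e he := isSum_mul _ (h e he)

/-- The restriction maps. -/
def secRes (U V : Opens D.X) (h : V ≤ U) : PRingHom (D.Sec U) (D.Sec V) where
  toFun s := ⟨fun e he => s.1 e (h he), D.P_res U V h s.1 s.2⟩
  map_zero' := rfl
  map_one' := rfl
  map_mul' _ _ := rfl
  map_isSum' H e he := H e (h he)

/-- The resulting space with a sheaf of partial rings. -/
abbrev toPRingedSpace : PRingedSpace.{u} where
  carrier := D.X
  sec := D.Sec
  res := D.secRes
  res_self _ _ := rfl
  res_res _ _ _ _ _ _ := rfl
  eq_of_local U s t h := Sec.ext fun e he => by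
    obtain ⟨V, hV, hx, H⟩ := h _ he
    exact congrFun (congrFun (congrArg Subtype.val H) e) hx
  isSum_of_local U s t r h e he := by
    obtain ⟨V, hV, hx, H⟩ := h _ he
    exact H e hx
  exists_glue ι U s h := by
    have key : ∀ i j e (hi : D.proj e ∈ U i) (hj : D.proj e ∈ U j),
        (s i).1 e hi = (s j).1 e hj := fun i j e hi hj =>
      congrFun (congrFun (congrArg Subtype.val (h i j)) e) ⟨hi, hj⟩
    have hex : ∀ e, D.proj e ∈ (⨆ i, U i) → ∃ i, D.proj e ∈ U i := fun e he => by
      simpa using he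
    choose k hk using hex
    refine ⟨⟨fun e he => (s (k e he)).1 e (hk e he), D.P_local _ _ ?_⟩, ?_⟩
    · intro x hx
      obtain ⟨i, hi⟩ : ∃ i, x ∈ U i := by simpa using hx
      refine ⟨U i, le_iSup U i, hi, ?_⟩
      convert (s i).2 using 1
      funext e he
      exact key _ _ _ _ _
    · intro i
      exact Sec.ext fun e he => key _ _ _ _ _

/-- The value at `e` of a germ. -/
noncomputable def stalkEval (e : D.E) :
    PRingHom (D.toPRingedSpace.stalk (D.proj e)) (D.R e) :=
  PRingedSpace.stalkLift (X := D.toPRingedSpace)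
    (fun U he =>
      { toFun := fun s : D.Sec U => s.1 e he
        map_zero' := rfl
        map_one' := rfl
        map_mul' := fun _ _ => rfl
        map_isSum' := fun H => H e he })
    (fun _ _ _ _ _ => rfl)

theorem isUnit_of_stalkEval (e : D.E) (a : D.toPRingedSpace.stalk (D.proj e))
    (ha : IsUnit (D.stalkEval e a)) : IsUnit a := by
  obtain ⟨U, hU, s, rfl⟩ := PRingedSpace.exists_germ a
  obtain ⟨V, hVU, t, hV, hP, ht⟩ := D.P_inv U s.1 s.2 e hU ha
  rw [← PRingedSpace.germ_res U V hVU hV]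
  let t' : D.Sec V := ⟨t, hP⟩
  have h : D.secRes U V hVU s * t' = 1 := Sec.ext fun e' he' => ht e' he'
  refine IsUnit.of_mul_eq_one (D.toPRingedSpace.germ V hV t') ?_
  exact (PRingedSpace.germ_mul (X := D.toPRingedSpace) V hV (D.secRes U V hVU s) t').symm.trans
    ((congrArg (D.toPRingedSpace.germ V hV) h).trans
      (PRingedSpace.germ_one (X := D.toPRingedSpace) V hV))

/-- The resulting locally partial-ringed space. -/
abbrev toLPRingedSpace : LPRingedSpace.{u} where
  toPRingedSpace := D.toPRingedSpace
  isLocal_stalk x := by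
    obtain ⟨e, rfl⟩ := D.proj_surj x
    exact isLocalPRing_of_hom (D.stalkEval e) (D.isUnit_of_stalkEval e) (D.not_isUnit_zero e)
      (D.isUnit_or e)

end FunSheafData

/-! ### Affine partial schemes -/

section Spec

variable {A : Type u} [PRing A]

/-- The sections of the structure sheaf of `Spec A` over `U`: functions `𝔭 ↦ s(𝔭) ∈ A_𝔭` which are
locally given by fractions `a / f`, with `f` in none of the primes of a neighbourhood.  This is the
sheafification of `U ↦ S_U⁻¹ A`, `S_U = {f | f ∉ 𝔭 for all 𝔭 ∈ U}`. -/
def IsLocFrac (U : Opens (PSpec A)) (s : ∀ p : PSpec A, p ∈ U → p.LocalAt) : Prop :=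
  ∀ p ∈ U, ∃ (V : Opens (PSpec A)) (a f : A), p ∈ V ∧ ∀ q ∈ V, ∃ hf : f ∈ q.compl,
    ∀ hU : q ∈ U, s q hU = Localization.mk a ⟨f, hf⟩

theorem IsLocFrac.res {U V : Opens (PSpec A)} (h : V ≤ U) {s : ∀ p : PSpec A, p ∈ U → p.LocalAt}
    (hs : IsLocFrac U s) : IsLocFrac V (fun p hp => s p (h hp)) := by
  intro p hp
  obtain ⟨W, a, f, hpW, H⟩ := hs p (h hp)
  exact ⟨W, a, f, hpW, fun q hq => ⟨(H q hq).1, fun hU => (H q hq).2 (h hU)⟩⟩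

theorem IsLocFrac.of_local {U : Opens (PSpec A)} {s : ∀ p : PSpec A, p ∈ U → p.LocalAt}
    (hs : ∀ p ∈ U, ∃ (V : Opens (PSpec A)) (h : V ≤ U), p ∈ V ∧
      IsLocFrac V (fun q hq => s q (h hq))) : IsLocFrac U s := by
  intro p hp
  obtain ⟨V, hVU, hpV, H⟩ := hs p hp
  obtain ⟨W, a, f, hpW, H'⟩ := H p hpV
  exact ⟨W ⊓ V, a, f, ⟨hpW, hpV⟩, fun q hq => ⟨(H' q hq.1).1, fun _ => (H' q hq.1).2 hq.2⟩⟩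

theorem IsLocFrac.const (U : Opens (PSpec A)) (a : A) :
    IsLocFrac U (fun p _ => Localization.mk a (1 : p.compl)) :=
  fun p _ => ⟨⊤, a, 1, Opens.mem_top p, fun q _ => ⟨q.compl.one_mem, fun _ => rfl⟩⟩

theorem IsLocFrac.zero (U : Opens (PSpec A)) :
    IsLocFrac U (fun _ _ => 0) := by
  have h := IsLocFrac.const U (0 : A)
  simpa only [Localization.mk_zero] using h

theorem IsLocFrac.one (U : Opens (PSpec A)) :
    IsLocFrac U (fun _ _ => 1) := by
  have h := IsLocFrac.const U (1 : A)
  simpa only [Localization.mk_one] using h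

theorem IsLocFrac.mul {U : Opens (PSpec A)} {s t : ∀ p : PSpec A, p ∈ U → p.LocalAt}
    (hs : IsLocFrac U s) (ht : IsLocFrac U t) : IsLocFrac U (fun p hp => s p hp * t p hp) := by
  intro p hp
  obtain ⟨V, a, f, hV, H⟩ := hs p hp
  obtain ⟨W, b, g, hW, H'⟩ := ht p hp
  refine ⟨V ⊓ W, a * b, f * g, ⟨hV, hW⟩, fun q hq => ?_⟩
  obtain ⟨h₁, e₁⟩ := H q hq.1
  obtain ⟨h₂, e₂⟩ := H' q hq.2
  refine ⟨q.compl.mul_mem h₁ h₂, fun hU => ?_⟩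
  change s q hU * t q hU = _
  rw [e₁ hU, e₂ hU, Localization.mk_mul]
  rfl

theorem IsLocFrac.sum {U : Opens (PSpec A)} {s t r : ∀ p : PSpec A, p ∈ U → p.LocalAt}
    (hs : IsLocFrac U s) (ht : IsLocFrac U t)
    (h : ∀ p hp, IsSum (s p hp) (t p hp) (r p hp)) : IsLocFrac U r := by
  intro p hp
  obtain ⟨V, a, f, hV, H⟩ := hs p hp
  obtain ⟨W, b, g, hW, H'⟩ := ht p hp
  obtain ⟨h₁, e₁⟩ := H p hV
  obtain ⟨h₂, e₂⟩ := H' p hW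
  have hsum := h p hp
  rw [e₁ hp, e₂ hp] at hsum
  obtain ⟨u, c, hc, hr⟩ := (locIsSum_mk_iff _ _ _ _ _ _).1 hsum
  refine ⟨V ⊓ W ⊓ PSpec.basicOpen (u : A), c, u * (f * g), ⟨⟨hV, hW⟩, u.2⟩, fun q hq => ?_⟩
  obtain ⟨k₁, l₁⟩ := H q hq.1.1
  obtain ⟨k₂, l₂⟩ := H' q hq.1.2
  have hu : (u : A) ∈ q.compl := hq.2
  refine ⟨q.compl.mul_mem hu (q.compl.mul_mem k₁ k₂), fun hU => ?_⟩
  have hq' := h q hU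
  rw [l₁ hU, l₂ hU] at hq'
  exact isSum_unique hq' ((locIsSum_mk_iff _ _ _ _ _ _).2 ⟨⟨u, hu⟩, c, hc, rfl⟩)

/-- A section that is invertible at `p` is so on a neighbourhood. -/
theorem IsLocFrac.isUnit_nhds {U : Opens (PSpec A)} {s : ∀ p : PSpec A, p ∈ U → p.LocalAt}
    (hs : IsLocFrac U s) (p : PSpec A) (hp : p ∈ U) (hu : IsUnit (s p hp)) :
    ∃ V : Opens (PSpec A), p ∈ V ∧ V ≤ U ∧ ∀ q ∈ V, ∀ hU : q ∈ U, IsUnit (s q hU) := by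
  obtain ⟨V, a, f, hV, H⟩ := hs p hp
  obtain ⟨h₁, e₁⟩ := H p hV
  rw [e₁ hp, PSpec.isUnit_mk_iff] at hu
  refine ⟨V ⊓ PSpec.basicOpen a ⊓ U, ⟨⟨hV, hu⟩, hp⟩, inf_le_right, fun q hq hU => ?_⟩
  obtain ⟨h₂, e₂⟩ := H q hq.1.1
  rw [e₂ hU, PSpec.isUnit_mk_iff]
  exact hq.1.2

/-- The pointwise inverse of a section is a section. -/
theorem IsLocFrac.inv {U : Opens (PSpec A)} {s t : ∀ p : PSpec A, p ∈ U → p.LocalAt}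
    (hs : IsLocFrac U s) (h : ∀ p hp, s p hp * t p hp = 1) : IsLocFrac U t := by
  intro p hp
  obtain ⟨V, a, f, hV, H⟩ := hs p hp
  refine ⟨V ⊓ U, f, a, ⟨hV, hp⟩, fun q hq => ?_⟩
  obtain ⟨h₁, e₁⟩ := H q hq.1
  have h₂ := h q hq.2
  rw [e₁ hq.2] at h₂
  have ha : a ∈ q.compl := (PSpec.isUnit_mk_iff q a ⟨f, h₁⟩).1 (IsUnit.of_mul_eq_one _ h₂)
  refine ⟨ha, fun hU => ?_⟩
  have h₃ : (Localization.mk a ⟨f, h₁⟩ : q.LocalAt) * Localization.mk f ⟨a, ha⟩ = 1 := by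
    rw [Localization.mk_mul, ← Localization.mk_self (⟨f, h₁⟩ * ⟨a, ha⟩ : q.compl)]
    congr 1
    exact mul_comm _ _
  exact (IsUnit.of_mul_eq_one _ h₂).mul_left_cancel (h₂.trans h₃.symm)

variable (A) in
/-- The data of `(Spec A, 𝒪)`. -/
def specData : FunSheafData.{u} where
  X := PSpec A
  E := PSpec A
  proj := id
  proj_surj := Function.surjective_id
  R p := p.LocalAt
  not_isUnit_zero := PSpec.localAt_not_isUnit_zero
  isUnit_or := PSpec.localAt_isUnit_or
  P := IsLocFrac
  P_res _ _ h _ hs := hs.res h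
  P_local _ _ hs := IsLocFrac.of_local hs
  P_zero := IsLocFrac.zero
  P_one := IsLocFrac.one
  P_mul _ _ _ hs ht := hs.mul ht
  P_sum _ _ _ _ hs ht h := hs.sum ht h
  P_inv U s hs p hp hu := by
    obtain ⟨V, hpV, hVU, H⟩ := hs.isUnit_nhds p hp hu
    have H' : ∀ q (hq : q ∈ V), ∃ b, s q (hVU hq) * b = 1 :=
      fun q hq => (H q hq (hVU hq)).exists_right_inv
    choose t ht using H'
    exact ⟨V, hVU, t, hpV, (hs.res hVU).inv ht, ht⟩

variable (A) in
/-- The affine partial scheme `Spec A`. -/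
def Spec : LPRingedSpace.{u} := (specData A).toLPRingedSpace

end Spec

/-- A partial scheme: a locally partial-ringed space that is locally isomorphic to affine partial
schemes. -/
def IsPartialScheme (X : LPRingedSpace.{u}) : Prop :=
  ∀ x : X.carrier, ∃ (A : Type u) (_ : PRing A) (f : LPRingedSpace.Hom (Spec A) X),
    f.IsOpenImmersion ∧ x ∈ Set.range f.base

/-! ### Gluing affine partial schemes -/

/-- Charts `A i` and overlaps `A₂ i j`, with homomorphisms `A i → A₂ i j ← A j`. -/
structure AffineGlueData : Type (u + 1) where
  ι : Type u
  A : ι → Type u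
  [ring : ∀ i, PRing (A i)]
  A₂ : ι → ι → Type u
  [ring₂ : ∀ i j, PRing (A₂ i j)]
  left : ∀ i j, PRingHom (A i) (A₂ i j)
  right : ∀ i j, PRingHom (A j) (A₂ i j)

namespace AffineGlueData

attribute [instance] AffineGlueData.ring AffineGlueData.ring₂

variable (D : AffineGlueData.{u})

/-- The disjoint union of the charts `Spec (A i)`. -/
abbrev Charts : Type u := Σ i, PSpec (D.A i)

/-- The images of a point of `Spec (A₂ i j)` in `Spec (A i)` and in `Spec (A j)` are identified. -/
inductive Rel : D.Charts → D.Charts → Prop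
  | glue (i j : D.ι) (r : PSpec (D.A₂ i j)) :
      Rel ⟨i, PSpec.comap (D.left i j) r⟩ ⟨j, PSpec.comap (D.right i j) r⟩

/-- The glued space, with the quotient topology. -/
def Carrier : Type u := Quot D.Rel

instance : TopologicalSpace D.Carrier := inferInstanceAs (TopologicalSpace (Quot D.Rel))

/-- The projection of the disjoint union of the charts to the glued space. -/
def proj (e : D.Charts) : D.Carrier := Quot.mk D.Rel e

theorem continuous_proj : Continuous D.proj := continuous_quot_mk

/-- The inverse image in the chart `Spec (A i)` of an open set of the glued space. -/
def preim (i : D.ι) (U : Opens D.Carrier) : Opens (PSpec (D.A i)) :=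
  U.comap ⟨fun p => D.proj ⟨i, p⟩, D.continuous_proj.comp continuous_sigmaMk⟩

/-- The sections of the glued sheaf over `U`: families of sections of the structure sheaves of the
charts over the inverse images of `U`, whose pullbacks to `Spec (A₂ i j)` agree for all `i, j`. -/
def IsSection (U : Opens D.Carrier) (s : ∀ e : D.Charts, D.proj e ∈ U → e.2.LocalAt) : Prop :=
  (∀ i, IsLocFrac (D.preim i U) (fun p hp => s ⟨i, p⟩ hp)) ∧
  ∀ (i j : D.ι) (r : PSpec (D.A₂ i j))
    (hi : D.proj ⟨i, PSpec.comap (D.left i j) r⟩ ∈ U)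
    (hj : D.proj ⟨j, PSpec.comap (D.right i j) r⟩ ∈ U),
    PSpec.localMap (D.left i j) r (s ⟨i, PSpec.comap (D.left i j) r⟩ hi) =
      PSpec.localMap (D.right i j) r (s ⟨j, PSpec.comap (D.right i j) r⟩ hj)

theorem preim_mono (i : D.ι) {U V : Opens D.Carrier} (h : V ≤ U) : D.preim i V ≤ D.preim i U :=
  fun _ hp => h hp

/-- The data of the glued space. -/
def funSheafData : FunSheafData.{u} where
  X := D.Carrier
  E := D.Charts
  proj := D.proj
  proj_surj := Quot.mk_surjective
  R e := e.2.LocalAt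
  not_isUnit_zero e := PSpec.localAt_not_isUnit_zero e.2
  isUnit_or e := PSpec.localAt_isUnit_or e.2
  P := D.IsSection
  P_res U V h s hs :=
    ⟨fun i => (hs.1 i).res (D.preim_mono i h), fun i j r hi hj => hs.2 i j r (h hi) (h hj)⟩
  P_local U s hs := by
    refine ⟨fun i => IsLocFrac.of_local fun p hp => ?_, fun i j r hi hj => ?_⟩
    · obtain ⟨V, hVU, hpV, H⟩ := hs _ hp
      exact ⟨D.preim i V, D.preim_mono i hVU, hpV, H.1 i⟩
    · obtain ⟨V, hVU, hpV, H⟩ := hs _ hi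
      have e := Quot.sound (Rel.glue (D := D) i j r)
      have hpV' : D.proj ⟨j, PSpec.comap (D.right i j) r⟩ ∈ V := by
        unfold proj; rw [← e]; exact hpV
      exact H.2 i j r hpV hpV'
  P_zero U := ⟨fun i => IsLocFrac.zero _, fun i j r _ _ => by rw [map_zero, map_zero]⟩
  P_one U := ⟨fun i => IsLocFrac.one _, fun i j r _ _ => by rw [map_one, map_one]⟩
  P_mul U s t hs ht :=
    ⟨fun i => (hs.1 i).mul (ht.1 i), fun i j r hi hj => by
      rw [map_mul, map_mul, hs.2 i j r hi hj, ht.2 i j r hi hj]⟩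
  P_sum U s t r hs ht h := by
    refine ⟨fun i => (hs.1 i).sum (ht.1 i) fun p hp => h ⟨i, p⟩ hp, fun i j q hi hj => ?_⟩
    have h₁ := (PSpec.localMap (D.left i j) q).map_isSum (h _ hi)
    have h₂ := (PSpec.localMap (D.right i j) q).map_isSum (h _ hj)
    rw [hs.2 i j q hi hj, ht.2 i j q hi hj] at h₁
    exact isSum_unique h₁ h₂
  P_inv U s hs e he hu := by
    let Q : D.Charts → Prop := fun e => ∃ h : D.proj e ∈ U, IsUnit (s e h)
    have hQ : ∀ e e', D.Rel e e' → Q e = Q e' := by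
      rintro _ _ ⟨i, j, r⟩
      have hr := Quot.sound (Rel.glue (D := D) i j r)
      apply propext
      constructor
      · rintro ⟨h, h'⟩
        have hj : D.proj ⟨j, PSpec.comap (D.right i j) r⟩ ∈ U := by
          unfold proj; rw [← hr]; exact h
        refine ⟨hj, ?_⟩
        rw [← PSpec.isUnit_localMap_iff, ← hs.2 i j r h hj]
        exact (PSpec.isUnit_localMap_iff _ _ _).2 h'
      · rintro ⟨h, h'⟩
        have hi : D.proj ⟨i, PSpec.comap (D.left i j) r⟩ ∈ U := by
          unfold proj; rw [hr]; exact h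
        refine ⟨hi, ?_⟩
        rw [← PSpec.isUnit_localMap_iff, hs.2 i j r hi h]
        exact (PSpec.isUnit_localMap_iff _ _ _).2 h'
    let V : Opens D.Carrier := ⟨{x | Quot.lift Q hQ x}, by
      refine isQuotientMap_quot_mk.isOpen_preimage.1 ?_
      rw [isOpen_sigma_iff]
      intro i
      rw [isOpen_iff_forall_mem_open]
      rintro p ⟨hp, hup⟩
      obtain ⟨W, hpW, hWU, H⟩ := (hs.1 i).isUnit_nhds p hp hup
      exact ⟨W, fun q hq => ⟨hWU hq, H q hq (hWU hq)⟩, W.isOpen, hpW⟩⟩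
    have hVU : V ≤ U := by
      intro x hx
      obtain ⟨e, rfl⟩ := Quot.mk_surjective x
      exact hx.1
    have H' : ∀ e' (he' : D.proj e' ∈ V), ∃ b, s e' (hVU he') * b = 1 :=
      fun e' he' => he'.2.exists_right_inv
    choose t ht using H'
    refine ⟨V, hVU, t, ⟨he, hu⟩, ⟨fun i => ?_, fun i j r hi hj => ?_⟩, ht⟩
    · exact ((hs.1 i).res (D.preim_mono i hVU)).inv fun p hp => ht ⟨i, p⟩ hp
    · have h₁ := congrArg (PSpec.localMap (D.left i j) r) (ht _ hi)
      have h₂ := congrArg (PSpec.localMap (D.right i j) r) (ht _ hj)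
      rw [map_mul, map_one] at h₁ h₂
      rw [hs.2 i j r (hVU hi) (hVU hj)] at h₁
      exact (IsUnit.of_mul_eq_one _ h₂).mul_left_cancel (h₁.trans h₂.symm)

/-- The space glued from the affine partial schemes `Spec (A i)` along `Spec (A₂ i j)`, that is, the
coequalizer of `∐ Spec (A₂ i j) ⇉ ∐ Spec (A i)`. -/
def glued : LPRingedSpace.{u} := D.funSheafData.toLPRingedSpace

end AffineGlueData

/-! ### Partial subrings of semirings -/

/-- A partial subring of a commutative semiring `N`: a subset `carrier`, and a set `rel` of summable
pairs, that form a partial ring with the operations of `N`. -/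
structure PartialSubring (N : Type u) [CommSemiring N] where
  carrier : Set N
  rel : N → N → Prop
  left_mem : ∀ {a b : N}, rel a b → a ∈ carrier
  add_mem : ∀ {a b : N}, rel a b → a + b ∈ carrier
  zero_mem : (0 : N) ∈ carrier
  one_mem : (1 : N) ∈ carrier
  mul_mem : ∀ {a b : N}, a ∈ carrier → b ∈ carrier → a * b ∈ carrier
  zero_rel : ∀ {a : N}, a ∈ carrier → rel 0 a
  rel_comm : ∀ {a b : N}, rel a b → rel b a
  rel_assoc : ∀ {a b c : N}, rel a b → rel (a + b) c → rel b c ∧ rel a (b + c)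
  rel_mul : ∀ {a b x : N}, rel a b → x ∈ carrier → rel (a * x) (b * x)

namespace PartialSubring

variable {N : Type u} [CommSemiring N]

instance : CoeSort (PartialSubring N) (Type u) := ⟨fun B => {a : N // a ∈ B.carrier}⟩

instance (B : PartialSubring N) : PRing B where
  mul a b := ⟨a.1 * b.1, B.mul_mem a.2 b.2⟩
  one := ⟨1, B.one_mem⟩
  zero := ⟨0, B.zero_mem⟩
  mul_assoc _ _ _ := Subtype.ext (mul_assoc _ _ _)
  mul_comm _ _ := Subtype.ext (mul_comm _ _)
  one_mul _ := Subtype.ext (one_mul _)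
  mul_one _ := Subtype.ext (mul_one _)
  zero_mul _ := Subtype.ext (zero_mul _)
  mul_zero _ := Subtype.ext (mul_zero _)
  IsSum a b c := B.rel a.1 b.1 ∧ a.1 + b.1 = c.1
  isSum_unique h h' := Subtype.ext (h.2.symm.trans h'.2)
  zero_isSum a := ⟨B.zero_rel a.2, zero_add _⟩
  isSum_comm h := ⟨B.rel_comm h.1, (add_comm _ _).trans h.2⟩
  isSum_assoc {a b c d e} h h' := by
    obtain ⟨h₁, h₂⟩ := B.rel_assoc h.1 (h.2.symm ▸ h'.1)
    exact ⟨⟨b.1 + c.1, B.add_mem h₁⟩, ⟨h₁, rfl⟩, h₂, by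
      change a.1 + (b.1 + c.1) = e.1
      rw [← h'.2, ← h.2, add_assoc]⟩
  isSum_mul {a b c} x h := ⟨B.rel_mul h.1 x.2, by
    change a.1 * x.1 + b.1 * x.1 = c.1 * x.1
    rw [← h.2, add_mul]⟩

/-- For polynomials over `ℕ`, written as sums of monomials with coefficient `1`, `t` is a subsum of
`s` if and only if `s = t + u` for some polynomial `u`. -/
def IsSubsum (t s : N) : Prop := ∃ u, t + u = s

/-- `B` contains every subsum of every element of `S`, and pairs whose sum is such a subsum are
summable in `B`. -/
def Admits (B : PartialSubring N) (S : Set N) : Prop :=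
  ∀ s ∈ S, (∀ t, IsSubsum t s → t ∈ B.carrier) ∧ ∀ a b, IsSubsum (a + b) s → B.rel a b

/-- The smallest partial subring that admits `S`. -/
def generated (S : Set N) : PartialSubring N where
  carrier := {a | ∀ B : PartialSubring N, B.Admits S → a ∈ B.carrier}
  rel a b := ∀ B : PartialSubring N, B.Admits S → B.rel a b
  left_mem h B hB := B.left_mem (h B hB)
  add_mem h B hB := B.add_mem (h B hB)
  zero_mem B _ := B.zero_mem
  one_mem B _ := B.one_mem
  mul_mem ha hb B hB := B.mul_mem (ha B hB) (hb B hB)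
  zero_rel ha B hB := B.zero_rel (ha B hB)
  rel_comm h B hB := B.rel_comm (h B hB)
  rel_assoc h h' :=
    ⟨fun B hB => (B.rel_assoc (h B hB) (h' B hB)).1, fun B hB => (B.rel_assoc (h B hB) (h' B hB)).2⟩
  rel_mul h hx B hB := B.rel_mul (h B hB) (hx B hB)

end PartialSubring

/-! ### Projective spaces -/

section Projective

variable {n : ℕ}

/-- The polynomial semiring `ℕ[y₀, …, yₙ]`. -/
abbrev NPoly (n : ℕ) : Type := MvPolynomial (Fin (n + 1)) ℕ

variable (B : PartialSubring (NPoly n))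

/-- The multiplicative subset of `B` generated by the variables `yᵢ`, `i ∈ T`. -/
noncomputable def varSubmonoid (T : Finset (Fin (n + 1))) : Submonoid B :=
  Submonoid.closure {b | ∃ i ∈ T, b.1 = MvPolynomial.X i}

/-- `x ∈ S⁻¹ B` is homogeneous of degree `0`: a fraction `f / s` with `f ∈ B` and `s ∈ S`
homogeneous of the same degree. -/
def IsDegZero {T : Finset (Fin (n + 1))} (x : Localization (varSubmonoid B T)) : Prop :=
  ∃ (d : ℕ) (f : B) (s : varSubmonoid B T), f.1.IsHomogeneous d ∧ s.1.1.IsHomogeneous d ∧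
    x = Localization.mk f s

/-- The part `A^(T)` of degree `0` of the localization of `B` at the variables `yᵢ`, `i ∈ T`. -/
noncomputable def DegZero (T : Finset (Fin (n + 1))) : Type :=
  {x : Localization (varSubmonoid B T) // IsDegZero B x}

variable {B}

theorem IsDegZero.zero {T : Finset (Fin (n + 1))} :
    IsDegZero B (0 : Localization (varSubmonoid B T)) :=
  ⟨0, 0, 1, MvPolynomial.isHomogeneous_zero _ _ _, MvPolynomial.isHomogeneous_one _ _,
    (Localization.mk_zero 1).symm⟩

theorem IsDegZero.one {T : Finset (Fin (n + 1))} :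
    IsDegZero B (1 : Localization (varSubmonoid B T)) :=
  ⟨0, 1, 1, MvPolynomial.isHomogeneous_one _ _, MvPolynomial.isHomogeneous_one _ _,
    Localization.mk_one.symm⟩

theorem IsDegZero.mul {T : Finset (Fin (n + 1))} {x y : Localization (varSubmonoid B T)}
    (hx : IsDegZero B x) (hy : IsDegZero B y) : IsDegZero B (x * y) := by
  obtain ⟨d, f, s, hf, hs, rfl⟩ := hx
  obtain ⟨d', f', s', hf', hs', rfl⟩ := hy
  exact ⟨d + d', f * f', s * s', hf.mul hf', hs.mul hs', Localization.mk_mul _ _ _ _⟩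

theorem varSubmonoid_homogeneous {T : Finset (Fin (n + 1))} (s : varSubmonoid B T) :
    ∃ d, s.1.1.IsHomogeneous d := by
  obtain ⟨s, hs⟩ := s
  refine Submonoid.closure_induction (motive := fun (b : B) _ => ∃ d, b.1.IsHomogeneous d)
    ?_ ?_ ?_ hs
  · rintro b ⟨i, -, hb⟩
    exact ⟨1, hb ▸ MvPolynomial.isHomogeneous_X _ _⟩
  · exact ⟨0, MvPolynomial.isHomogeneous_one _ _⟩
  · rintro a b - - ⟨d, hd⟩ ⟨d', hd'⟩
    exact ⟨d + d', hd.mul hd'⟩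

theorem IsDegZero.sum {T : Finset (Fin (n + 1))} {x y z : Localization (varSubmonoid B T)}
    (hx : IsDegZero B x) (hy : IsDegZero B y) (h : IsSum x y z) : IsDegZero B z := by
  obtain ⟨d, f, s, hf, hs, rfl⟩ := hx
  obtain ⟨d', g, t, hg, ht, rfl⟩ := hy
  obtain ⟨u, c, hc, rfl⟩ := (locIsSum_mk_iff _ _ _ _ _ _).1 h
  obtain ⟨k, hk⟩ := varSubmonoid_homogeneous u
  refine ⟨k + (d + d'), c, u * (s * t), ?_, hk.mul (hs.mul ht), rfl⟩
  rw [← hc.2]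
  refine MvPolynomial.IsHomogeneous.add ?_ (hk.mul (hs.mul hg))
  have := hk.mul (ht.mul hf)
  rwa [add_comm d' d] at this

/-- `A^(T)` as a partial ring; its sums are those of the localization of `B`. -/
noncomputable instance (T : Finset (Fin (n + 1))) : PRing (DegZero B T) where
  mul a b := ⟨a.1 * b.1, a.2.mul b.2⟩
  one := ⟨1, IsDegZero.one⟩
  zero := ⟨0, IsDegZero.zero⟩
  mul_assoc _ _ _ := Subtype.ext (mul_assoc _ _ _)
  mul_comm _ _ := Subtype.ext (mul_comm _ _)
  one_mul _ := Subtype.ext (one_mul _)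
  mul_one _ := Subtype.ext (mul_one _)
  zero_mul _ := Subtype.ext (zero_mul _)
  mul_zero _ := Subtype.ext (mul_zero _)
  IsSum a b c := IsSum a.1 b.1 c.1
  isSum_unique h h' := Subtype.ext (isSum_unique h h')
  zero_isSum a := zero_isSum a.1
  isSum_comm h := isSum_comm h
  isSum_assoc {a b c d e} h h' := by
    obtain ⟨f, hf, hf'⟩ := isSum_assoc h h'
    exact ⟨⟨f, b.2.sum c.2 hf⟩, hf, hf'⟩
  isSum_mul x h := isSum_mul x.1 h

/-- The identity homomorphism. -/
def PRingHom.id (A : Type u) [PRing A] : PRingHom A A where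
  toMonoidWithZeroHom := MonoidWithZeroHom.id A
  map_isSum' h := h

variable (B) in
/-- The homomorphism `A^(T) → A^(T')`, `f / s ↦ f / s`, for `T ⊆ T'`. -/
noncomputable def degZeroMap {T T' : Finset (Fin (n + 1))} (h : T ⊆ T') :
    PRingHom (DegZero B T) (DegZero B T') :=
  let hS : varSubmonoid B T ≤ varSubmonoid B T' :=
    Submonoid.closure_mono fun _ ⟨i, hi, hb⟩ => ⟨i, h hi, hb⟩
  let φ := locMap (PRingHom.id B) (varSubmonoid B T) (varSubmonoid B T') fun _ hs => hS hs
  { toFun := fun x => ⟨φ x.1, by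
      obtain ⟨d, f, s, hf, hs, hx⟩ := x.2
      exact ⟨d, f, ⟨s.1, hS s.2⟩, hf, hs, by rw [hx]; rfl⟩⟩
    map_zero' := Subtype.ext (map_zero φ)
    map_one' := Subtype.ext (map_one φ)
    map_mul' := fun x y => Subtype.ext (map_mul φ x.1 y.1)
    map_isSum' := fun h => φ.map_isSum h }

variable (B) in
/-- The charts `A^(i) = {f / yᵢ^r}` and the overlaps `A^(i,j) = A^(j,i) = {f / (yᵢ^r yⱼ^s)}`, with
`f` homogeneous of the degree of the denominator. -/
noncomputable def projGlueData : AffineGlueData.{0} where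
  ι := Fin (n + 1)
  A i := DegZero B {i}
  A₂ i j := DegZero B {i, j}
  left i j := degZeroMap B (by simp)
  right i j := degZeroMap B (by simp)

/-- The projective space of the vector space `Spec B`, where `B` contains the variables `y₀, …, yₙ`:
it is glued from the charts `Spec A^(i)` along `Spec A^(i,j)`. -/
noncomputable def projectivization (B : PartialSubring (NPoly n)) : LPRingedSpace.{0} := (projGlueData B).glued

end Projective

/-- The partial ring `𝔽₁⟨y₀, …, yₙ | ∃ (y₀ + ⋯ + yₙ)⟩`. -/
noncomputable def coordRing (n : ℕ) : PartialSubring (NPoly n) :=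
  PartialSubring.generated {∑ i, MvPolynomial.X i}

/-- The projective space `ℙⁿ`. -/
noncomputable def projectiveSpace (n : ℕ) : LPRingedSpace.{0} := projectivization (coordRing n)

/-- The set `X(F)` of `F`-points `Spec F → X`. -/
def Points (X : LPRingedSpace.{v}) (F : Type u) [PRing F] := LPRingedSpace.Hom (Spec F) X

/-!
The points of projective space with values in a partial field `F` are the tuples
`(0, …, 0, 1, x₁, …, xₘ)`, `m ≤ n`, for which the sum of the entries is defined in `F`, and for each
`m` there are `κᵐ` of them.

*Projective space is a partial scheme.* All elements and all sums in the coordinate ring `B` are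
homogeneous. Therefore `f ↦ f / yᵢ ^ deg f` is a homomorphism `dehom` of partial rings to `A^(i)`,
and pulling back along it embeds the `i`-th chart into the space of prime ideals of `B`, with image
the primes that do not contain `yᵢ` (`cone`, `exists_cone_eq`, `isInducing_cone`). Two points of
charts are identified in `ℙⁿ` exactly if they give the same prime of `B` (`chartPt_eq_chartPt_iff`),
so the charts are open in `ℙⁿ`. The elements of the local partial ring at a point of a chart are
fractions `f / g` of elements of `B` of the same degree, and equality and summability of such
fractions depend only on the prime of `B` (`IsFrac.eq_iff`, `IsFrac.isSum_iff`). So a section over a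
chart has well-defined values in all other charts as well, which makes the charts open immersions.
`FractionSystem` axiomatizes this argument, and takes the place of cocycle conditions on triple
overlaps.

*Points and tuples.* As `Spec F` has a single point, with local partial ring `F`, a morphism
`Spec F → ℙⁿ` factors through a chart and comes from a homomorphism `A^(i) → F`
(`FractionSystem.exists_eq_specMap`, `FractionSystem.specMap_injective`). These homomorphisms are
the homomorphisms `B → F` with `yᵢ ↦ 1`. A homomorphism from `B` is determined by the images `xᵢ` of
the variables, and the only condition on these is that `x₀ + ⋯ + xₙ` is defined
(`coordRing_hom_ext`, `exists_coordRing_hom`). To construct it, one adjoins to `F` an element `∞`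
that is the value of all undefined sums. Strict associativity makes `F ∪ {∞}` a commutative monoid
(`WithUndef F`), so that every polynomial over `ℕ` has a value at `x`, and the polynomials with a
value in `F` form a partial subring. Taking `i` to be the index of the first nonzero coordinate
singles out one chart for each point.

*Counting.* Let `s ≠ 0`. Multiplication by `s` shows that `κ` elements are summable with `s`. If a
partial sum of `s + x₁ + ⋯ + xₘ` is zero, then `s` has an additive inverse, hence every element is
summable with `1`, and `κ` is the cardinality of `F`, which is also the number of elements summable
with zero. So in each step of the sum there are `κ` possibilities for the next term, whether or not
partial sums vanish (`mk_summableAfter`).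
-/

/-! ### Maximal ideals of stalks and local homomorphisms -/

/-- If `φ : A → R` reflects units and the nonunits of `R` form an ideal, then the maximal ideal of
`A` consists of the elements with noninvertible image. -/
theorem PIdeal.IsMaximal.mem_iff_of_hom {A : Type u} {R : Type v} [PRing A] [PRing R]
    (φ : PRingHom A R) (hφ : ∀ a, IsUnit (φ a) → IsUnit a) (h0 : ¬ IsUnit (0 : R))
    (hR : ∀ a b c : R, IsSum a b c → IsUnit c → IsUnit a ∨ IsUnit b)
    {I : PIdeal A} (hI : I.IsMaximal) (a : A) : a ∈ I.carrier ↔ ¬ IsUnit (φ a) := by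
  let N : PIdeal A :=
    { carrier := {a | ¬ IsUnit (φ a)}
      zero_mem := by simpa using h0
      sum_mem := fun {a b c} ha hb h hc => (hR _ _ _ (φ.map_isSum h) hc).elim ha hb
      mul_mem := fun a x hx h => hx (by
        rw [map_mul] at h
        exact isUnit_of_mul_isUnit_right h) }
  have hN : N.carrier ≠ Set.univ := fun h => by
    have : (1 : A) ∈ N.carrier := h ▸ Set.mem_univ _
    exact this (by simp)
  have hIN : I.carrier ⊆ N.carrier := by
    intro a ha hu
    obtain ⟨b, hb⟩ := (hφ a hu).exists_left_inv
    exact PIdeal.one_notMem hI.1 (hb ▸ I.mul_mem b ha)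
  rw [← hI.2 N hN hIN]
  rfl

namespace FunSheafData

variable (D : FunSheafData.{u})

/-- The germ of a section is noninvertible exactly if its value at a point above is. -/
theorem germ_mem_maximal_iff {x : D.X} {I : PIdeal (D.toPRingedSpace.stalk x)}
    (hI : I.IsMaximal) (e : D.E) (hx : x = D.proj e) (U : Opens D.X) (hU : x ∈ U) (s : D.Sec U) :
    D.toPRingedSpace.germ U hU s ∈ I.carrier ↔ ¬ IsUnit (s.1 e (hx ▸ hU)) := by
  subst hx
  exact hI.mem_iff_of_hom (D.stalkEval e) (D.isUnit_of_stalkEval e) (D.not_isUnit_zero e)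
    (D.isUnit_or e) _

end FunSheafData

/-- Pulling back sections along a morphism preserves and reflects invertibility of values. This is
the locality of the morphism, expressed through values instead of germs. -/
theorem LPRingedSpace.Hom.isUnit_app_iff {D : FunSheafData.{u}} {D' : FunSheafData.{v}}
    (f : LPRingedSpace.Hom D.toLPRingedSpace D'.toLPRingedSpace) (e : D.E) (e' : D'.E)
    (he : f.base (D.proj e) = D'.proj e') (V : Opens D'.X) (hV : D'.proj e' ∈ V)
    (s : D'.Sec V) :
    IsUnit ((f.app V s).1 e (show f.base (D.proj e) ∈ V from he ▸ hV)) ↔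
      IsUnit (s.1 e' hV) := by
  obtain ⟨J, hJ, -⟩ := D.toLPRingedSpace.isLocal_stalk (D.proj e)
  obtain ⟨I, hI, -⟩ := D'.toLPRingedSpace.isLocal_stalk (f.base (D.proj e))
  have h := f.isLocal_stalkMap (D.proj e) I J hI hJ
  have h₁ := D'.germ_mem_maximal_iff hI e' he V (he ▸ hV) s
  have h₂ := D.germ_mem_maximal_iff hJ e rfl (V.comap f.base)
    (show f.base (D.proj e) ∈ V from he ▸ hV) (f.app V s)
  rw [← h] at h₁
  exact not_iff_not.1 (h₂.symm.trans h₁)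

/-! ### Morphisms from affine partial schemes to glued spaces -/

section SpecMap

theorem PSpec.continuous_comap {A : Type u} {B : Type v} [PRing A] [PRing B]
    (φ : PRingHom A B) : Continuous (PSpec.comap φ) := by
  refine continuous_generateFrom_iff.2 ?_
  rintro _ ⟨a, rfl⟩
  exact (PSpec.basicOpen (φ a)).isOpen

theorem IsLocFrac.comap {A : Type u} {B : Type v} [PRing A] [PRing B] (φ : PRingHom A B)
    {U : Opens (PSpec A)}
    {s : ∀ p : PSpec A, p ∈ U → p.LocalAt} (hs : IsLocFrac U s) :
    IsLocFrac (U.comap ⟨_, PSpec.continuous_comap φ⟩)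
      (fun q hq => PSpec.localMap φ q (s (PSpec.comap φ q) hq)) := by
  intro q hq
  obtain ⟨V, a, f, hV, H⟩ := hs _ hq
  refine ⟨V.comap ⟨_, PSpec.continuous_comap φ⟩, φ a, φ f, hV, fun q' hq' => ?_⟩
  obtain ⟨hf, e⟩ := H _ hq'
  exact ⟨hf, fun hU => congrArg (PSpec.localMap φ q') (e hU)⟩

namespace AffineGlueData

variable (D : AffineGlueData.{u})

/-- The morphism `Spec B → Spec (A i) → X` to the glued space `X` induced by `φ : A i → B`. -/
noncomputable def specMap {B : Type v} [PRing B] (i : D.ι) (φ : PRingHom (D.A i) B) :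
    LPRingedSpace.Hom (Spec B) D.glued where
  base := ⟨fun q : PSpec B => D.proj ⟨i, PSpec.comap φ q⟩,
    D.continuous_proj.comp (continuous_sigmaMk.comp (PSpec.continuous_comap φ))⟩
  app V :=
    { toFun := fun s : D.funSheafData.Sec V =>
        ⟨fun q hq => PSpec.localMap φ q (s.1 ⟨i, PSpec.comap φ q⟩ hq), (s.2.1 i).comap φ⟩
      map_zero' := FunSheafData.Sec.ext fun q _ => map_zero (PSpec.localMap φ q)
      map_one' := FunSheafData.Sec.ext fun q _ => map_one (PSpec.localMap φ q)
      map_mul' := fun _ _ => FunSheafData.Sec.ext fun q _ => map_mul (PSpec.localMap φ q) _ _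
      map_isSum' := fun h q hq => (PSpec.localMap φ q).map_isSum (h _ hq) }
  app_res V W h s := rfl
  isLocal_stalkMap q I J hI hJ := by
    refine PIdeal.ext (Set.ext fun a => ?_)
    obtain ⟨V, hV, s, rfl⟩ := PRingedSpace.exists_germ a
    have h₁ := D.funSheafData.germ_mem_maximal_iff hI ⟨i, PSpec.comap φ q⟩ rfl V hV s
    refine (((specData B).germ_mem_maximal_iff hJ q rfl _ hV _).trans (not_congr ?_)).trans h₁.symm
    exact PSpec.isUnit_localMap_iff φ q _

end AffineGlueData

end SpecMap

/-! ### Adjoining an undefined element -/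

/-- The set `F ∪ {∞}`, where `∞ = none` stands for an undefined sum. -/
def WithUndef (F : Type u) : Type u := Option F

namespace WithUndef

variable {F : Type u}

/-- The inclusion `F → F ∪ {∞}`. -/
def of (a : F) : WithUndef F := some a

theorem of_injective : Function.Injective (of : F → WithUndef F) := Option.some_injective F

theorem ext_of {x y : WithUndef F} (h : ∀ c, x = of c ↔ y = of c) : x = y :=
  Option.ext h

variable [PRing F]

open Classical in
/-- The sum is `∞` as soon as it is undefined in `F`. -/
noncomputable instance : Add (WithUndef F) where
  add
    | some a, some b => if h : Summ a b then some h.choose else none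
    | _, _ => none

theorem add_eq_of {x y : WithUndef F} {c : F} :
    x + y = of c ↔ ∃ a b, x = of a ∧ y = of b ∧ IsSum a b c := by
  constructor
  · intro h
    match x, y, h with
    | none, none, h => cases h
    | none, some b, h => cases h
    | some a, none, h => cases h
    | some a, some b, h =>
      by_cases hs : Summ a b
      · have : of a + of b = of hs.choose := dif_pos hs
        replace h := this.symm.trans h
        refine ⟨a, b, rfl, rfl, ?_⟩
        rw [← of_injective h]
        exact hs.choose_spec
      · have : of a + of b = (none : Option F) := dif_neg hs
        cases this.symm.trans h
  · rintro ⟨a, b, rfl, rfl, h⟩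
    have hs : Summ a b := ⟨c, h⟩
    have : of a + of b = of hs.choose := dif_pos hs
    rw [this, isSum_unique hs.choose_spec h]

theorem of_add_of {a b c : F} : of a + of b = of c ↔ IsSum a b c := by
  rw [add_eq_of]
  constructor
  · rintro ⟨a', b', ha, hb, h⟩
    rwa [of_injective ha, of_injective hb]
  · exact fun h => ⟨a, b, rfl, rfl, h⟩

instance : Zero (WithUndef F) := ⟨of 0⟩

theorem of_zero : of (0 : F) = 0 := rfl

/-- Strict associativity of the addition of `F` makes `F ∪ {∞}` a monoid. -/
noncomputable instance : AddCommMonoid (WithUndef F) where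
  add_assoc x y z := by
    refine ext_of fun e => ?_
    simp only [add_eq_of]
    constructor
    · rintro ⟨d, c, ⟨a, b, rfl, rfl, h⟩, rfl, h'⟩
      obtain ⟨f, hf, hf'⟩ := isSum_assoc h h'
      exact ⟨a, f, rfl, ⟨b, c, rfl, rfl, hf⟩, hf'⟩
    · rintro ⟨a, f, rfl, ⟨b, c, rfl, rfl, h⟩, h'⟩
      obtain ⟨d, hd, hd'⟩ := isSum_assoc' h h'
      exact ⟨d, c, ⟨a, b, rfl, rfl, hd⟩, rfl, hd'⟩
  add_comm x y := by
    refine ext_of fun e => ?_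
    simp only [add_eq_of]
    constructor <;>
    · rintro ⟨a, b, rfl, rfl, h⟩
      exact ⟨b, a, rfl, rfl, isSum_comm h⟩
  zero_add x := by
    refine ext_of fun e => ?_
    rw [add_eq_of]
    constructor
    · rintro ⟨a, b, ha, rfl, h⟩
      rw [← of_injective ha] at h
      rw [isSum_unique h (zero_isSum b)]
    · rintro rfl
      exact ⟨0, e, rfl, rfl, zero_isSum e⟩
  add_zero x := by
    refine ext_of fun e => ?_
    rw [add_eq_of]
    constructor
    · rintro ⟨b, a, rfl, ha, h⟩
      rw [← of_injective ha] at h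
      rw [isSum_unique (isSum_comm h) (zero_isSum b)]
    · rintro rfl
      exact ⟨e, 0, rfl, rfl, isSum_comm (zero_isSum e)⟩
  nsmul := nsmulRec

/-- `x` is a defined sum. -/
def IsDef (x : WithUndef F) : Prop := ∃ c, x = of c

theorem IsDef.left {x y : WithUndef F} (h : (x + y).IsDef) : x.IsDef := by
  obtain ⟨c, h⟩ := h
  obtain ⟨a, b, ha, -, -⟩ := add_eq_of.1 h
  exact ⟨a, ha⟩

end WithUndef

open WithUndef

/-! ### Counting summable tuples -/

section Count

variable {F : Type u} [PRing F]

/-- The tuples `x` of length `m` for which `s + x₁ + ⋯ + xₘ` is defined. -/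
def SummableAfter (s : F) (m : ℕ) : Type u :=
  {x : Fin m → F // (of s + ∑ j, of (x j)).IsDef}

/-- The tuples with defined sum, whose first nonzero entry exists and is `1`. -/
def NormalizedTuple (F : Type u) [PRing F] (m : ℕ) : Type u :=
  {x : Fin m → F // (∑ j, of (x j)).IsDef ∧ ∃ i, x i = 1 ∧ ∀ j < i, x j = 0}

theorem mk_summ_zero : Cardinal.mk {x : F // Summ 0 x} = Cardinal.mk F :=
  Cardinal.mk_congr (Equiv.subtypeUnivEquiv fun x => ⟨x, zero_isSum x⟩)

theorem mk_summ_of_isUnit {s : F} (hs : IsUnit s) : Cardinal.mk {x : F // Summ s x} = kappa F := by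
  obtain ⟨s, rfl⟩ := hs
  refine Cardinal.mk_congr ((Units.mulLeft s⁻¹).subtypeEquiv fun x => ?_)
  constructor
  · rintro ⟨c, h⟩
    refine ⟨(s⁻¹ : Fˣ) * c, ?_⟩
    simpa using mul_isSum ((s⁻¹ : Fˣ) : F) h
  · rintro ⟨c, h⟩
    refine ⟨s * c, ?_⟩
    simpa using mul_isSum (s : F) h

/-- If two nonzero elements of a partial field have sum zero, then every element is summable
with `1`. -/
theorem kappa_eq_mk_of_isSum_zero (hF : IsPartialField F) {s a : F} (hs : s ≠ 0)
    (h : IsSum s a 0) : kappa F = Cardinal.mk F := by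
  rw [← mk_summ_of_isUnit (hF.2 s hs)]
  refine Cardinal.mk_congr (Equiv.subtypeUnivEquiv fun x => ?_)
  -- The sum `(a + s) + x = 0 + x` is defined, hence so is `s + x`.
  obtain ⟨g, hg, -⟩ := isSum_assoc (isSum_comm h) (zero_isSum x)
  exact ⟨g, hg⟩

/-- The condition on `s` is inherited by all defined sums `s + a`, which makes the induction work:
by `kappa_eq_mk_of_isSum_zero`, a partial sum can become zero only if `κ` is the cardinality
of `F`, and every element is summable with zero. -/
theorem mk_summableAfter (hF : IsPartialField F) (m : ℕ) :
    ∀ s : F, (s ≠ 0 ∨ kappa F = Cardinal.mk F) →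
      Cardinal.mk (SummableAfter s m) = kappa F ^ m := by
  induction m with
  | zero =>
    intro s _
    rw [pow_zero, Cardinal.eq_one_iff_unique]
    exact ⟨⟨fun x y => Subtype.ext (Subsingleton.elim _ _)⟩,
      ⟨⟨Fin.elim0, s, by simp⟩⟩⟩
  | succ m ih =>
    intro s hs
    have hk : Cardinal.mk {x : F // Summ s x} = kappa F := by
      by_cases h0 : s = 0
      · rw [h0, mk_summ_zero]
        exact (hs.resolve_left fun h => h h0).symm
      · exact mk_summ_of_isUnit (hF.2 s h0)
    have e : SummableAfter s (m + 1) ≃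
        Σ a : {x : F // Summ s x}, SummableAfter a.2.choose m :=
      (Equiv.ofBijective
        (fun x : (Σ a : {x : F // Summ s x}, SummableAfter a.2.choose m) =>
          (⟨Fin.cons x.1.1 x.2.1, by
            rw [Fin.sum_univ_succ, ← add_assoc]
            exact (of_add_of.2 x.1.2.choose_spec).symm ▸ x.2.2⟩ : SummableAfter s (m + 1))) (by
        constructor
        · rintro ⟨⟨a, ha⟩, x, hx⟩ ⟨⟨b, hb⟩, y, hy⟩ h
          replace h := congrArg Subtype.val h
          obtain rfl : a = b := congrFun h 0
          obtain rfl : x = y := congrArg Fin.tail h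
          rfl
        · rintro ⟨x, hx⟩
          rw [Fin.sum_univ_succ, ← add_assoc] at hx
          obtain ⟨c, hc⟩ := hx.left
          have ha : Summ s (x 0) := ⟨c, of_add_of.1 hc⟩
          rw [of_add_of.2 ha.choose_spec] at hx
          exact ⟨⟨⟨x 0, ha⟩, Fin.tail x, hx⟩, Subtype.ext (Fin.cons_self_tail x)⟩)).symm
    rw [Cardinal.mk_congr e, Cardinal.mk_sigma]
    have : ∀ a : {x : F // Summ s x}, Cardinal.mk (SummableAfter a.2.choose m) = kappa F ^ m := by
      intro a
      refine ih _ ?_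
      by_cases h0 : a.2.choose = 0
      · refine Or.inr (hs.elim (fun h => kappa_eq_mk_of_isSum_zero hF h (a := a.1) ?_) id)
        rw [← h0]
        exact a.2.choose_spec
      · exact Or.inl h0
    simp only [this, Cardinal.sum_const', hk, pow_succ']

/-- A normalized tuple starts with `1`, and then the rest is any tuple summable after `1`, or it
starts with `0`, and then the rest is again normalized. -/
theorem mk_normalizedTuple (hF : IsPartialField F) (m : ℕ) :
    Cardinal.mk (NormalizedTuple F m) = ∑ i ∈ Finset.range m, kappa F ^ i := by
  induction m with
  | zero =>
    rw [Finset.range_zero, Finset.sum_empty, Cardinal.mk_eq_zero_iff]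
    exact ⟨fun x => x.2.2.choose.elim0⟩
  | succ m ih =>
    have e : SummableAfter (1 : F) m ⊕ NormalizedTuple F m ≃ NormalizedTuple F (m + 1) :=
      Equiv.ofBijective
        (Sum.elim
          (fun x => ⟨Fin.cons 1 x.1, by simpa [Fin.sum_univ_succ] using x.2,
            0, rfl, fun j hj => absurd hj (Fin.not_lt_zero j)⟩)
          (fun x => ⟨Fin.cons 0 x.1, by simpa [Fin.sum_univ_succ, of_zero] using x.2.1, by
            obtain ⟨i, hi, hi'⟩ := x.2.2
            refine ⟨i.succ, hi, fun j => ?_⟩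
            induction j using Fin.cases with
            | zero => exact fun _ => rfl
            | succ j => exact fun hj => hi' j (Fin.succ_lt_succ_iff.1 hj)⟩)) (by
        constructor
        · rintro (⟨x, hx⟩ | ⟨x, hx⟩) (⟨y, hy⟩ | ⟨y, hy⟩) h <;>
            replace h := congrArg Subtype.val h
          · exact congrArg Sum.inl (Subtype.ext (congrArg Fin.tail h))
          · exact absurd (congrFun h 0).symm hF.1
          · exact absurd (congrFun h 0) hF.1
          · exact congrArg Sum.inr (Subtype.ext (congrArg Fin.tail h))
        · rintro ⟨x, hx, i, hi, hi'⟩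
          induction i using Fin.cases with
          | zero =>
            refine ⟨Sum.inl ⟨Fin.tail x, ?_⟩, Subtype.ext ?_⟩
            · rw [Fin.sum_univ_succ, hi] at hx
              exact hx
            · change Fin.cons 1 (Fin.tail x) = x
              rw [← hi, Fin.cons_self_tail]
          | succ i =>
            have h0 : x 0 = 0 := hi' 0 (Fin.succ_pos i)
            refine ⟨Sum.inr ⟨Fin.tail x, ?_, i, hi, fun j hj => hi' _ (Fin.succ_lt_succ_iff.2 hj)⟩,
              Subtype.ext ?_⟩
            · rw [Fin.sum_univ_succ, h0, of_zero, zero_add] at hx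
              exact hx
            · change Fin.cons 0 (Fin.tail x) = x
              rw [← h0, Fin.cons_self_tail])
    rw [← Cardinal.mk_congr e, Cardinal.mk_sum, Cardinal.lift_id, Cardinal.lift_id,
      mk_summableAfter hF m 1 (Or.inl hF.1.symm), ih, Finset.sum_range_succ, add_comm]

end Count

/-! ### Sums in localizations with a common denominator -/

section CommonDenominator

variable {A : Type u} [PRing A]

theorem mk_eq_mk_same_iff {S : Submonoid A} {a b : A} {s : S} :
    Localization.mk a s = Localization.mk b s ↔ ∃ w ∈ S, w * a = w * b := by
  rw [Localization.mk_eq_mk_iff, Localization.r_iff_exists]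
  constructor
  · rintro ⟨c, hc⟩
    exact ⟨c * s, S.mul_mem c.2 s.2, by simpa only [mul_assoc] using hc⟩
  · rintro ⟨w, hw, h⟩
    refine ⟨⟨w, hw⟩, ?_⟩
    change w * (s * a) = w * (s * b)
    rw [mul_left_comm, h, mul_left_comm]

theorem isSum_mk_same_iff {S : Submonoid A} {a b c : A} {s : S} :
    IsSum (Localization.mk a s) (Localization.mk b s) (Localization.mk c s) ↔
      ∃ w ∈ S, IsSum (w * a) (w * b) (w * c) := by
  constructor
  · intro h
    obtain ⟨u, d, hd, h⟩ := (locIsSum_mk_iff _ _ _ _ _ _).1 h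
    rw [Localization.mk_eq_mk_iff, Localization.r_iff_exists] at h
    obtain ⟨v, hv⟩ := h
    refine ⟨v * u * s * s, S.mul_mem (S.mul_mem (S.mul_mem v.2 u.2) s.2) s.2, ?_⟩
    have := mul_isSum (v * s : A) hd
    have e : (v * s : A) * d = v * u * s * s * c := by
      calc (v * s : A) * d = v * (s * d) := mul_assoc _ _ _
        _ = v * ((u * (s * s) : S) * c) := hv.symm
        _ = _ := by push_cast; simp only [mul_assoc]
    rw [e] at this
    convert this using 1 <;> simp only [mul_comm, mul_left_comm]
  · rintro ⟨w, hw, h⟩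
    refine ⟨_, _, _, ⟨w, hw⟩ * s, h, ?_, ?_, ?_⟩ <;>
      exact (mk_mul_left_cancel S ⟨w, hw⟩ s _).symm

end CommonDenominator

/-! ### Partial subrings given by downward closed sets -/

namespace PartialSubring

variable {N : Type u} [CommSemiring N]

/-- A property of elements of `N` that is stable under products and passes to summands defines a
partial subring, in which a pair is summable if its sum has the property. -/
def ofProp (P : N → Prop) (h0 : P 0) (h1 : P 1) (hmul : ∀ a b, P a → P b → P (a * b))
    (hadd : ∀ a b, P (a + b) → P a) : PartialSubring N where
  carrier := {a | P a}
  rel a b := P (a + b)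
  left_mem h := hadd _ _ h
  add_mem h := h
  zero_mem := h0
  one_mem := h1
  mul_mem ha hb := hmul _ _ ha hb
  zero_rel {a} h := show P (0 + a) by rwa [zero_add]
  rel_comm {a b} h := show P (b + a) by rwa [add_comm]
  rel_assoc {a b c} _ h := by
    rw [add_assoc] at h
    exact ⟨hadd _ a (by rwa [add_comm]), h⟩
  rel_mul {a b x} h hx := by
    rw [← add_mul]
    exact hmul _ _ h hx

/-- A property that is stable under products, passes to summands and holds for the generators holds
for all elements, and for all sums of summable pairs. -/
theorem generated_induction {S : Set N} (P : N → Prop) (h0 : P 0) (h1 : P 1)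
    (hmul : ∀ a b, P a → P b → P (a * b)) (hadd : ∀ a b, P (a + b) → P a) (hS : ∀ s ∈ S, P s) :
    (∀ a ∈ (generated S).carrier, P a) ∧ ∀ a b, (generated S).rel a b → P (a + b) := by
  have h : (ofProp P h0 h1 hmul hadd).Admits S := by
    refine fun s hs => ⟨?_, ?_⟩
    · rintro t ⟨u, rfl⟩
      exact hadd _ _ (hS _ hs)
    · rintro a b ⟨u, rfl⟩
      exact hadd _ _ (hS _ hs)
  exact ⟨fun a ha => ha _ h, fun a b hab => hab _ h⟩

theorem generated_admits (S : Set N) : (generated S).Admits S :=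
  fun s hs => ⟨fun t ht _ hB => (hB s hs).1 t ht, fun a b hab _ hB => (hB s hs).2 a b hab⟩

end PartialSubring

/-! ### Homogeneous partial subrings of polynomial semirings -/

theorem MvPolynomial.IsHomogeneous.of_add_left {σ : Type u} {p q : MvPolynomial σ ℕ} {d : ℕ}
    (h : (p + q).IsHomogeneous d) : p.IsHomogeneous d := by
  intro m hm
  refine h ?_
  rw [MvPolynomial.coeff_add]
  omega

/-- A partial subring of `ℕ[y₀, …, yₙ]` that contains the variables, and all of whose elements
and sums are homogeneous. -/
class PartialSubring.IsHomogeneous {n : ℕ} (B : PartialSubring (NPoly n)) : Prop where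
  X_mem : ∀ i, MvPolynomial.X i ∈ B.carrier
  exists_degree : ∀ {a : NPoly n}, a ∈ B.carrier → ∃ d, a.IsHomogeneous d
  exists_degree_add : ∀ {a b : NPoly n}, B.rel a b → ∃ d, (a + b).IsHomogeneous d

theorem sum_X_isSubsum {n : ℕ} (s : Finset (Fin (n + 1))) :
    PartialSubring.IsSubsum (∑ i ∈ s, MvPolynomial.X i : NPoly n) (∑ i, MvPolynomial.X i) :=
  ⟨∑ i ∈ sᶜ, MvPolynomial.X i, Finset.sum_add_sum_compl s _⟩

instance (n : ℕ) : (coordRing n).IsHomogeneous :=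
  have h := PartialSubring.generated_induction (S := {(∑ i, MvPolynomial.X i : NPoly n)})
    (fun a => ∃ d, a.IsHomogeneous d) ⟨0, MvPolynomial.isHomogeneous_zero _ _ _⟩
    ⟨0, MvPolynomial.isHomogeneous_one _ _⟩
    (fun _ _ ⟨d, hd⟩ ⟨d', hd'⟩ => ⟨d + d', hd.mul hd'⟩)
    (fun _ _ ⟨d, hd⟩ => ⟨d, hd.of_add_left⟩)
    (by
      rintro _ rfl
      exact ⟨1, MvPolynomial.IsHomogeneous.sum _ _ _ fun i _ => MvPolynomial.isHomogeneous_X _ i⟩)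
  { X_mem := fun i => (PartialSubring.generated_admits {∑ i, MvPolynomial.X i} _ rfl).1 _ (by
      simpa using sum_X_isSubsum (n := n) {i})
    exists_degree := fun ha => h.1 _ ha
    exists_degree_add := fun hab => h.2 _ _ hab }

section Homogeneous

variable {n : ℕ} {B : PartialSubring (NPoly n)}

theorem IsSum.exists_degree [B.IsHomogeneous] {a b c : B} (h : IsSum a b c) :
    ∃ d, a.1.IsHomogeneous d ∧ b.1.IsHomogeneous d ∧ c.1.IsHomogeneous d := by
  obtain ⟨d, hd⟩ := PartialSubring.IsHomogeneous.exists_degree_add h.1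
  exact ⟨d, hd.of_add_left, (add_comm a.1 b.1 ▸ hd).of_add_left, h.2 ▸ hd⟩

variable (B) in
/-- The variable `yᵢ` as an element of `B`. -/
noncomputable def varElem [B.IsHomogeneous] (i : Fin (n + 1)) : B :=
  ⟨MvPolynomial.X i, PartialSubring.IsHomogeneous.X_mem i⟩

variable [B.IsHomogeneous] {T T' : Finset (Fin (n + 1))}

theorem varElem_homogeneous (i : Fin (n + 1)) : (varElem B i).1.IsHomogeneous 1 :=
  MvPolynomial.isHomogeneous_X _ i

theorem varElem_pow_homogeneous (i : Fin (n + 1)) (d : ℕ) :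
    (varElem B i ^ d).1.IsHomogeneous d := by
  induction d with
  | zero => exact MvPolynomial.isHomogeneous_one _ _
  | succ d ih =>
    rw [pow_succ]
    exact ih.mul (varElem_homogeneous i)

theorem varElem_mem {i : Fin (n + 1)} (hi : i ∈ T) : varElem B i ∈ varSubmonoid B T :=
  Submonoid.subset_closure ⟨i, hi, rfl⟩

/-- The power `yᵢ ^ d` as a denominator. -/
noncomputable def varPow (i : Fin (n + 1)) (hi : i ∈ T) (d : ℕ) : varSubmonoid B T :=
  ⟨varElem B i ^ d, Submonoid.pow_mem _ (varElem_mem hi) d⟩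

theorem varPow_add {i : Fin (n + 1)} (hi : i ∈ T) (d e : ℕ) :
    varPow (B := B) i hi (d + e) = varPow i hi d * varPow i hi e :=
  Subtype.ext (pow_add _ _ _)

/-- A degree of an element of `B`. -/
noncomputable def degB (f : B) : ℕ := (PartialSubring.IsHomogeneous.exists_degree f.2).choose

theorem degB_spec (f : B) : f.1.IsHomogeneous (degB f) :=
  (PartialSubring.IsHomogeneous.exists_degree f.2).choose_spec

/-- All choices of a degree of `f` give the same fraction, even for `f = 0`. -/
theorem mk_varPow_degB {i : Fin (n + 1)} (hi : i ∈ T) {f : B} {d : ℕ} (hf : f.1.IsHomogeneous d) :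
    Localization.mk f (varPow i hi (degB f)) = Localization.mk f (varPow i hi d) := by
  by_cases h0 : f.1 = 0
  · have : f = 0 := Subtype.ext h0
    rw [this, Localization.mk_zero, Localization.mk_zero]
  · rw [hf.inj_right (degB_spec f) h0]

/-- The dehomogenization `f ↦ f / yᵢ ^ deg f`. It is a homomorphism of partial rings because
summable elements of `B` have the same degree. -/
noncomputable def dehom (i : Fin (n + 1)) (hi : i ∈ T) : PRingHom B (DegZero B T) where
  toFun f := ⟨Localization.mk f (varPow i hi (degB f)), degB f, f, _, degB_spec f,
    varElem_pow_homogeneous i _, rfl⟩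
  map_zero' := Subtype.ext (Localization.mk_zero _)
  map_one' := Subtype.ext (by
    exact (mk_varPow_degB hi (MvPolynomial.isHomogeneous_one _ _)).trans Localization.mk_one)
  map_mul' f g := Subtype.ext (by
    change Localization.mk (f * g) _ = Localization.mk f _ * Localization.mk g _
    rw [mk_varPow_degB hi ((degB_spec f).mul (degB_spec g)), Localization.mk_mul, varPow_add])
  map_isSum' {a b c} h := by
    obtain ⟨d, ha, hb, hc⟩ := IsSum.exists_degree h
    change IsSum (Localization.mk a _) (Localization.mk b _) (Localization.mk c _)
    rw [mk_varPow_degB hi ha, mk_varPow_degB hi hb, mk_varPow_degB hi hc]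
    exact ⟨a, b, c, _, h, rfl, rfl, rfl⟩

theorem dehom_val {i : Fin (n + 1)} (hi : i ∈ T) {f : B} {d : ℕ} (hf : f.1.IsHomogeneous d) :
    (dehom i hi f).1 = Localization.mk f (varPow i hi d) := mk_varPow_degB hi hf

theorem dehom_varElem_self {i : Fin (n + 1)} (hi : i ∈ T) :
    dehom i hi (varElem B i) = 1 := Subtype.ext (by
  rw [dehom_val hi (varElem_homogeneous i), ← pow_one (varElem B i)]
  exact Localization.mk_self (varPow i hi 1))

theorem isUnit_dehom {i : Fin (n + 1)} (hi : i ∈ T) {g : B} (hg : g ∈ varSubmonoid B T) :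
    IsUnit (dehom i hi g) := by
  let y : DegZero B T := ⟨Localization.mk (varElem B i ^ degB g) ⟨g, hg⟩, degB g, _, _,
    varElem_pow_homogeneous i _, degB_spec g, rfl⟩
  refine IsUnit.of_mul_eq_one y (Subtype.ext ?_)
  change Localization.mk g (varPow i hi (degB g)) * Localization.mk _ _ = 1
  rw [Localization.mk_mul, ← Localization.mk_self (varPow i hi (degB g) * ⟨g, hg⟩)]
  congr 1
  exact mul_comm _ _

/-- Elements of `A^(T)` are quotients `(f / yᵢ ^ d) / (g / yᵢ ^ d)` with `g` a product of variables
from `T`. -/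
theorem exists_mul_dehom_eq {i : Fin (n + 1)} (hi : i ∈ T) (x : DegZero B T) :
    ∃ (d : ℕ) (f g : B), f.1.IsHomogeneous d ∧ g.1.IsHomogeneous d ∧ g ∈ varSubmonoid B T ∧
      x * dehom i hi g = dehom i hi f := by
  obtain ⟨x, d, f, s, hf, hs, rfl⟩ := x
  refine ⟨d, f, s, hf, hs, s.2, Subtype.ext ?_⟩
  change Localization.mk f s * (dehom i hi s.1).1 = _
  rw [dehom_val hi hf, dehom_val hi hs, Localization.mk_mul, mul_comm f, mk_mul_left_cancel]

/-- For elements of the same degree, equality of the dehomogenizations is equality in `B` up to a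
factor from `varSubmonoid B T`. -/
theorem exists_mul_eq_of_dehom_eq {i : Fin (n + 1)} (hi : i ∈ T) {f f' : B} {d : ℕ}
    (hf : f.1.IsHomogeneous d) (hf' : f'.1.IsHomogeneous d) (h : dehom i hi f = dehom i hi f') :
    ∃ w ∈ varSubmonoid B T, w * f = w * f' := by
  replace h := congrArg Subtype.val h
  rw [dehom_val hi hf, dehom_val hi hf'] at h
  exact mk_eq_mk_same_iff.1 h

theorem exists_isSum_of_dehom {i : Fin (n + 1)} (hi : i ∈ T) {f f' f'' : B} {d : ℕ}
    (hf : f.1.IsHomogeneous d) (hf' : f'.1.IsHomogeneous d) (hf'' : f''.1.IsHomogeneous d)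
    (h : IsSum (dehom i hi f) (dehom i hi f') (dehom i hi f'')) :
    ∃ w ∈ varSubmonoid B T, IsSum (w * f) (w * f') (w * f'') := by
  replace h : IsSum (dehom i hi f).1 (dehom i hi f').1 (dehom i hi f'').1 := h
  rw [dehom_val hi hf, dehom_val hi hf', dehom_val hi hf''] at h
  exact isSum_mk_same_iff.1 h

theorem degZeroMap_dehom (h : T ⊆ T') {i : Fin (n + 1)} (hi : i ∈ T) (f : B) :
    degZeroMap B h (dehom i hi f) = dehom i (h hi) f := rfl

/-- Dehomogenizations with respect to different variables differ by powers of `yⱼ / yᵢ`. -/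
theorem dehom_eq_mul {i j : Fin (n + 1)} (hi : i ∈ T) (hj : j ∈ T) {f : B} {d : ℕ}
    (hf : f.1.IsHomogeneous d) :
    dehom i hi f = dehom i hi (varElem B j) ^ d * dehom j hj f := by
  rw [← map_pow]
  refine Subtype.ext ?_
  change (dehom i hi f).1 = (dehom i hi (varElem B j ^ d)).1 * (dehom j hj f).1
  rw [dehom_val hi hf, dehom_val hj hf, dehom_val hi (varElem_pow_homogeneous j d),
    Localization.mk_mul, mul_comm (varPow i hi d)]
  exact (mk_mul_left_cancel _ (varPow j hj d) _ _).symm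

end Homogeneous

/-! ### Open immersions of charts -/

theorem PSpec.localMap_id {A : Type u} [PRing A] (p : PSpec A) (x : p.LocalAt) :
    PSpec.localMap (PRingHom.id A) p x = x := by
  induction x using Localization.induction_on with
  | H x => rfl

/-- Fractions that describe the elements of the local partial rings of all charts uniformly.  They
encode that points in different charts that are identified in the glued space have the same local
partial ring, which replaces the cocycle condition on triple overlaps. -/
structure FractionSystem (D : AffineGlueData.{u}) where
  /-- The fractions. -/
  K : Type u
  /-- The relation `x = k` between elements `x` of the local partial ring at `e` and fractions. -/
  IsFrac : ∀ e : D.Charts, K → e.2.LocalAt → Prop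
  /-- Points identified in the glued space are identified in a single overlap of two charts. -/
  rel_of_proj_eq : ∀ {e e' : D.Charts}, D.proj e = D.proj e' → D.Rel e e'
  isOpenEmbedding : ∀ i, Topology.IsOpenEmbedding fun p : PSpec (D.A i) => D.proj ⟨i, p⟩
  exists_isFrac : ∀ (e : D.Charts) (x : e.2.LocalAt), ∃ k, IsFrac e k x
  /-- Sections of the structure sheaf of a chart are locally given by a single fraction. -/
  isLocFrac_iff : ∀ (i : D.ι) (U : Opens (PSpec (D.A i)))
    (s : ∀ p : PSpec (D.A i), p ∈ U → p.LocalAt),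
    IsLocFrac U s ↔ ∀ p ∈ U, ∃ (V : Opens (PSpec (D.A i))) (k : K), p ∈ V ∧ V ≤ U ∧
      ∀ q ∈ V, ∀ hU : q ∈ U, IsFrac ⟨i, q⟩ k (s q hU)
  /-- A fraction defined at a point of a chart is defined at all points identified with it. -/
  exists_of_proj_eq : ∀ {e e' : D.Charts}, D.proj e = D.proj e' →
    ∀ {k : K} {x : e.2.LocalAt}, IsFrac e k x → ∃ x', IsFrac e' k x'
  /-- Which fractions are equal depends only on the image of the point in the glued space. -/
  unique : ∀ {e e' : D.Charts}, D.proj e = D.proj e' →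
    ∀ {k l : K} {x : e.2.LocalAt} {y y' : e'.2.LocalAt}, IsFrac e k x → IsFrac e' k y →
      IsFrac e l x → IsFrac e' l y' → y = y'
  /-- Which fractions are summable depends only on the image of the point in the glued space. -/
  isSum : ∀ {e e' : D.Charts}, D.proj e = D.proj e' →
    ∀ {k l m : K} {x y z : e.2.LocalAt} {x' y' z' : e'.2.LocalAt}, IsFrac e k x → IsFrac e' k x' →
      IsFrac e l y → IsFrac e' l y' → IsFrac e m z → IsFrac e' m z' → IsSum x y z → IsSum x' y' z'
  /-- The gluing maps identify elements exactly if they are given by the same fraction. -/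
  localMap_eq_iff : ∀ (i j : D.ι) (r : PSpec (D.A₂ i j)) (x : (PSpec.comap (D.left i j) r).LocalAt)
    (y : (PSpec.comap (D.right i j) r).LocalAt),
    PSpec.localMap (D.left i j) r x = PSpec.localMap (D.right i j) r y ↔
      ∃ k, IsFrac ⟨i, _⟩ k x ∧ IsFrac ⟨j, _⟩ k y

namespace FractionSystem

variable {D : AffineGlueData.{u}} {S : FractionSystem D}

/-- The elements `x` and `x'` of local partial rings of charts are given by the same fraction. -/
def Agree (S : FractionSystem D) (e e' : D.Charts) (x : e.2.LocalAt) (x' : e'.2.LocalAt) : Prop :=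
  ∃ k, S.IsFrac e k x ∧ S.IsFrac e' k x'

theorem Agree.unique {e e' : D.Charts} (h : D.proj e = D.proj e') {x : e.2.LocalAt}
    {y y' : e'.2.LocalAt} (hy : S.Agree e e' x y) (hy' : S.Agree e e' x y') : y = y' := by
  obtain ⟨k, h₁, h₂⟩ := hy
  obtain ⟨l, h₃, h₄⟩ := hy'
  exact S.unique h h₁ h₂ h₃ h₄

theorem Agree.symm {e e' : D.Charts} {x : e.2.LocalAt} {x' : e'.2.LocalAt}
    (h : S.Agree e e' x x') : S.Agree e' e x' x := by
  obtain ⟨k, h₁, h₂⟩ := h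
  exact ⟨k, h₂, h₁⟩

theorem Agree.trans {e e' e'' : D.Charts} (h : D.proj e' = D.proj e'') {x : e.2.LocalAt}
    {y : e'.2.LocalAt} {z : e''.2.LocalAt} (hy : S.Agree e e' x y) (hz : S.Agree e' e'' y z) :
    S.Agree e e'' x z := by
  obtain ⟨k, h₁, h₂⟩ := hy
  obtain ⟨z', hz'⟩ := S.exists_of_proj_eq h h₂
  obtain rfl := Agree.unique h hz ⟨k, h₂, hz'⟩
  exact ⟨k, h₁, hz'⟩

theorem agree_of_isSection (S : FractionSystem D) {V : Opens D.Carrier}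
    {s : ∀ e : D.Charts, D.proj e ∈ V → e.2.LocalAt}
    (hs : D.IsSection V s) {e e' : D.Charts} (h : D.proj e = D.proj e') (he : D.proj e ∈ V)
    (he' : D.proj e' ∈ V) : S.Agree e e' (s e he) (s e' he') := by
  obtain ⟨i, j, r⟩ := S.rel_of_proj_eq h
  exact (S.localMap_eq_iff i j r _ _).1 (hs.2 i j r he he')

/-- Over an open subset of the image of the `i`-th chart, a section of the structure sheaf of the
chart is a section of the glued space: its values in the other charts are given by the same
fractions. -/
theorem exists_section (S : FractionSystem D) (i : D.ι) {V : Opens D.Carrier}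
    (hV : ∀ e, D.proj e ∈ V → ∃ p : PSpec (D.A i), D.proj ⟨i, p⟩ = D.proj e)
    (t : ∀ p : PSpec (D.A i), p ∈ D.preim i V → p.LocalAt) (ht : IsLocFrac (D.preim i V) t) :
    ∃ s : D.funSheafData.Sec V, ∀ p hp, s.1 ⟨i, p⟩ hp = t p hp := by
  have H : ∀ (e : D.Charts) (he : D.proj e ∈ V), ∃ x : e.2.LocalAt, ∀ (p : PSpec (D.A i))
      (_ : D.proj ⟨i, p⟩ = D.proj e) (hpV : D.proj ⟨i, p⟩ ∈ V),
      S.Agree ⟨i, p⟩ e (t p hpV) x := by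
    intro e he
    obtain ⟨p, hp⟩ := hV e he
    have hpV : D.proj ⟨i, p⟩ ∈ V := hp ▸ he
    obtain ⟨k, hk⟩ := S.exists_isFrac ⟨i, p⟩ (t p hpV)
    obtain ⟨x, hx⟩ := S.exists_of_proj_eq hp hk
    refine ⟨x, fun p' hp' hpV' => ?_⟩
    obtain rfl : p = p' := (S.isOpenEmbedding i).injective (hp.trans hp'.symm)
    exact ⟨k, hk, hx⟩
  choose s hs using H
  refine ⟨⟨s, fun j => ?_, fun j k r hj hk => ?_⟩, fun p hp => ?_⟩
  · refine (S.isLocFrac_iff j _ _).2 fun q hq => ?_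
    obtain ⟨p, hp⟩ := hV ⟨j, q⟩ hq
    have hpV : D.proj ⟨i, p⟩ ∈ V := by rw [hp]; exact hq
    obtain ⟨W, k, hW, hWV, hfrac⟩ := (S.isLocFrac_iff i _ _).1 ht p hpV
    refine ⟨D.preim j ⟨_, (S.isOpenEmbedding i).isOpenMap W W.isOpen⟩, k, ⟨p, hW, hp⟩, ?_, ?_⟩
    · rintro q' ⟨p', hp', h⟩
      replace h : D.proj ⟨i, p'⟩ = D.proj ⟨j, q'⟩ := h
      change D.proj ⟨j, q'⟩ ∈ V
      rw [← h]
      exact hWV hp'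
    · rintro q' ⟨p', hp', h⟩ hq'
      have hf := hfrac p' hp' (hWV hp')
      obtain ⟨x, hx⟩ := S.exists_of_proj_eq h hf
      have := Agree.unique h (hs ⟨j, q'⟩ hq' p' h (hWV hp')) ⟨k, hf, hx⟩
      change S.IsFrac _ _ (s ⟨j, q'⟩ hq')
      rw [this]
      exact hx
  · obtain ⟨p, hp⟩ := hV _ hj
    have hpV : D.proj ⟨i, p⟩ ∈ V := hp ▸ hj
    have hp' := hp.trans (Quot.sound (AffineGlueData.Rel.glue j k r))
    exact (S.localMap_eq_iff j k r _ _).2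
      (Agree.trans hp' (hs _ hj p hp hpV).symm (hs _ hk p hp' hpV))
  · obtain ⟨k, h₁, h₂⟩ := hs ⟨i, p⟩ hp p rfl hp
    exact S.unique rfl h₁ h₂ h₁ h₁

/-- The charts are open immersions, since a section over the image of a chart is determined by its
values in that chart. -/
theorem isOpenImmersion (S : FractionSystem D) (i : D.ι) :
    (D.specMap i (PRingHom.id (D.A i))).IsOpenImmersion := by
  have hval : ∀ (V : Opens D.Carrier) (s : D.funSheafData.Sec V) (p : PSpec (D.A i))
      (hp : D.proj ⟨i, p⟩ ∈ V), ((D.specMap i (PRingHom.id (D.A i))).app V s).1 p hp =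
        s.1 ⟨i, p⟩ hp := fun V s p hp => PSpec.localMap_id p _
  refine ⟨S.isOpenEmbedding i, fun V hV => ⟨?_, ?_⟩, ?_⟩
  · intro s s' h
    refine FunSheafData.Sec.ext fun e he => ?_
    obtain ⟨p, hp⟩ : ∃ p : PSpec (D.A i), D.proj ⟨i, p⟩ = D.proj e := hV he
    have hpV : D.proj ⟨i, p⟩ ∈ V := hp ▸ he
    have h₁ := congrFun (congrFun (congrArg Subtype.val h) p) hpV
    replace h₁ : s.1 ⟨i, p⟩ hpV = s'.1 ⟨i, p⟩ hpV :=
      (hval V s p hpV).symm.trans (h₁.trans (hval V s' p hpV))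
    have a := S.agree_of_isSection s.2 hp hpV he
    rw [h₁] at a
    exact Agree.unique hp a (S.agree_of_isSection s'.2 hp hpV he)
  · rintro ⟨t, ht⟩
    obtain ⟨s, hs⟩ := S.exists_section i (fun e he => hV he) t ht
    exact ⟨s, FunSheafData.Sec.ext fun p hp => (hval V s p hp).trans (hs p hp)⟩
  · refine fun V hV a b c => ⟨fun h e he => ?_, fun h => PRingHom.map_isSum _ h⟩
    obtain ⟨p, hp⟩ : ∃ p : PSpec (D.A i), D.proj ⟨i, p⟩ = D.proj e := hV he
    have hpV : D.proj ⟨i, p⟩ ∈ V := hp ▸ he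
    have h₁ : IsSum (A := PSpec.LocalAt p) (a.1 ⟨i, p⟩ hpV) (b.1 ⟨i, p⟩ hpV) (c.1 ⟨i, p⟩ hpV) := by
      rw [← hval V a p hpV, ← hval V b p hpV, ← hval V c p hpV]
      exact h p hpV
    obtain ⟨k, ha, ha'⟩ := S.agree_of_isSection a.2 hp hpV he
    obtain ⟨l, hb, hb'⟩ := S.agree_of_isSection b.2 hp hpV he
    obtain ⟨m, hc, hc'⟩ := S.agree_of_isSection c.2 hp hpV he
    exact S.isSum hp ha ha' hb hb' hc hc' h₁

theorem isPartialScheme (S : FractionSystem D) : IsPartialScheme D.glued := by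
  intro x
  obtain ⟨⟨i, p⟩, rfl⟩ := Quot.mk_surjective x
  exact ⟨D.A i, inferInstance, D.specMap i (PRingHom.id (D.A i)), S.isOpenImmersion i, p, rfl⟩

end FractionSystem

/-! ### Homogeneous primes and homogeneous fractions -/

section Cone

variable {n : ℕ} {B : PartialSubring (NPoly n)} [B.IsHomogeneous]
  {T T' : Finset (Fin (n + 1))}

/-- The homogeneous prime ideal `{f | f / yᵢ ^ deg f ∈ 𝔭}` of `B` corresponding to a prime ideal `𝔭`
of `A^(T)`, `i ∈ T`. -/
noncomputable def cone (i : Fin (n + 1)) (hi : i ∈ T) (p : PSpec (DegZero B T)) : PSpec B :=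
  PSpec.comap (dehom i hi) p

theorem mem_cone_compl {i : Fin (n + 1)} {hi : i ∈ T} {p : PSpec (DegZero B T)} {f : B} :
    f ∈ (cone i hi p).compl ↔ dehom i hi f ∈ p.compl := Iff.rfl

theorem PSpec.mem_compl_of_isUnit {A : Type u} [PRing A] (p : PSpec A) {a : A} (ha : IsUnit a) :
    a ∈ p.compl := by
  obtain ⟨b, hb⟩ := ha.exists_left_inv
  exact fun h => PIdeal.one_notMem p.isPrime.1 (hb ▸ p.ideal.mul_mem b h)

theorem PSpec.left_mem_compl {A : Type u} [PRing A] (p : PSpec A) {a b : A}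
    (h : a * b ∈ p.compl) : a ∈ p.compl :=
  fun ha => h (mul_comm b a ▸ p.ideal.mul_mem b ha)

theorem cone_eq_cone {i j : Fin (n + 1)} (hi : i ∈ T) (hj : j ∈ T) (p : PSpec (DegZero B T)) :
    cone i hi p = cone j hj p := by
  refine PSpec.ext (PIdeal.ext (Set.ext fun f => ?_))
  change dehom i hi f ∈ p.ideal.carrier ↔ dehom j hj f ∈ p.ideal.carrier
  constructor <;> intro h
  · rw [dehom_eq_mul hj hi (degB_spec f)]
    exact p.ideal.mul_mem _ h
  · rw [dehom_eq_mul hi hj (degB_spec f)]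
    exact p.ideal.mul_mem _ h

theorem varSubmonoid_le_cone_compl {i : Fin (n + 1)} (hi : i ∈ T) (p : PSpec (DegZero B T)) :
    varSubmonoid B T ≤ (cone i hi p).compl :=
  fun _ hg => p.mem_compl_of_isUnit (isUnit_dehom hi hg)

theorem mul_dehom_mem_compl {i : Fin (n + 1)} (hi : i ∈ T) {p : PSpec (DegZero B T)}
    {x : DegZero B T} (hx : x ∈ p.compl) {f g : B} (hg : g ∈ varSubmonoid B T)
    (h : x * dehom i hi g = dehom i hi f) : f ∈ (cone i hi p).compl :=
  mem_cone_compl.2 (h ▸ p.compl.mul_mem hx (varSubmonoid_le_cone_compl hi p hg))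

/-- The element `x` of the localization of `A^(T)` at `𝔭` is the fraction `f / g` of homogeneous
elements of `B` of the same degree. -/
def IsFrac (p : PSpec (DegZero B T)) (f g : B) (x : p.LocalAt) : Prop :=
  ∃ d, f.1.IsHomogeneous d ∧ g.1.IsHomogeneous d ∧ ∀ (i : Fin (n + 1)) (hi : i ∈ T),
    ∃ hg : dehom i hi g ∈ p.compl, x = Localization.mk (dehom i hi f) ⟨dehom i hi g, hg⟩

variable {p : PSpec (DegZero B T)} {p' : PSpec (DegZero B T')}

/-- It suffices to check the condition for a single `i ∈ T`, since `f` and `g` have the same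
degree. -/
theorem IsFrac.of_index {i : Fin (n + 1)} (hi : i ∈ T) {f g : B} {d : ℕ}
    (hf : f.1.IsHomogeneous d) (hg : g.1.IsHomogeneous d) (h : dehom i hi g ∈ p.compl) :
    IsFrac p f g (Localization.mk (dehom i hi f) ⟨dehom i hi g, h⟩) := by
  refine ⟨d, hf, hg, fun j hj => ?_⟩
  have ef := dehom_eq_mul hi hj hf
  have eg := dehom_eq_mul hi hj hg
  have hu : dehom i hi (varElem B j) ^ d ∈ p.compl := p.left_mem_compl (eg ▸ h)
  have hj' : dehom j hj g ∈ p.compl := by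
    rw [← mem_cone_compl, ← cone_eq_cone hi hj]
    exact h
  refine ⟨hj', ?_⟩
  rw [← mk_mul_left_cancel p.compl ⟨_, hu⟩ ⟨_, hj'⟩ (dehom j hj f)]
  congr 1
  exact Subtype.ext eg

theorem isFrac_mk {i : Fin (n + 1)} (hi : i ∈ T) {a t : DegZero B T} {f g f' g' : B} {d d' : ℕ}
    (hf : f.1.IsHomogeneous d) (hg : g.1.IsHomogeneous d) (hgT : g ∈ varSubmonoid B T)
    (h : a * dehom i hi g = dehom i hi f) (hf' : f'.1.IsHomogeneous d')
    (hg' : g'.1.IsHomogeneous d') (hgT' : g' ∈ varSubmonoid B T)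
    (h' : t * dehom i hi g' = dehom i hi f') {ht : t ∈ p.compl} :
    IsFrac p (f * g') (g * f') (Localization.mk a ⟨t, ht⟩) := by
  have hfp := mul_dehom_mem_compl hi ht hgT' h'
  have hgp := varSubmonoid_le_cone_compl hi p hgT
  have hgp' := varSubmonoid_le_cone_compl hi p hgT'
  have := IsFrac.of_index (p := p) (f := f * g') (g := g * f') hi (hf.mul hg') (hg.mul hf')
    ((cone i hi p).compl.mul_mem hgp hfp)
  convert this using 1
  rw [← mk_mul_left_cancel p.compl (⟨_, hgp⟩ * ⟨_, hgp'⟩) ⟨t, ht⟩ a]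
  congr 1
  · rw [map_mul, ← h]
    simp only [Submonoid.coe_mul, mul_comm, mul_left_comm]
  · refine Subtype.ext ?_
    change dehom i hi g * dehom i hi g' * t = dehom i hi (g * f')
    rw [map_mul, ← h', mul_assoc, mul_comm t]

theorem exists_isFrac {i : Fin (n + 1)} (hi : i ∈ T) (x : p.LocalAt) :
    ∃ f g, IsFrac p f g x := by
  induction x using Localization.induction_on with
  | H x =>
    obtain ⟨a, t, ht⟩ := x
    obtain ⟨d, f, g, hf, hg, hgT, h⟩ := exists_mul_dehom_eq hi a
    obtain ⟨d', f', g', hf', hg', hgT', h'⟩ := exists_mul_dehom_eq hi t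
    exact ⟨f * g', g * f', isFrac_mk hi hf hg hgT h hf' hg' hgT' h'⟩

theorem IsFrac.mul_right {i : Fin (n + 1)} (hi : i ∈ T) {f g k : B} {x : p.LocalAt}
    (h : IsFrac p f g x) (hk : k ∈ (cone i hi p).compl) : IsFrac p (f * k) (g * k) x := by
  obtain ⟨d, hf, hg, h⟩ := h
  obtain ⟨hg', rfl⟩ := h i hi
  have := IsFrac.of_index (p := p) (f := f * k) (g := g * k) hi (hf.mul (degB_spec k))
    (hg.mul (degB_spec k)) ((cone i hi p).compl.mul_mem hg' hk)
  convert this using 1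
  rw [← mk_mul_left_cancel p.compl ⟨_, hk⟩ _ (dehom i hi f)]
  congr 1
  · rw [map_mul, mul_comm]
  · refine Subtype.ext ?_
    change dehom i hi k * dehom i hi g = dehom i hi (g * k)
    rw [map_mul, mul_comm]

theorem IsFrac.denom_mem {i : Fin (n + 1)} (hi : i ∈ T) {f g : B} {x : p.LocalAt}
    (h : IsFrac p f g x) : g ∈ (cone i hi p).compl := by
  obtain ⟨d, hf, hg, h⟩ := h
  exact (h i hi).1

/-- Equality of fractions with a common denominator is a condition that involves only the
homogeneous prime ideal of the point. -/
theorem IsFrac.eq_iff {i : Fin (n + 1)} (hi : i ∈ T) {f f' g : B} {x y : p.LocalAt}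
    (hx : IsFrac p f g x) (hy : IsFrac p f' g y) :
    x = y ↔ ∃ h ∈ (cone i hi p).compl, h * f = h * f' := by
  by_cases hg0 : g.1 = 0
  · exact absurd (p.ideal.zero_mem) (by
      have := hx.denom_mem hi
      rw [show g = 0 from Subtype.ext hg0, mem_cone_compl, map_zero] at this
      exact this)
  obtain ⟨d, hf, hg, hx⟩ := hx
  obtain ⟨d', hf', hg', hy⟩ := hy
  obtain rfl := hg.inj_right hg' hg0
  obtain ⟨_, rfl⟩ := hx i hi
  obtain ⟨_, rfl⟩ := hy i hi
  rw [mk_eq_mk_same_iff]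
  constructor
  · rintro ⟨w, hw, h⟩
    obtain ⟨e, a, b, ha, hb, hbT, hab⟩ := exists_mul_dehom_eq hi w
    have key : dehom i hi (a * f) = dehom i hi (a * f') := by
      rw [map_mul, map_mul, ← hab, mul_right_comm, h, mul_right_comm]
    obtain ⟨c, hc, h⟩ := exists_mul_eq_of_dehom_eq hi (ha.mul hf) (ha.mul hf') key
    refine ⟨c * a, (cone i hi p).compl.mul_mem (varSubmonoid_le_cone_compl hi p hc)
      (mul_dehom_mem_compl hi hw hbT hab), ?_⟩
    rw [mul_assoc, h, mul_assoc]
  · rintro ⟨h, hp, e⟩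
    exact ⟨_, hp, by rw [← map_mul, e, map_mul]⟩

/-- Summability of fractions with a common denominator is a condition that involves only the
homogeneous prime ideal of the point. -/
theorem IsFrac.isSum_iff {i : Fin (n + 1)} (hi : i ∈ T) {f f' f'' g : B} {x y z : p.LocalAt}
    (hx : IsFrac p f g x) (hy : IsFrac p f' g y) (hz : IsFrac p f'' g z) :
    IsSum x y z ↔ ∃ h ∈ (cone i hi p).compl, IsSum (h * f) (h * f') (h * f'') := by
  by_cases hg0 : g.1 = 0
  · exact absurd (p.ideal.zero_mem) (by
      have := hx.denom_mem hi
      rw [show g = 0 from Subtype.ext hg0, mem_cone_compl, map_zero] at this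
      exact this)
  obtain ⟨d, hf, hg, hx⟩ := hx
  obtain ⟨d', hf', hg', hy⟩ := hy
  obtain ⟨d'', hf'', hg'', hz⟩ := hz
  obtain rfl := hg.inj_right hg' hg0
  obtain rfl := hg.inj_right hg'' hg0
  obtain ⟨_, rfl⟩ := hx i hi
  obtain ⟨_, rfl⟩ := hy i hi
  obtain ⟨_, rfl⟩ := hz i hi
  rw [isSum_mk_same_iff]
  constructor
  · rintro ⟨w, hw, h⟩
    obtain ⟨e, a, b, ha, hb, hbT, hab⟩ := exists_mul_dehom_eq hi w
    have key : IsSum (dehom i hi (a * f)) (dehom i hi (a * f')) (dehom i hi (a * f'')) := by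
      have := isSum_mul (dehom i hi b) h
      simp only [mul_right_comm w _ (dehom i hi b), hab, ← map_mul] at this
      exact this
    obtain ⟨c, hc, h⟩ := exists_isSum_of_dehom hi (ha.mul hf) (ha.mul hf') (ha.mul hf'') key
    refine ⟨c * a, (cone i hi p).compl.mul_mem (varSubmonoid_le_cone_compl hi p hc)
      (mul_dehom_mem_compl hi hw hbT hab), ?_⟩
    simpa only [mul_assoc] using h
  · rintro ⟨h, hp, e⟩
    refine ⟨_, hp, ?_⟩
    simpa only [map_mul] using (dehom i hi).map_isSum e

theorem IsFrac.exists_of_cone_eq {i i' : Fin (n + 1)} {hi : i ∈ T} {hi' : i' ∈ T'}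
    (hp : cone i hi p = cone i' hi' p') {f g : B} {x : p.LocalAt} (hx : IsFrac p f g x) :
    ∃ x' : p'.LocalAt, IsFrac p' f g x' := by
  have hg' := hp ▸ hx.denom_mem hi
  obtain ⟨d, hf, hg, -⟩ := hx
  exact ⟨_, IsFrac.of_index hi' hf hg hg'⟩

theorem IsFrac.unique {i i' : Fin (n + 1)} {hi : i ∈ T} {hi' : i' ∈ T'}
    (hp : cone i hi p = cone i' hi' p') {f g f' g' : B} {x : p.LocalAt} {y y' : p'.LocalAt}
    (h₁ : IsFrac p f g x) (h₂ : IsFrac p' f g y) (h₁' : IsFrac p f' g' x)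
    (h₂' : IsFrac p' f' g' y') : y = y' := by
  have hg := h₁.denom_mem hi
  have hg' := h₁'.denom_mem hi
  have e := ((h₁.mul_right hi hg').eq_iff hi (mul_comm g g' ▸ h₁'.mul_right hi hg)).1 rfl
  rw [hp] at hg hg' e
  exact ((h₂.mul_right hi' hg').eq_iff hi' (mul_comm g g' ▸ h₂'.mul_right hi' hg)).2 e

theorem IsFrac.isSum {i i' : Fin (n + 1)} {hi : i ∈ T} {hi' : i' ∈ T'}
    (hp : cone i hi p = cone i' hi' p') {a b c r s t : B} {x y z : p.LocalAt}
    {x' y' z' : p'.LocalAt} (ha : IsFrac p a r x) (ha' : IsFrac p' a r x') (hb : IsFrac p b s y)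
    (hb' : IsFrac p' b s y') (hc : IsFrac p c t z) (hc' : IsFrac p' c t z') (h : IsSum x y z) :
    IsSum x' y' z' := by
  have hr := ha.denom_mem hi
  have hs := hb.denom_mem hi
  have ht := hc.denom_mem hi
  have e₁ : s * (r * t) = r * (s * t) := mul_left_comm _ _ _
  have e₂ : t * (r * s) = r * (s * t) := by rw [mul_left_comm, mul_comm t s]
  have key := ((ha.mul_right hi (mul_mem hs ht)).isSum_iff hi
    (e₁ ▸ hb.mul_right hi (mul_mem hr ht)) (e₂ ▸ hc.mul_right hi (mul_mem hr hs))).1 h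
  rw [hp] at hr hs ht key
  exact ((ha'.mul_right hi' (mul_mem hs ht)).isSum_iff hi'
    (e₁ ▸ hb'.mul_right hi' (mul_mem hr ht)) (e₂ ▸ hc'.mul_right hi' (mul_mem hr hs))).2 key

theorem cone_comap_degZeroMap (h : T ⊆ T') {i : Fin (n + 1)} (hi : i ∈ T)
    (r : PSpec (DegZero B T')) :
    cone i hi (PSpec.comap (degZeroMap B h) r) = cone i (h hi) r := by
  refine PSpec.ext (PIdeal.ext (Set.ext fun f => ?_))
  change degZeroMap B h (dehom i hi f) ∈ r.ideal.carrier ↔ dehom i (h hi) f ∈ r.ideal.carrier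
  rw [degZeroMap_dehom]

theorem IsFrac.localMap (h : T ⊆ T') {i : Fin (n + 1)} (hi : i ∈ T) {r : PSpec (DegZero B T')}
    {f g : B} {x : (PSpec.comap (degZeroMap B h) r).LocalAt} (hx : IsFrac _ f g x) :
    IsFrac r f g (PSpec.localMap (degZeroMap B h) r x) := by
  obtain ⟨d, hf, hg, hx⟩ := hx
  obtain ⟨hg', rfl⟩ := hx i hi
  have key := degZeroMap_dehom (B := B) h hi
  have := IsFrac.of_index (p := r) (h hi) hf hg (key g ▸ hg')
  simp only [← key] at this
  exact this

/-- A homogeneous prime ideal that contains none of the `yₖ`, `k ∈ T'`, comes from a prime ideal of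
`A^(T')`. -/
theorem exists_cone_eq {i j : Fin (n + 1)} (hi : i ∈ T) (hj : j ∈ T') (p : PSpec (DegZero B T))
    (hT : varSubmonoid B T' ≤ (cone i hi p).compl) :
    ∃ r : PSpec (DegZero B T'), cone j hj r = cone i hi p := by
  let P := (cone i hi p).ideal
  have hP : P.IsPrime := (cone i hi p).isPrime
  have key : ∀ (f f' : B) (s s' : varSubmonoid B T'),
      Localization.mk f s = Localization.mk f' s' → f ∈ P.carrier → f' ∈ P.carrier := by
    intro f f' s s' h hf
    rw [Localization.mk_eq_mk_iff, Localization.r_iff_exists] at h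
    obtain ⟨c, hc⟩ := h
    have h₁ : (c : B) * (s * f') ∈ P.carrier := hc ▸ P.mul_mem _ (P.mul_mem _ hf)
    exact (hP.2 _ _ ((hP.2 _ _ h₁).resolve_left (hT c.2))).resolve_left (hT s.2)
  let I : PIdeal (DegZero B T') :=
    { carrier := {x | ∀ f s, x.1 = Localization.mk f s → f ∈ P.carrier}
      zero_mem := fun f s h =>
        key 0 f 1 s ((Localization.mk_zero _).trans h) P.zero_mem
      sum_mem := by
        intro x y z hx hy h f s hz
        obtain ⟨a, b, c, t, hs, ha, hb, hc⟩ := h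
        exact key c f t s (hc.symm.trans hz) (P.sum_mem (hx _ _ ha) (hy _ _ hb) hs)
      mul_mem := by
        intro x y hy f s hz
        obtain ⟨-, a, t, -, -, ha⟩ := x.2
        obtain ⟨-, b, t', -, -, hb⟩ := y.2
        refine key (a * b) f (t * t') s (Eq.trans ?_ hz) (P.mul_mem _ (hy b t' hb))
        exact (Localization.mk_mul _ _ _ _).symm.trans (congrArg₂ _ ha hb).symm }
  have hmem : ∀ (x : DegZero B T') (f : B) (s : varSubmonoid B T'), x.1 = Localization.mk f s →
      (x ∈ I.carrier ↔ f ∈ P.carrier) := fun x f s h =>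
    ⟨fun hx => hx f s h, fun hf f' s' h' => key f f' s s' (h.symm.trans h') hf⟩
  have hI : I.IsPrime := by
    refine ⟨fun h => ?_, ?_⟩
    · have h1 : (1 : DegZero B T') ∈ I.carrier := h ▸ Set.mem_univ _
      exact PIdeal.one_notMem hP.1 (h1 1 1 Localization.mk_one.symm)
    · rintro ⟨x, d, a, t, ha, ht, rfl⟩ ⟨y, d', b, t', hb, ht', rfl⟩ h
      refine (hP.2 a b (h _ _ (Localization.mk_mul _ _ _ _))).imp ?_ ?_
      · exact (hmem _ _ _ rfl).2
      · exact (hmem _ _ _ rfl).2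
  refine ⟨⟨I, hI⟩, PSpec.ext (PIdeal.ext (Set.ext fun f => ?_))⟩
  exact hmem _ _ _ (dehom_val hj (degB_spec f))

theorem cone_injective {i : Fin (n + 1)} (hi : i ∈ T) :
    Function.Injective (cone (B := B) i hi) := by
  intro p q h
  refine PSpec.ext (PIdeal.ext (Set.ext fun x => ?_))
  obtain ⟨d, f, g, hf, hg, hgT, hx⟩ := exists_mul_dehom_eq hi x
  have key : ∀ p : PSpec (DegZero B T), x ∈ p.ideal.carrier ↔ f ∈ (cone i hi p).ideal.carrier := by
    intro p
    change _ ↔ dehom i hi f ∈ p.ideal.carrier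
    rw [← hx]
    refine ⟨fun h => mul_comm x _ ▸ p.ideal.mul_mem _ h, fun h => ?_⟩
    exact (p.isPrime.2 _ _ h).resolve_right (varSubmonoid_le_cone_compl hi p hgT)
  rw [key, key, h]

/-- The Zariski topology of a chart is induced by that of `Spec B`. -/
theorem isInducing_cone {i : Fin (n + 1)} (hi : i ∈ T) :
    Topology.IsInducing (cone (B := B) i hi) := by
  refine ⟨le_antisymm (continuous_iff_le_induced.1 (PSpec.continuous_comap _)) ?_⟩
  refine le_generateFrom ?_
  rintro _ ⟨x, rfl⟩
  obtain ⟨d, f, g, hf, hg, hgT, hx⟩ := exists_mul_dehom_eq hi x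
  refine ⟨_, (PSpec.basicOpen f).isOpen, Set.ext fun p => ?_⟩
  change dehom i hi f ∉ p.ideal.carrier ↔ x ∉ p.ideal.carrier
  rw [← hx]
  refine not_congr ⟨fun h => ?_, fun h => mul_comm x _ ▸ p.ideal.mul_mem _ h⟩
  exact (p.isPrime.2 _ _ h).resolve_right (varSubmonoid_le_cone_compl hi p hgT)

end Cone

/-! ### The charts of projective space -/

section Charts

variable {n : ℕ} {B : PartialSubring (NPoly n)}

variable (B) in
/-- The points of the charts of projective space in the glued space. -/
noncomputable def chartPt (i : Fin (n + 1)) (p : PSpec (DegZero B {i})) :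
    (projGlueData B).Carrier :=
  (projGlueData B).proj ⟨i, p⟩

theorem continuous_chartPt (i : Fin (n + 1)) : Continuous (chartPt B i) :=
  (projGlueData B).continuous_proj.comp
    (continuous_sigmaMk (σ := fun i => PSpec ((projGlueData B).A i)) (i := i))

theorem isOpen_of_chartPt {U : Set (projGlueData B).Carrier}
    (h : ∀ i, IsOpen (chartPt B i ⁻¹' U)) : IsOpen U := by
  refine isQuotientMap_quot_mk.isOpen_preimage.1 ?_
  rw [isOpen_sigma_iff]
  exact h

variable [B.IsHomogeneous]

variable (B) in
/-- The homogeneous prime ideal of `B` corresponding to a point of a chart. -/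
noncomputable def chartCone (i : Fin (n + 1)) (p : PSpec (DegZero B {i})) : PSpec B :=
  cone i (Finset.mem_singleton_self i) p

theorem chartCone_left (i j : Fin (n + 1)) (r : PSpec (DegZero B {i, j})) :
    chartCone B i (PSpec.comap (degZeroMap B (by simp)) r) =
      cone i (Finset.mem_insert_self i {j}) r :=
  cone_comap_degZeroMap _ (Finset.mem_singleton_self i) r

theorem chartCone_right (i j : Fin (n + 1)) (r : PSpec (DegZero B {i, j})) :
    chartCone B j (PSpec.comap (degZeroMap B (by simp)) r) =
      cone i (Finset.mem_insert_self i {j}) r :=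
  (cone_comap_degZeroMap _ (Finset.mem_singleton_self j) r).trans
    (cone_eq_cone (Finset.mem_insert_of_mem (Finset.mem_singleton_self j)) _ r)

theorem varSubmonoid_pair_le {i j : Fin (n + 1)} {S : Submonoid B} (hi : varElem B i ∈ S)
    (hj : varElem B j ∈ S) : varSubmonoid B {i, j} ≤ S := by
  refine Submonoid.closure_le.2 ?_
  rintro b ⟨k, hk, hb⟩
  obtain rfl : b = varElem B k := Subtype.ext hb
  rcases Finset.mem_insert.1 hk with rfl | hk
  · exact hi
  · rw [Finset.mem_singleton.1 hk]
    exact hj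

theorem varElem_mem_chartCone_compl (i : Fin (n + 1)) (p : PSpec (DegZero B {i})) :
    varElem B i ∈ (chartCone B i p).compl :=
  varSubmonoid_le_cone_compl _ _ (varElem_mem (Finset.mem_singleton_self i))

theorem exists_overlap {i j : Fin (n + 1)} {p : PSpec (DegZero B {i})} {q : PSpec (DegZero B {j})}
    (h : chartCone B i p = chartCone B j q) :
    ∃ r : PSpec (DegZero B {i, j}), p = PSpec.comap (degZeroMap B (by simp)) r ∧
      q = PSpec.comap (degZeroMap B (by simp)) r := by
  obtain ⟨r, hr⟩ := exists_cone_eq (T' := {i, j}) (Finset.mem_singleton_self i)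
    (Finset.mem_insert_self i {j}) p (varSubmonoid_pair_le (varElem_mem_chartCone_compl i p)
      (by
        have := varElem_mem_chartCone_compl j q
        rw [← h] at this
        exact this))
  exact ⟨r, cone_injective (Finset.mem_singleton_self i)
      (hr.symm.trans (chartCone_left i j r).symm),
    cone_injective (Finset.mem_singleton_self j)
      (h.symm.trans (hr.symm.trans (chartCone_right i j r).symm))⟩

theorem chartCone_eq_of_rel {e e' : (projGlueData B).Charts} (h : (projGlueData B).Rel e e') :
    chartCone B e.1 e.2 = chartCone B e'.1 e'.2 := by
  obtain ⟨i, j, r⟩ := h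
  exact (chartCone_left i j r).trans (chartCone_right i j r).symm

theorem rel_of_chartCone_eq {i j : Fin (n + 1)} {p : PSpec (DegZero B {i})}
    {q : PSpec (DegZero B {j})} (h : chartCone B i p = chartCone B j q) :
    (projGlueData B).Rel ⟨i, p⟩ ⟨j, q⟩ := by
  obtain ⟨r, rfl, rfl⟩ := exists_overlap h
  exact AffineGlueData.Rel.glue (D := projGlueData B) i j r

/-- The gluing relation identifies exactly the points with the same homogeneous prime ideal. -/
theorem chartPt_eq_chartPt_iff {i j : Fin (n + 1)} {p : PSpec (DegZero B {i})}
    {q : PSpec (DegZero B {j})} :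
    chartPt B i p = chartPt B j q ↔ chartCone B i p = chartCone B j q :=
  ⟨fun h => congrArg (Quot.lift (fun e : (projGlueData B).Charts => chartCone B e.1 e.2)
    fun _ _ => chartCone_eq_of_rel) h, fun h => Quot.sound (rel_of_chartCone_eq h)⟩

/-- The `i`-th chart contains every point whose homogeneous prime ideal does not contain `yᵢ`. -/
theorem exists_chartCone_eq {i j : Fin (n + 1)} (q : PSpec (DegZero B {j}))
    (h : varElem B i ∈ (chartCone B j q).compl) :
    ∃ p : PSpec (DegZero B {i}), chartCone B i p = chartCone B j q := by
  refine exists_cone_eq (Finset.mem_singleton_self j) (Finset.mem_singleton_self i) q ?_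
  rw [← Finset.pair_eq_singleton i]
  exact varSubmonoid_pair_le h h

theorem isOpenEmbedding_chartPt (i : Fin (n + 1)) : Topology.IsOpenEmbedding (chartPt B i) := by
  refine .of_continuous_injective_isOpenMap (continuous_chartPt i) ?_ ?_
  · exact fun p q h => cone_injective (Finset.mem_singleton_self i) (chartPt_eq_chartPt_iff.1 h)
  · intro U hU
    obtain ⟨W, hW, rfl⟩ := (isInducing_cone (B := B) (Finset.mem_singleton_self i)).isOpen_iff.1 hU
    refine isOpen_of_chartPt fun j => ?_
    have hc : Continuous (chartCone B j) := PSpec.continuous_comap _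
    have := (hW.inter (PSpec.basicOpen (varElem B i)).isOpen).preimage hc
    convert this using 1
    ext q
    constructor
    · rintro ⟨p, hp, h⟩
      have hv := varElem_mem_chartCone_compl i p
      have hp' : chartCone B i p ∈ W := hp
      rw [chartPt_eq_chartPt_iff.1 h] at hv hp'
      exact ⟨hp', hv⟩
    · rintro ⟨hq, hv⟩
      obtain ⟨p, hp⟩ := exists_chartCone_eq (i := i) q hv
      have hp' : chartCone B i p ∈ W := hp ▸ hq
      exact ⟨p, hp', chartPt_eq_chartPt_iff.2 hp⟩

theorem isLocFrac_iff_isFrac {T : Finset (Fin (n + 1))} {i : Fin (n + 1)} (hi : i ∈ T)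
    (U : Opens (PSpec (DegZero B T))) (s : ∀ p : PSpec (DegZero B T), p ∈ U → p.LocalAt) :
    IsLocFrac U s ↔ ∀ p ∈ U, ∃ (V : Opens (PSpec (DegZero B T))) (k : B × B), p ∈ V ∧ V ≤ U ∧
      ∀ q ∈ V, ∀ hU : q ∈ U, IsFrac q k.1 k.2 (s q hU) := by
  constructor
  · intro hs p hp
    obtain ⟨V, a, t, hV, H⟩ := hs p hp
    obtain ⟨d, f, g, hf, hg, hgT, h⟩ := exists_mul_dehom_eq hi a
    obtain ⟨d', f', g', hf', hg', hgT', h'⟩ := exists_mul_dehom_eq hi t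
    refine ⟨V ⊓ U, ⟨f * g', g * f'⟩, ⟨hV, hp⟩, inf_le_right, fun q hq hU => ?_⟩
    obtain ⟨ht, e⟩ := H q hq.1
    rw [e hU]
    exact isFrac_mk hi hf hg hgT h hf' hg' hgT' h'
  · intro hs p hp
    obtain ⟨V, ⟨f, g⟩, hV, hVU, H⟩ := hs p hp
    refine ⟨V, dehom i hi f, dehom i hi g, hV, fun q hq => ?_⟩
    exact ⟨(H q hq (hVU hq)).denom_mem hi, fun hU => ((H q hq hU).choose_spec.2.2 i hi).2⟩

theorem localMap_eq_localMap_iff (i j : Fin (n + 1)) (r : PSpec (DegZero B {i, j}))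
    (x : (PSpec.comap (degZeroMap B (T := {i}) (T' := {i, j}) (by simp)) r).LocalAt)
    (y : (PSpec.comap (degZeroMap B (T := {j}) (T' := {i, j}) (by simp)) r).LocalAt) :
    PSpec.localMap (degZeroMap B _) r x = PSpec.localMap (degZeroMap B _) r y ↔
      ∃ k : B × B, IsFrac _ k.1 k.2 x ∧ IsFrac _ k.1 k.2 y := by
  have hl : {i} ⊆ ({i, j} : Finset (Fin (n + 1))) := by simp
  have hr : {j} ⊆ ({i, j} : Finset (Fin (n + 1))) := by simp
  have hi := Finset.mem_singleton_self i
  have hj := Finset.mem_singleton_self j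
  constructor
  · intro h
    obtain ⟨f, g, hx⟩ := exists_isFrac hi x
    obtain ⟨f', g', hy⟩ := exists_isFrac hj y
    have hx' := hx.localMap hl hi
    obtain ⟨y', hy'⟩ := hx.exists_of_cone_eq (hi := hi) (hi' := hj)
      ((chartCone_left i j r).trans (chartCone_right i j r).symm)
    rw [h] at hx'
    obtain rfl := IsFrac.unique (chartCone_right i j r).symm hx' hy' (hy.localMap hr hj) hy
    exact ⟨⟨f, g⟩, hx, hy'⟩
  · rintro ⟨⟨f, g⟩, hx, hy⟩
    exact ((hx.localMap hl hi).eq_iff (hl hi) (hy.localMap hr hj)).2 ⟨1, one_mem _, rfl⟩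

variable (B) in
/-- Fractions of homogeneous elements of `B` of the same degree describe the elements of the local
partial rings of the charts of projective space. -/
noncomputable def projFractionSystem : FractionSystem (projGlueData B) where
  K := B × B
  IsFrac e k x := IsFrac (T := {e.1}) e.2 k.1 k.2 x
  rel_of_proj_eq {e e'} h := rel_of_chartCone_eq (chartPt_eq_chartPt_iff.1 h)
  isOpenEmbedding i := isOpenEmbedding_chartPt i
  exists_isFrac e x := by
    obtain ⟨f, g, h⟩ := exists_isFrac (T := {e.1}) (Finset.mem_singleton_self e.1) x
    exact ⟨⟨f, g⟩, h⟩
  isLocFrac_iff i U s := isLocFrac_iff_isFrac (T := {i}) (Finset.mem_singleton_self i) U s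
  exists_of_proj_eq {e e'} h {k x} hx := IsFrac.exists_of_cone_eq (chartPt_eq_chartPt_iff.1 h) hx
  unique {e e'} h {k l x y y'} h₁ h₂ h₃ h₄ := IsFrac.unique (chartPt_eq_chartPt_iff.1 h) h₁ h₂ h₃ h₄
  isSum {e e'} h {k l m x y z x' y' z'} h₁ h₂ h₃ h₄ h₅ h₆ h₇ :=
    IsFrac.isSum (chartPt_eq_chartPt_iff.1 h) h₁ h₂ h₃ h₄ h₅ h₆ h₇
  localMap_eq_iff i j r x y := localMap_eq_localMap_iff i j r x y

end Charts

/-! ### Points with values in a partial field -/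

section PartialField

variable {F : Type v} [PRing F]

namespace IsPartialField

theorem isUnit_iff (hF : IsPartialField F) {a : F} : IsUnit a ↔ a ≠ 0 := by
  refine ⟨?_, hF.2 a⟩
  rintro h rfl
  obtain ⟨b, hb⟩ := h.exists_left_inv
  rw [mul_zero] at hb
  exact hF.1 hb

/-- The point of `Spec F`, given by the zero ideal. -/
def point (hF : IsPartialField F) : PSpec F where
  ideal :=
    { carrier := {0}
      zero_mem := rfl
      sum_mem := by
        rintro a b c rfl rfl h
        exact isSum_unique h (zero_isSum 0)
      mul_mem := by
        rintro a b rfl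
        exact mul_zero a }
  isPrime := by
    refine ⟨fun h => ?_, fun a b h => ?_⟩
    · have : (1 : F) ∈ ({0} : Set F) := (Set.ext_iff.1 h 1).2 (Set.mem_univ _)
      exact hF.1 this.symm
    · by_contra! hab
      exact hF.isUnit_iff.1 ((hF.2 a hab.1).mul (hF.2 b hab.2)) h

theorem eq_point (hF : IsPartialField F) (q : PSpec F) : q = hF.point := by
  refine PSpec.ext (PIdeal.ext (Set.ext fun a => ?_))
  constructor
  · intro ha
    by_contra h0
    exact q.mem_compl_of_isUnit (hF.2 a h0) ha
  · rintro rfl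
    exact q.ideal.zero_mem

theorem mk_one_injective (hF : IsPartialField F) {a b : F}
    (h : (Localization.mk a 1 : hF.point.LocalAt) = Localization.mk b 1) : a = b := by
  obtain ⟨w, hw, h⟩ := mk_eq_mk_same_iff.1 h
  exact (hF.2 w hw).mul_left_cancel h

theorem exists_eq_mk_one (hF : IsPartialField F) (x : hF.point.LocalAt) :
    ∃ a : F, x = Localization.mk a 1 := by
  induction x using Localization.induction_on with
  | H x =>
    obtain ⟨a, s, hs⟩ := x
    obtain ⟨b, hb⟩ := (hF.2 s hs).exists_right_inv
    refine ⟨b * a, ?_⟩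
    rw [← mk_mul_left_cancel hF.point.compl ⟨s, hs⟩ 1 (b * a), ← mul_assoc, hb, one_mul, mul_one]

/-- The localization of a partial field `F` at its only prime ideal is `F`. -/
theorem exists_value (hF : IsPartialField F) :
    ∃ v : PRingHom hF.point.LocalAt F, ∀ a, v (Localization.mk a 1) = a := by
  choose v hv using hF.exists_eq_mk_one
  have h : ∀ a, v (Localization.mk a 1) = a := fun a => (hF.mk_one_injective (hv _)).symm
  refine ⟨{ toFun := v, map_zero' := ?_, map_one' := ?_, map_mul' := ?_, map_isSum' := ?_ }, h⟩
  · rw [← Localization.mk_zero 1, h]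
  · rw [← Localization.mk_one, h]
  · intro x y
    rw [hv x, hv y, Localization.mk_mul, mul_one, h, h, h]
  · intro x y z hs
    rw [hv x, hv y, hv z] at hs
    obtain ⟨w, hw, hs⟩ := isSum_mk_same_iff.1 hs
    obtain ⟨b, hb⟩ := (hF.2 w hw).exists_left_inv
    simpa only [← mul_assoc, hb, one_mul] using mul_isSum b hs

end IsPartialField

/-- A morphism from the spectrum of a partial field is determined by the image of the point and the
values at the point of the pulled back sections. -/
theorem LPRingedSpace.Hom.ext_point (hF : IsPartialField F) {D : FunSheafData.{u}}
    {f g : LPRingedSpace.Hom (Spec F) D.toLPRingedSpace}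
    (hb : f.base hF.point = g.base hF.point)
    (h : ∀ (V : Opens D.X) (s : D.Sec V) (hV : f.base hF.point ∈ V) (hV' : g.base hF.point ∈ V),
      (f.app V s).1 hF.point hV = (g.app V s).1 hF.point hV') : f = g := by
  obtain ⟨fb, fa, fr, fl⟩ := f
  obtain ⟨gb, ga, gr, gl⟩ := g
  obtain rfl : fb = gb := by
    refine ContinuousMap.ext fun q => ?_
    obtain rfl := hF.eq_point q
    exact hb
  obtain rfl : fa = ga := by
    refine funext fun V => DFunLike.ext _ _ fun s => FunSheafData.Sec.ext fun q hq => ?_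
    obtain rfl := hF.eq_point q
    exact h V s hq hq
  rfl

theorem LPRingedSpace.Hom.app_congr {A : Type v} [PRing A] {D : FunSheafData.{u}}
    {f g : LPRingedSpace.Hom (Spec A) D.toLPRingedSpace} (h : f = g) (V : Opens D.X) (s : D.Sec V)
    (q : PSpec A) (hV : f.base q ∈ V) (hV' : g.base q ∈ V) :
    (f.app V s).1 q hV = (g.app V s).1 q hV' := by
  subst h
  rfl

theorem isSum_congr {A : Type u} [PRing A] {a b c a' b' c' : A} (ha : a = a') (hb : b = b')
    (hc : c = c') (h : IsSum a' b' c') : IsSum a b c := by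
  subst ha hb hc
  exact h

theorem mk_one_mul {A : Type u} [PRing A] (S : Submonoid A) (a b : A) :
    Localization.mk (a * b) (1 : S) = Localization.mk a 1 * Localization.mk b 1 := by
  rw [Localization.mk_mul, mul_one]

theorem mk_mul_mk_one {A : Type u} [PRing A] (S : Submonoid A) (a : A) (t : S) :
    Localization.mk a t * Localization.mk (t : A) 1 = Localization.mk a 1 := by
  rw [Localization.mk_mul, mul_comm a, mul_one, ← mk_mul_left_cancel S t 1 a, mul_one]

/-- A relation `s t = r` between sections over an open set yields one between the values of their
images under a morphism. -/
theorem LPRingedSpace.Hom.app_mul_app {A : Type v} [PRing A] {D : FunSheafData.{u}}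
    (f : LPRingedSpace.Hom (Spec A) D.toLPRingedSpace) {U V W : Opens D.X} (hU : W ≤ U) (hV : W ≤ V)
    (s : D.Sec U) (t r : D.Sec V) (h : D.secRes U W hU s * D.secRes V W hV t = D.secRes V W hV r)
    (q : PSpec A) (hq : f.base q ∈ W) {x y z : q.LocalAt} (hx : (f.app U s).1 q (hU hq) = x)
    (hy : (f.app V t).1 q (hV hq) = y) (hz : (f.app V r).1 q (hV hq) = z) : x * y = z := by
  subst hx hy hz
  let ev : PRingHom ((Spec A).sec (W.comap f.base)) q.LocalAt :=
    { toFun := fun s => s.1 q hq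
      map_zero' := rfl
      map_one' := rfl
      map_mul' := fun _ _ => rfl
      map_isSum' := fun h => h _ _ }
  have h₁ := congrArg (ev.comp (f.app W)) h
  replace h₁ := (map_mul (ev.comp (f.app W)) _ _).symm.trans h₁
  have e₁ := congrArg ev (f.app_res U W hU s)
  have e₂ := congrArg ev (f.app_res V W hV t)
  have e₃ := congrArg ev (f.app_res V W hV r)
  exact (congrArg₂ (fun x y : q.LocalAt => x * y) e₁ e₂).symm.trans (h₁.trans e₃)

namespace FractionSystem

variable {D : AffineGlueData.{u}}

instance (V : Opens D.Carrier) : PRing (D.funSheafData.Sec V) :=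
  D.glued.ring V

/-- The image of a chart, as an open subset of the glued space. -/
def chartOpens (S : FractionSystem D) (i : D.ι) : Opens D.Carrier :=
  ⟨Set.range fun p : PSpec (D.A i) => D.proj ⟨i, p⟩, (S.isOpenEmbedding i).isOpen_range⟩

theorem exists_chartSection (S : FractionSystem D) (i : D.ι) (a : D.A i) :
    ∃ s : D.funSheafData.Sec (S.chartOpens i), ∀ (p : PSpec (D.A i)) hp,
      s.1 ⟨i, p⟩ hp = (Localization.mk a 1 : p.LocalAt) :=
  S.exists_section i (fun _ he => he) _ (IsLocFrac.const _ a)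

/-- The section over the `i`-th chart given by an element of `A i`. -/
noncomputable def chartSection (S : FractionSystem D) (i : D.ι) (a : D.A i) :
    D.funSheafData.Sec (S.chartOpens i) := (S.exists_chartSection i a).choose

theorem chartSection_val (S : FractionSystem D) (i : D.ι) (a : D.A i) (p : PSpec (D.A i))
    (hp : D.proj ⟨i, p⟩ ∈ S.chartOpens i) :
    (S.chartSection i a).1 ⟨i, p⟩ hp = (Localization.mk a 1 : p.LocalAt) :=
  (S.exists_chartSection i a).choose_spec p hp

theorem section_ext (S : FractionSystem D) (i : D.ι) {V : Opens D.Carrier}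
    (hV : V ≤ S.chartOpens i) {s t : D.funSheafData.Sec V}
    (h : ∀ (p : PSpec (D.A i)) hp, s.1 ⟨i, p⟩ hp = t.1 ⟨i, p⟩ hp) : s = t := by
  refine FunSheafData.Sec.ext fun e he => ?_
  obtain ⟨p, hp⟩ : ∃ p : PSpec (D.A i), D.proj ⟨i, p⟩ = D.proj e := hV he
  have hpV : D.proj ⟨i, p⟩ ∈ V := hp ▸ he
  obtain ⟨k, h₁, h₂⟩ := S.agree_of_isSection s.2 hp hpV he
  exact Agree.unique hp ⟨k, h p hpV ▸ h₁, h₂⟩ (S.agree_of_isSection t.2 hp hpV he)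

theorem section_isSum (S : FractionSystem D) (i : D.ι) {V : Opens D.Carrier}
    (hV : V ≤ S.chartOpens i) {a b c : D.funSheafData.Sec V}
    (h : ∀ (p : PSpec (D.A i)) hp,
      IsSum (A := p.LocalAt) (a.1 ⟨i, p⟩ hp) (b.1 ⟨i, p⟩ hp) (c.1 ⟨i, p⟩ hp)) : IsSum a b c := by
  refine fun (e : D.Charts) he => ?_
  obtain ⟨p, hp⟩ : ∃ p : PSpec (D.A i), D.proj ⟨i, p⟩ = D.proj e := hV he
  have hpV : D.proj ⟨i, p⟩ ∈ V := hp ▸ he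
  obtain ⟨k, ha, ha'⟩ := S.agree_of_isSection a.2 hp hpV he
  obtain ⟨l, hb, hb'⟩ := S.agree_of_isSection b.2 hp hpV he
  obtain ⟨m, hc, hc'⟩ := S.agree_of_isSection c.2 hp hpV he
  exact S.isSum hp ha ha' hb hb' hc hc' (h p hpV)

/-- The elements of `A i` are sections over the `i`-th chart. -/
noncomputable def chartHom (S : FractionSystem D) (i : D.ι) :
    PRingHom (D.A i) (D.funSheafData.Sec (S.chartOpens i)) where
  toFun := S.chartSection i
  map_zero' := S.section_ext i le_rfl fun p hp =>
    (S.chartSection_val i 0 p hp).trans (Localization.mk_zero _)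
  map_one' := S.section_ext i le_rfl fun p hp =>
    (S.chartSection_val i 1 p hp).trans (Localization.mk_one (M := D.A i))
  map_mul' a b := S.section_ext i le_rfl fun p hp =>
    ((S.chartSection_val i (a * b) p hp).trans (mk_one_mul p.compl a b)).trans
      (congrArg₂ (fun x y : p.LocalAt => x * y) (S.chartSection_val i a p hp)
        (S.chartSection_val i b p hp)).symm
  map_isSum' {a b c} h := S.section_isSum i le_rfl fun p hp =>
    isSum_congr (S.chartSection_val i a p hp) (S.chartSection_val i b p hp)
      (S.chartSection_val i c p hp) ⟨a, b, c, 1, h, rfl, rfl, rfl⟩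

theorem specMap_injective (S : FractionSystem D) (hF : IsPartialField F) (i : D.ι)
    {φ φ' : PRingHom (D.A i) F} (h : D.specMap i φ = D.specMap i φ') : φ = φ' := by
  refine DFunLike.ext _ _ fun a => hF.mk_one_injective ?_
  have hV : ∀ p : PSpec (D.A i), D.proj ⟨i, p⟩ ∈ S.chartOpens i := fun p => ⟨p, rfl⟩
  have key : ∀ φ : PRingHom (D.A i) F,
      ((D.specMap i φ).app (S.chartOpens i) (S.chartSection i a)).1 hF.point (hV _) =
        (Localization.mk (φ a) 1 : hF.point.LocalAt) := by
    intro φ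
    refine (congrArg (PSpec.localMap φ hF.point) (S.chartSection_val i a _ (hV _))).trans ?_
    exact (locMap_mk φ _ _ _ a 1).trans (congrArg _ (Subtype.ext (map_one φ)))
  exact (key φ).symm.trans ((LPRingedSpace.Hom.app_congr h _ _ _ _ _).trans (key φ'))

/-- A point with values in a partial field that meets the `i`-th chart comes from a
homomorphism `A i → F`, namely `f` on the sections over the chart, evaluated at the point. -/
theorem exists_eq_specMap (S : FractionSystem D) (hF : IsPartialField F)
    (f : LPRingedSpace.Hom (Spec F) D.glued) (i : D.ι) (p : PSpec (D.A i))
    (hp : f.base hF.point = D.proj ⟨i, p⟩) :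
    ∃ φ : PRingHom (D.A i) F, f = D.specMap i φ ∧ PSpec.comap φ hF.point = p := by
  obtain ⟨v, hv⟩ := hF.exists_value
  have hv' : ∀ x, x = Localization.mk (v x) 1 := by
    intro x
    obtain ⟨a, rfl⟩ := hF.exists_eq_mk_one x
    rw [hv]
  have hpV : f.base hF.point ∈ S.chartOpens i := ⟨p, hp.symm⟩
  let ev : PRingHom ((Spec F).sec ((S.chartOpens i).comap f.base)) hF.point.LocalAt :=
    { toFun := fun s => s.1 hF.point hpV
      map_zero' := rfl
      map_one' := rfl
      map_mul' := fun _ _ => rfl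
      map_isSum' := fun h => h _ _ }
  let φ : PRingHom (D.A i) F :=
    v.comp (ev.comp (PRingHom.comp (B := D.funSheafData.Sec (S.chartOpens i))
      (f.app (S.chartOpens i)) (S.chartHom i)))
  have hφ : ∀ a, (f.app (S.chartOpens i) (S.chartSection i a)).1 hF.point hpV =
      (Localization.mk (φ a) 1 : hF.point.LocalAt) := fun a => hv' _
  -- The morphism `f` is local, so `φ a` is invertible exactly if `a` is nonzero at `p`.
  have hcomap : PSpec.comap φ hF.point = p := by
    refine PSpec.ext (PIdeal.ext (Set.ext fun a => not_iff_not.1 ?_))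
    have h := LPRingedSpace.Hom.isUnit_app_iff (D := specData F) (D' := D.funSheafData) f hF.point
      ⟨i, p⟩ hp (S.chartOpens i) ⟨p, rfl⟩ (S.chartSection i a)
    replace h : IsUnit (Localization.mk (φ a) 1 : hF.point.LocalAt) ↔
      IsUnit (Localization.mk a 1 : p.LocalAt) := by
      rw [← hφ, ← S.chartSection_val]
      exact h
    rwa [PSpec.isUnit_mk_iff, PSpec.isUnit_mk_iff] at h
  refine ⟨φ, ?_, hcomap⟩
  refine LPRingedSpace.Hom.ext_point (D := D.funSheafData) hF
    (hp.trans (congrArg (fun p => D.proj ⟨i, p⟩) hcomap.symm)) fun V s hV hV' => ?_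
  obtain ⟨W, a, t, hW, H⟩ := s.2.1 i (PSpec.comap φ hF.point) hV'
  let U : Opens D.Carrier := V ⊓ ⟨_, (S.isOpenEmbedding i).isOpenMap W W.isOpen⟩
  have hUV : U ≤ V := inf_le_left
  have hUi : U ≤ S.chartOpens i := fun x hx => by
    obtain ⟨q, -, rfl⟩ := hx.2
    exact ⟨q, rfl⟩
  have hWq : ∀ q : PSpec (D.A i), D.proj ⟨i, q⟩ ∈ U → q ∈ W := by
    rintro q ⟨-, q', hq', h⟩
    rwa [← (S.isOpenEmbedding i).injective h]
  -- On a neighbourhood of the point, the section `s` is the quotient of the sections `a` and `t`.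
  have hsec : D.funSheafData.secRes V U hUV s *
      D.funSheafData.secRes _ U hUi (S.chartSection i t) =
        D.funSheafData.secRes _ U hUi (S.chartSection i a) := by
    refine S.section_ext i hUi fun q hq => ?_
    obtain ⟨ht, e⟩ := H q (hWq q hq)
    refine Eq.trans (congrArg₂ (fun x y : q.LocalAt => x * y) (e (hUV hq))
      (S.chartSection_val i t q (hUi hq))) (Eq.trans ?_ (S.chartSection_val i a q (hUi hq)).symm)
    exact mk_mul_mk_one q.compl a ⟨t, ht⟩
  have hU : f.base hF.point ∈ U := ⟨hV, by
    rw [hp, ← hcomap]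
    exact ⟨_, hW, rfl⟩⟩
  obtain ⟨ht, e⟩ := H _ hW
  have hu : IsUnit (Localization.mk (φ t) 1 : hF.point.LocalAt) :=
    (PSpec.isUnit_mk_iff _ _ _).2 ht
  have h₁ := LPRingedSpace.Hom.app_mul_app (D := D.funSheafData) f hUV hUi s
    (S.chartSection i t) (S.chartSection i a) hsec hF.point hU rfl (hφ t) (hφ a)
  have h₂ : ((D.specMap i φ).app V s).1 hF.point hV' =
      (Localization.mk (φ a) ⟨φ t, ht⟩ : hF.point.LocalAt) :=
    congrArg (PSpec.localMap φ hF.point) (e hV')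
  exact (hu.mul_right_cancel (h₁.trans
    (mk_mul_mk_one hF.point.compl (φ a) ⟨φ t, ht⟩).symm)).trans h₂.symm

end FractionSystem

end PartialField

/-! ### Homomorphisms from the coordinate ring -/

section SumEval

variable {n : ℕ} {F : Type v} [PRing F]

/-- The value at `x` of a polynomial, computed as a sum of monomials in `F ∪ {∞}`. -/
noncomputable def sumEval (x : Fin (n + 1) → F) : NPoly n →ₗ[ℕ] WithUndef F :=
  (MvPolynomial.basisMonomials _ ℕ).constr ℕ fun m => of (∏ i, x i ^ m i)

theorem sumEval_monomial (x : Fin (n + 1) → F) (m : Fin (n + 1) →₀ ℕ) :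
    sumEval x (MvPolynomial.monomial m 1) = of (∏ i, x i ^ m i) := by
  have := (MvPolynomial.basisMonomials (Fin (n + 1)) ℕ).constr_basis ℕ
    (fun m => of (∏ i, x i ^ m i)) m
  rwa [MvPolynomial.coe_basisMonomials] at this

theorem sumEval_X (x : Fin (n + 1) → F) (i : Fin (n + 1)) :
    sumEval x (MvPolynomial.X i) = of (x i) := by
  rw [MvPolynomial.X, sumEval_monomial]
  congr 1
  rw [Finset.prod_eq_single i]
  · simp
  · intro j _ hj
    simp [Finsupp.single_eq_of_ne hj]
  · simp

theorem MvPolynomial.induction_nat {σ : Type*} {P : MvPolynomial σ ℕ → Prop} (h0 : P 0)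
    (h1 : ∀ m, P (monomial m 1)) (hadd : ∀ p q, P p → P q → P (p + q)) (p : MvPolynomial σ ℕ) :
    P p := by
  refine MvPolynomial.induction_on' p (fun m a => ?_) hadd
  induction a with
  | zero => simpa using h0
  | succ a ih =>
    rw [map_add]
    exact hadd _ _ ih (h1 m)

theorem sumEval_mul (x : Fin (n + 1) → F) {f g : NPoly n} {c d : F} (hf : sumEval x f = of c)
    (hg : sumEval x g = of d) : sumEval x (f * g) = of (c * d) := by
  induction f using MvPolynomial.induction_nat generalizing c with
  | h0 =>
    rw [map_zero, ← of_zero] at hf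
    rw [zero_mul, map_zero, ← of_injective hf, zero_mul, of_zero]
  | h1 m =>
    rw [sumEval_monomial] at hf
    rw [← of_injective hf]
    clear hf
    induction g using MvPolynomial.induction_nat generalizing d with
    | h0 =>
      rw [map_zero, ← of_zero] at hg
      rw [mul_zero, map_zero, ← of_injective hg, mul_zero, of_zero]
    | h1 k =>
      rw [sumEval_monomial] at hg
      rw [MvPolynomial.monomial_mul, one_mul, sumEval_monomial, ← of_injective hg,
        ← Finset.prod_mul_distrib]
      simp only [Finsupp.add_apply, pow_add]
    | hadd p q hp hq =>
      rw [map_add, add_eq_of] at hg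
      obtain ⟨a, b, ha, hb, h⟩ := hg
      rw [mul_add, map_add, hp ha, hq hb]
      exact of_add_of.2 (mul_isSum _ h)
  | hadd p q hp hq =>
    rw [map_add, add_eq_of] at hf
    obtain ⟨a, b, ha, hb, h⟩ := hf
    rw [add_mul, map_add, hp ha, hq hb]
    exact of_add_of.2 (isSum_mul _ h)

/-- If the sum of the entries of `x` is defined, so are the values at `x` of all elements of the
coordinate ring, because the polynomials with defined value form a partial subring. -/
theorem sumEval_isDef (x : Fin (n + 1) → F) (hx : (∑ i, of (x i)).IsDef) (f : coordRing n) :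
    (sumEval x f.1).IsDef := by
  refine (PartialSubring.generated_induction (fun f => (sumEval x f).IsDef) ⟨0, map_zero _⟩ ⟨1, ?_⟩
    ?_ ?_ ?_).1 f.1 f.2
  · rw [← MvPolynomial.C_1, ← MvPolynomial.monomial_zero', sumEval_monomial]
    simp
  · rintro f g ⟨c, hc⟩ ⟨d, hd⟩
    exact ⟨c * d, sumEval_mul x hc hd⟩
  · intro f g h
    rw [map_add] at h
    exact h.left
  · rintro _ rfl
    simpa only [map_sum, sumEval_X] using hx

/-- A tuple with defined sum defines a homomorphism from the coordinate ring. -/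
theorem exists_coordRing_hom (x : Fin (n + 1) → F) (hx : (∑ i, of (x i)).IsDef) :
    ∃ ψ : PRingHom (coordRing n) F, ∀ i, ψ (varElem (coordRing n) i) = x i := by
  choose ψ hψ using sumEval_isDef x hx
  refine ⟨{ toFun := ψ, map_zero' := ?_, map_one' := ?_, map_mul' := ?_, map_isSum' := ?_ }, ?_⟩
  · exact of_injective ((hψ 0).symm.trans (map_zero (sumEval x)))
  · refine of_injective ((hψ 1).symm.trans ?_)
    change sumEval x 1 = _
    rw [← MvPolynomial.C_1, ← MvPolynomial.monomial_zero', sumEval_monomial]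
    simp
  · exact fun f g => of_injective ((hψ (f * g)).symm.trans (sumEval_mul x (hψ f) (hψ g)))
  · intro f g h hs
    have := congrArg (sumEval x) hs.2
    rw [map_add, hψ f, hψ g, hψ h] at this
    exact of_add_of.1 this
  · exact fun i => of_injective ((hψ (varElem _ i)).symm.trans (sumEval_X x i))

/-- A subsum of `y₀ + ⋯ + yₙ` is the sum of the variables from some set. -/
theorem exists_eq_sum_X {t : NPoly n}
    (ht : PartialSubring.IsSubsum t (∑ i, MvPolynomial.X i : NPoly n)) :
    ∃ s : Finset (Fin (n + 1)), t = ∑ i ∈ s, MvPolynomial.X i := by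
  obtain ⟨u, h⟩ := ht
  refine ⟨Finset.univ.filter fun i => MvPolynomial.coeff (Finsupp.single i 1) t ≠ 0, ?_⟩
  have hle : ∀ m, MvPolynomial.coeff m t ≤
      MvPolynomial.coeff m (∑ i, MvPolynomial.X i : NPoly n) := by
    intro m
    rw [← h, MvPolynomial.coeff_add]
    exact Nat.le_add_right _ _
  have hX : ∀ (s : Finset (Fin (n + 1))) (j : Fin (n + 1)), MvPolynomial.coeff (Finsupp.single j 1)
      (∑ i ∈ s, MvPolynomial.X i : NPoly n) = if j ∈ s then 1 else 0 := by
    intro s j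
    rw [MvPolynomial.coeff_sum]
    simp [MvPolynomial.coeff_X, Finsupp.single_left_inj]
  ext m
  by_cases hm : ∃ j, m = Finsupp.single j 1
  · obtain ⟨j, rfl⟩ := hm
    have := hle (Finsupp.single j 1)
    rw [hX] at this
    rw [hX]
    simp only [Finset.mem_univ, if_true] at this
    simp only [Finset.mem_filter, Finset.mem_univ, true_and]
    split_ifs with h <;> omega
  · have h0 : ∀ s : Finset (Fin (n + 1)),
        MvPolynomial.coeff m (∑ i ∈ s, MvPolynomial.X i : NPoly n) = 0 := by
      intro s
      rw [MvPolynomial.coeff_sum]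
      refine Finset.sum_eq_zero fun i _ => ?_
      rw [MvPolynomial.coeff_X, if_neg fun h => hm ⟨i, h.symm⟩]
    have := hle m
    rw [h0] at this
    rw [h0]
    omega

/-- The sum of the variables from a set, as an element of the coordinate ring. -/
noncomputable def sumVar (s : Finset (Fin (n + 1))) : coordRing n :=
  ⟨∑ i ∈ s, MvPolynomial.X i,
    (PartialSubring.generated_admits {∑ i, MvPolynomial.X i} _ rfl).1 _ (sum_X_isSubsum s)⟩

theorem of_hom_sumVar (ψ : PRingHom (coordRing n) F) (s : Finset (Fin (n + 1))) :
    of (ψ (sumVar s)) = ∑ i ∈ s, of (ψ (varElem (coordRing n) i)) := by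
  induction s using Finset.induction_on with
  | empty =>
    have : (sumVar ∅ : coordRing n) = 0 := Subtype.ext (Finset.sum_empty (f := MvPolynomial.X))
    rw [this, map_zero, Finset.sum_empty, of_zero]
  | insert i s hi ih =>
    rw [Finset.sum_insert hi, ← ih, eq_comm, of_add_of]
    refine ψ.map_isSum ⟨?_, (Finset.sum_insert hi).symm⟩
    refine (PartialSubring.generated_admits {∑ i, MvPolynomial.X i} _ rfl).2 _ _ ?_
    have := sum_X_isSubsum (n := n) (insert i s)
    rwa [Finset.sum_insert hi] at this

theorem isDef_sum_hom (ψ : PRingHom (coordRing n) F) :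
    (∑ i, of (ψ (varElem (coordRing n) i))).IsDef := ⟨_, (of_hom_sumVar ψ Finset.univ).symm⟩

/-- Two homomorphisms agree if they agree on the subsums of the generators, because the elements on
which they agree, with the sums of such elements, form a partial subring. -/
theorem PartialSubring.generated_hom_ext {N : Type u} [CommSemiring N] {S : Set N}
    {ψ ψ' : PRingHom (generated S) F}
    (h : ∀ s ∈ S, ∀ (t : generated S), IsSubsum t.1 s → ψ t = ψ' t) : ψ = ψ' := by
  let E : N → Prop := fun f => ∃ hf : f ∈ (generated S).carrier, ψ ⟨f, hf⟩ = ψ' ⟨f, hf⟩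
  have h0 : E 0 := ⟨(generated S).zero_mem, (map_zero ψ).trans (map_zero ψ').symm⟩
  have h1 : E 1 := ⟨(generated S).one_mem, (map_one ψ).trans (map_one ψ').symm⟩
  have hmul : ∀ {a b}, E a → E b → E (a * b) := by
    rintro a b ⟨ha, ea⟩ ⟨hb, eb⟩
    have := map_mul ψ ⟨a, ha⟩ ⟨b, hb⟩
    rw [ea, eb, ← map_mul] at this
    exact ⟨(generated S).mul_mem ha hb, this⟩
  have hadd : ∀ {a b}, (generated S).rel a b → E a → E b → E (a + b) := by
    rintro a b hab ⟨ha, ea⟩ ⟨hb, eb⟩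
    have hs : IsSum (A := generated S) ⟨a, ha⟩ ⟨b, hb⟩ ⟨a + b, (generated S).add_mem hab⟩ :=
      ⟨hab, rfl⟩
    have hψ := ψ.map_isSum hs
    rw [ea, eb] at hψ
    exact ⟨_, isSum_unique hψ (ψ'.map_isSum hs)⟩
  let C : PartialSubring N :=
    { carrier := {f | E f}
      rel := fun a b => (generated S).rel a b ∧ E a ∧ E b
      left_mem := fun h => h.2.1
      add_mem := fun h => hadd h.1 h.2.1 h.2.2
      zero_mem := h0
      one_mem := h1
      mul_mem := hmul
      zero_rel := fun h => ⟨(generated S).zero_rel h.1, h0, h⟩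
      rel_comm := fun h => ⟨(generated S).rel_comm h.1, h.2.2, h.2.1⟩
      rel_assoc := fun h h' =>
        have H := (generated S).rel_assoc h.1 h'.1
        ⟨⟨H.1, h.2.2, h'.2.2⟩, H.2, h.2.1, hadd H.1 h.2.2 h'.2.2⟩
      rel_mul := fun h hx => ⟨(generated S).rel_mul h.1 hx.1, hmul h.2.1 hx, hmul h.2.2 hx⟩ }
  have hC : C.Admits S := by
    intro s hs
    have hE : ∀ t, IsSubsum t s → E t := fun t ht =>
      ⟨(generated_admits S s hs).1 t ht, h s hs ⟨t, _⟩ ht⟩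
    refine ⟨hE, ?_⟩
    rintro a b ⟨u, hu⟩
    exact ⟨(generated_admits S s hs).2 a b ⟨u, hu⟩, hE a ⟨b + u, by rw [← hu, add_assoc]⟩,
      hE b ⟨a + u, by rw [← hu, ← add_assoc, add_comm b]⟩⟩
  exact DFunLike.ext _ _ fun f => (f.2 C hC).2

/-- A homomorphism from the coordinate ring is determined by the values of the variables. -/
theorem coordRing_hom_ext {ψ ψ' : PRingHom (coordRing n) F}
    (h : ∀ i, ψ (varElem (coordRing n) i) = ψ' (varElem (coordRing n) i)) : ψ = ψ' := by
  refine PartialSubring.generated_hom_ext ?_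
  rintro _ rfl t ht
  obtain ⟨s, hs⟩ := exists_eq_sum_X ht
  obtain rfl : t = sumVar s := Subtype.ext hs
  refine of_injective ?_
  have e := of_hom_sumVar ψ s
  simp only [h] at e
  exact e.trans (of_hom_sumVar ψ' s).symm

end SumEval

/-! ### Homomorphisms from the charts -/

section ChartHom

variable {n : ℕ} {B : PartialSubring (NPoly n)} [B.IsHomogeneous] {F : Type v} [PRing F]

theorem chart_hom_ext {i : Fin (n + 1)} {T : Finset (Fin (n + 1))} (hi : i ∈ T)
    {φ φ' : PRingHom (DegZero B T) F} (h : ∀ f, φ (dehom i hi f) = φ' (dehom i hi f)) : φ = φ' := by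
  refine DFunLike.ext _ _ fun x => ?_
  obtain ⟨d, f, g, -, -, hg, hx⟩ := exists_mul_dehom_eq hi x
  have hu : IsUnit (φ (dehom i hi g)) := (isUnit_dehom hi hg).map φ
  refine hu.mul_right_cancel ?_
  rw [← map_mul, hx, h f, ← hx, map_mul, ← h g]

/-- A homomorphism from `B` that sends `yᵢ` to `1` factors over the dehomogenization. -/
theorem exists_chart_hom (ψ : PRingHom B F) {i : Fin (n + 1)} (h : ψ (varElem B i) = 1) :
    ∃ φ : PRingHom (DegZero B {i}) F,
      ∀ f, φ (dehom i (Finset.mem_singleton_self i) f) = ψ f := by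
  have hS : ∀ s ∈ varSubmonoid B {i}, ψ s = 1 := by
    intro s hs
    refine Submonoid.closure_induction (motive := fun s _ => ψ s = 1) ?_ (map_one ψ) ?_ hs
    · rintro b ⟨j, hj, hb⟩
      obtain rfl := Finset.mem_singleton.1 hj
      obtain rfl : b = varElem B j := Subtype.ext hb
      exact h
    · intro a b _ _ ha hb
      rw [map_mul, ha, hb, one_mul]
  let θ : Localization (varSubmonoid B {i}) → F := fun x => x.liftOn (fun f _ => ψ f) (by
    intro a c b d hr
    rw [Localization.r_iff_exists] at hr
    obtain ⟨p, hp⟩ := hr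
    have := congrArg ψ hp
    simpa only [map_mul, hS _ p.2, hS _ b.2, hS _ d.2, one_mul] using this)
  have hθ : ∀ f s, θ (Localization.mk f s) = ψ f := fun _ _ => rfl
  refine ⟨{ toFun := fun x => θ x.1, map_zero' := ?_, map_one' := ?_, map_mul' := ?_,
            map_isSum' := ?_ }, fun f => rfl⟩
  · change θ 0 = 0
    rw [← Localization.mk_zero 1, hθ, map_zero]
  · change θ 1 = 1
    rw [← Localization.mk_one, hθ, map_one]
  · rintro ⟨x, -⟩ ⟨y, -⟩
    change θ (x * y) = θ x * θ y
    induction x using Localization.induction_on with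
    | H x =>
      induction y using Localization.induction_on with
      | H y => rw [Localization.mk_mul, hθ, hθ, hθ, map_mul]
  · rintro x y z ⟨a, b, c, s, hs, ha, hb, hc⟩
    rw [ha, hb, hc, hθ, hθ, hθ]
    exact ψ.map_isSum hs

end ChartHom

/-! ### The points of projective space -/

section ProjectivePoints

variable {n : ℕ} {F : Type v} [PRing F]

theorem leading_index_unique (hF : IsPartialField F) {m : ℕ} {x : Fin m → F} {i j : Fin m}
    (hi : x i = 1 ∧ ∀ k < i, x k = 0) (hj : x j = 1 ∧ ∀ k < j, x k = 0) : i = j := by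
  rcases lt_trichotomy i j with h | h | h
  · exact absurd ((hj.2 i h).symm.trans hi.1) hF.1
  · exact h
  · exact absurd ((hi.2 j h).symm.trans hj.1) hF.1

/-- A normalized tuple with leading entry `xᵢ = 1` defines a homomorphism from the `i`-th chart. -/
theorem exists_normalized_hom (x : NormalizedTuple F (n + 1)) :
    ∃ (i : Fin (n + 1)) (φ : PRingHom (DegZero (coordRing n) {i}) F),
      (∀ k < i, x.1 k = 0) ∧
        ∀ k, φ (dehom i (Finset.mem_singleton_self i) (varElem (coordRing n) k)) = x.1 k := by
  obtain ⟨x, hx, i, hi, hi'⟩ := x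
  obtain ⟨ψ, hψ⟩ := exists_coordRing_hom x hx
  obtain ⟨φ, hφ⟩ := exists_chart_hom ψ ((hψ i).trans hi)
  exact ⟨i, φ, hi', fun k => (hφ _).trans (hψ k)⟩

/-- A normalized tuple determines the homomorphism from the chart given by its leading entry. -/
theorem normalized_hom_ext {i : Fin (n + 1)} {φ φ' : PRingHom (DegZero (coordRing n) {i}) F}
    (h : ∀ k, φ (dehom i (Finset.mem_singleton_self i) (varElem (coordRing n) k)) =
      φ' (dehom i (Finset.mem_singleton_self i) (varElem (coordRing n) k))) : φ = φ' := by
  have : φ.comp (dehom i (Finset.mem_singleton_self i)) =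
      φ'.comp (dehom i (Finset.mem_singleton_self i)) := coordRing_hom_ext h
  exact chart_hom_ext (Finset.mem_singleton_self i) fun f => DFunLike.congr_fun this f

/-- The point `Spec F → ℙⁿ` given by a homomorphism from a chart. -/
noncomputable def projPoint (i : Fin (n + 1)) (φ : PRingHom (DegZero (coordRing n) {i}) F) :
    Points (projectiveSpace n) F :=
  (projGlueData (coordRing n)).specMap i φ

/-- Equal points have the same vanishing coordinates, even if they are given in different charts. -/
theorem projPoint_eq_imp (hF : IsPartialField F) {i j : Fin (n + 1)}
    {φ : PRingHom (DegZero (coordRing n) {i}) F} {φ' : PRingHom (DegZero (coordRing n) {j}) F}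
    (h : projPoint i φ = projPoint j φ') (f : coordRing n) :
    φ (dehom i (Finset.mem_singleton_self i) f) = 0 ↔
      φ' (dehom j (Finset.mem_singleton_self j) f) = 0 := by
  have hb : chartPt (coordRing n) i (PSpec.comap φ hF.point) =
      chartPt (coordRing n) j (PSpec.comap φ' hF.point) :=
    congrArg (fun g : Points (projectiveSpace n) F => g.base hF.point) h
  have := chartPt_eq_chartPt_iff.1 hb
  change f ∈ (chartCone _ i (PSpec.comap φ hF.point)).ideal.carrier ↔ _
  rw [this]
  rfl

/-- Every point of projective space lies in the chart of its first nonvanishing coordinate. -/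
theorem exists_eq_projPoint (hF : IsPartialField F) (f : Points (projectiveSpace n) F) :
    ∃ (i : Fin (n + 1)) (φ : PRingHom (DegZero (coordRing n) {i}) F), f = projPoint i φ ∧
      ∀ k < i, φ (dehom i (Finset.mem_singleton_self i) (varElem (coordRing n) k)) = 0 := by
  obtain ⟨⟨i, p⟩, hp⟩ := Quot.mk_surjective (f.base hF.point)
  let P : PSpec (coordRing n) := chartCone (coordRing n) i p
  obtain ⟨j, hj, hmin⟩ := WellFounded.has_min (wellFounded_lt (α := Fin (n + 1)))
    {k | varElem (coordRing n) k ∈ P.compl} ⟨i, varElem_mem_chartCone_compl i p⟩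
  obtain ⟨q, hq⟩ := exists_chartCone_eq p hj
  have hfq : f.base hF.point = chartPt (coordRing n) j q :=
    hp.symm.trans (chartPt_eq_chartPt_iff.2 hq).symm
  obtain ⟨φ, hφ, hc⟩ := (projFractionSystem (coordRing n)).exists_eq_specMap hF f j q hfq
  refine ⟨j, φ, hφ, fun k hk => ?_⟩
  have hkP : varElem (coordRing n) k ∈ P.ideal.carrier := not_not.1 fun h => hmin k h hk
  have hkP' : varElem (coordRing n) k ∈ (chartCone (coordRing n) j q).ideal.carrier := by
    rw [hq]
    exact hkP
  subst hc
  exact hkP'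

/-- The points of projective space with values in a partial field are the normalized tuples of
homogeneous coordinates. -/
theorem mk_points_projectiveSpace (n : ℕ) (hF : IsPartialField F) :
    Cardinal.mk (Points (projectiveSpace n) F) = ∑ i ∈ Finset.range (n + 1), kappa F ^ i := by
  rw [← mk_normalizedTuple hF (n + 1)]
  choose idx φ hidx hφ using exists_normalized_hom (n := n) (F := F)
  have hlead : ∀ x : NormalizedTuple F (n + 1), x.1 (idx x) = 1 := fun x => by
    rw [← hφ x, dehom_varElem_self, map_one]
  refine (Cardinal.mk_congr (Equiv.ofBijective (fun x => projPoint (idx x) (φ x)) ⟨?_, ?_⟩)).symm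
  · intro x y h
    replace h : projPoint (idx x) (φ x) = projPoint (idx y) (φ y) := h
    have hzero : ∀ k, x.1 k = 0 ↔ y.1 k = 0 := fun k => by
      rw [← hφ x, ← hφ y]
      exact projPoint_eq_imp hF h _
    have hi : idx x = idx y := by
      rcases lt_trichotomy (idx x) (idx y) with h | h | h
      · exact absurd ((hzero _).2 (hidx y _ h) |>.symm.trans (hlead x)) hF.1
      · exact h
      · exact absurd ((hzero _).1 (hidx x _ h) |>.symm.trans (hlead y)) hF.1
    have hx := hφ x
    have hy := hφ y
    generalize φ x = a at h hx
    generalize φ y = b at h hy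
    generalize idx x = i at *
    subst hi
    obtain rfl := (projFractionSystem (coordRing n)).specMap_injective hF _ h
    exact Subtype.ext (funext fun k => (hx k).symm.trans (hy k))
  · intro f
    obtain ⟨i, a, rfl, ha⟩ := exists_eq_projPoint hF f
    let x : NormalizedTuple F (n + 1) :=
      ⟨fun k => a (dehom i (Finset.mem_singleton_self i) (varElem (coordRing n) k)),
        isDef_sum_hom (a.comp (dehom i (Finset.mem_singleton_self i))), i,
        by change a _ = 1; rw [dehom_varElem_self, map_one], ha⟩
    refine ⟨x, ?_⟩
    change projPoint (idx x) (φ x) = projPoint i a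
    have hi : idx x = i := leading_index_unique hF ⟨hlead x, hidx x⟩
      ⟨by change a _ = 1; rw [dehom_varElem_self, map_one], ha⟩
    have hx := hφ x
    generalize φ x = b at hx
    generalize idx x = j at *
    subst hi
    obtain rfl := normalized_hom_ext hx
    rfl

end ProjectivePoints

/-! ### Fields and the field with one element -/

theorem isPartialField_ofField (K : Type u) [Field K] :
    @IsPartialField K (PRing.ofCommSemiring K) :=
  ⟨zero_ne_one, fun _ ha => isUnit_iff_ne_zero.2 ha⟩

theorem kappa_ofField (K : Type u) [Field K] :
    @kappa K (PRing.ofCommSemiring K) = Cardinal.mk K :=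
  Cardinal.mk_congr (Equiv.subtypeUnivEquiv fun x => ⟨1 + x, rfl⟩)

theorem FOne.eq_zero_or_eq_one (a : FOne) : a = 0 ∨ a = 1 := by
  match a with
  | none => exact Or.inl rfl
  | some () => exact Or.inr rfl

theorem isPartialField_FOne : IsPartialField FOne :=
  ⟨fun h => (Option.some_ne_none ()) h.symm, fun a ha =>
    (a.eq_zero_or_eq_one.resolve_left ha) ▸ isUnit_one⟩

theorem kappa_FOne : kappa FOne = 1 := by
  rw [kappa, Cardinal.eq_one_iff_unique]
  have h : ∀ x : FOne, Summ 1 x → x = 0 := by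
    rintro x ⟨c, ⟨h, -⟩ | ⟨h, -⟩⟩
    · exact absurd h.symm isPartialField_FOne.1
    · exact h
  exact ⟨⟨fun x y => Subtype.ext ((h _ x.2).trans (h _ y.2).symm)⟩,
    ⟨⟨0, 1, isSum_comm (zero_isSum 1)⟩⟩⟩

theorem mainTheorem2 (n : ℕ) :
    IsPartialScheme (projectiveSpace n) ∧
    (∀ (F : Type u) [PRing F], IsPartialField F →
      Cardinal.mk (Points (projectiveSpace n) F) = ∑ i ∈ Finset.range (n + 1), kappa F ^ i) ∧
    (∀ (K : Type u) [Field K] [Finite K],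
      letI : PRing K := PRing.ofCommSemiring K
      kappa K = Nat.card K ∧
      Cardinal.mk (Points (projectiveSpace n) K) =
        ((∑ i ∈ Finset.range (n + 1), Nat.card K ^ i : ℕ) : Cardinal.{u})) ∧
    kappa FOne = 1 ∧
    Cardinal.mk (Points (projectiveSpace n) FOne) = ((n + 1 : ℕ) : Cardinal.{0}) := by
  refine ⟨(projFractionSystem (coordRing n)).isPartialScheme,
    fun F _ hF => mk_points_projectiveSpace n hF, fun K _ _ => ?_, kappa_FOne, ?_⟩
  · let _ : PRing K := PRing.ofCommSemiring K
    have hk : kappa K = Nat.card K := (kappa_ofField K).trans Nat.cast_card.symm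
    refine ⟨hk, ?_⟩
    rw [mk_points_projectiveSpace n (isPartialField_ofField K), hk]
    push_cast
    rfl
  · rw [mk_points_projectiveSpace n isPartialField_FOne, kappa_FOne]
    simp
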